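/- All graphs are finite, simple and undirected. A graph $G$ is \emph{outerplanar} if it has a crossing-free embedding in the plane such that all vertices belong to the boundary of the outer (unbounded) face; it is \emph{maximal outerplanar} if it is outerplanar and the addition of any single edge between two distinct non-adjacent vertices results in a graph that is not outerplanar. A set $S \subseteq V(G)$ is a \emph{total dominating set} of $G$ if every vertex of $G$ is adjacent to some vertex in $S$. A total dominating set $S$ is a \emph{secure total dominating set} if for every $u \in V(G) \setminus S$ there is a vertex $v \in S$ such that $uv \in E(G)$ and $(S \setminus \{v\}) \cup \{u\}$ is also a total dominating set of $G$. Theorem. Let $G$ be a maximal outerplanar graph on $n \geq 4$ vertices. Then there exists a secure total dominating set $S$ of $G$ such that $|S| \leq \lfloor 2n/3 \rfloor$ and $S$ contains no vertex of degree $2$ in $G$. -/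

import Mathlib

/-- `A` is a simple (Jordan) arc in the plane with end points `p` and `q`: the image of an injective
continuous map from `[0, 1]` that starts at `p` and ends at `q`. The plane is modelled by `ℂ`. -/
def IsSimpleArc (A : Set ℂ) (p q : ℂ) : Prop :=
  ∃ γ : unitInterval → ℂ, Continuous γ ∧ Function.Injective γ ∧ γ 0 = p ∧ γ 1 = q ∧
    Set.range γ = A

/-- A crossing-free embedding of a graph in the plane: vertices are distinct points, edges are
simple arcs between their end points, an arc meets no vertex other than its two end points, and
two different arcs meet only in common end vertices. The values of `arc` off the edge set are
irrelevant. -/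
structure PlaneEmbedding {V : Type*} (G : SimpleGraph V) where
  point : V → ℂ
  arc : Sym2 V → Set ℂ
  point_injective : Function.Injective point
  isSimpleArc : ∀ u v : V, G.Adj u v → IsSimpleArc (arc s(u, v)) (point u) (point v)
  vertex_of_mem_arc : ∀ e ∈ G.edgeSet, ∀ w : V, point w ∈ arc e → w ∈ e
  crossing_free : ∀ e ∈ G.edgeSet, ∀ f ∈ G.edgeSet, e ≠ f →
    ∀ z ∈ arc e ∩ arc f, ∃ w : V, w ∈ e ∧ w ∈ f ∧ point w = z

/-- The set of all points of the plane that are covered by the drawing. -/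
def PlaneEmbedding.support {V : Type*} {G : SimpleGraph V} (D : PlaneEmbedding G) : Set ℂ :=
  Set.range D.point ∪ ⋃ e ∈ G.edgeSet, D.arc e

/-- The outer face: the unbounded connected component of the complement of the drawing (for a
finite graph the drawing is compact, so there is exactly one such component). -/
def PlaneEmbedding.outerFace {V : Type*} {G : SimpleGraph V} (D : PlaneEmbedding G) : Set ℂ :=
  {z | z ∈ D.supportᶜ ∧ ¬ Bornology.IsBounded (connectedComponentIn D.supportᶜ z)}

/-- A graph is outerplanar if it has a crossing-free embedding in the plane such that all vertices
belong to the boundary of the outer face. -/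
def SimpleGraph.IsOuterplanar {V : Type*} (G : SimpleGraph V) : Prop :=
  ∃ D : PlaneEmbedding G, ∀ v : V, D.point v ∈ frontier D.outerFace

/-- A maximal outerplanar graph: an outerplanar graph such that the addition of any single edge
results in a graph that is not outerplanar. -/
def SimpleGraph.IsMaximalOuterplanar {V : Type*} (G : SimpleGraph V) : Prop :=
  G.IsOuterplanar ∧
    ∀ u v : V, u ≠ v → ¬ G.Adj u v → ¬ (G ⊔ SimpleGraph.edge u v).IsOuterplanar

/-- A total dominating set: every vertex is adjacent to some vertex of `S`. -/
def SimpleGraph.IsTotalDominatingSet {V : Type*} (G : SimpleGraph V) (S : Set V) : Prop :=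
  ∀ u : V, ∃ v ∈ S, G.Adj u v

/-- A secure total dominating set: a total dominating set `S` such that every `u ∉ S` has a
neighbour `v ∈ S` for which `(S \ {v}) ∪ {u}` is again a total dominating set. -/
def SimpleGraph.IsSecureTotalDominatingSet {V : Type*} (G : SimpleGraph V) (S : Set V) : Prop :=
  G.IsTotalDominatingSet S ∧
    ∀ u : V, u ∉ S → ∃ v ∈ S, G.Adj u v ∧ G.IsTotalDominatingSet ((S \ {v}) ∪ {u})

/-!
The proof has a topological part, which turns a maximal outerplanar graph into a triangulated
polygon, and a combinatorial part, which finds the dominating set there.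

*Outerplanar graphs have a noncrossing vertex order.* In an outerplanar drawing the outer face
touches all vertices. Hence no two vertices are joined by three internally disjoint paths with
interior vertices (`PlaneEmbedding.false_of_three_paths`), and no two chords of a cycle cross
(`PlaneEmbedding.false_of_crossing_chords`). Both follow from two facts about plane curves: a simple
closed curve separates the plane, and all its points are limits of a face other than a given one
(`IsLoop.exists_other_component`), and Janiszewski's theorem `NotSep.union`. These rest on
Eilenberg's criterion: a compact set `K` separates `p` from `q` if and only if `(z - p) / (z - q)`
has no continuous logarithm on `K`. A graph without the two forbidden configurations is glued at cut
vertices from graphs that are spanned by a cycle without crossing chords, so that its vertices can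
be ordered with no two edges crossing (`exists_nonCrossing`).

*Maximal outerplanar graphs are triangulated polygons.* Conversely a graph with a noncrossing order
is outerplanar: put the vertices on a parabola and join them by segments
(`isOuterplanar_of_noncrossing`). So a maximal outerplanar graph is a maximal set of noncrossing
sides and diagonals of a polygon (`SimpleGraph.IsMaximalOuterplanar.exists_isTriangulation`).

*Three classes.* Let there be at least five vertices, with a proper `3`-colouring. The ears, which
are the vertices of degree two, form a set `D`; let `N` be the set of their neighbours. For each
colour `j` a set `finalSet j` is defined whose complement is a secure total dominating set, and
`|V| ≤ ∑ j, |finalSet j|`; so one of the three complements has at most two thirds of the vertices.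
Since every `finalSet j` contains `D`, the complements contain no vertex of degree two.

The starting point is `baseSet j`, the union of `D` and the vertices of colour `j` outside `N`. The
sizes of these sets add up to `3 |D| + (|V| - |D| - |N|)`, that is, to `|V|` plus the number of
vertices between two ears. After the removal of `baseSet j` a vertex has at least two remaining
neighbours, except in two configurations around a vertex of degree three. The first one, the pivots,
is resolved by an exchange of vertices that keeps the size (`shiftedSet`). The other one, the flaps,
is harmless for domination, as the remaining neighbour of a flap belongs to `N`
(`IsColouredPolygon.exists_two_or_flap`). It can only spoil the exchange property at a removed vertex
`u`, which is then called bad. All remaining neighbours of a bad vertex lie in `N`. If `u` is not an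
ear, it may be moved to the class of another colour, because there the flaps in question and their
ends are not removed. If `u` is an ear, then it has a neighbour between two ears, and the class gives one
vertex back; the surplus in the count pays for it.
-/

open Set Topology

/-! ### Continuous logarithms -/

/-- The function `f` has a continuous logarithm on the set `K`. -/
def HasLogOn (f : ℂ → ℂ) (K : Set ℂ) : Prop :=
  ∃ L : ℂ → ℂ, ContinuousOn L K ∧ ∀ z ∈ K, Complex.exp (L z) = f z

lemma HasLogOn.congr {f g : ℂ → ℂ} {K : Set ℂ} (h : HasLogOn f K) (hfg : EqOn f g K) :
    HasLogOn g K := by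
  obtain ⟨L, hL, hf⟩ := h
  exact ⟨L, hL, fun z hz => (hf z hz).trans (hfg hz)⟩

lemma HasLogOn.mul {f g : ℂ → ℂ} {K : Set ℂ} (hf : HasLogOn f K) (hg : HasLogOn g K) :
    HasLogOn (fun z => f z * g z) K := by
  obtain ⟨L, hL, hf⟩ := hf
  obtain ⟨M, hM, hg⟩ := hg
  exact ⟨fun z => L z + M z, hL.add hM, fun z hz => by rw [Complex.exp_add, hf z hz, hg z hz]⟩

lemma HasLogOn.inv {f : ℂ → ℂ} {K : Set ℂ} (hf : HasLogOn f K) :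
    HasLogOn (fun z => (f z)⁻¹) K := by
  obtain ⟨L, hL, hf⟩ := hf
  exact ⟨fun z => - L z, hL.neg, fun z hz => by rw [Complex.exp_neg, hf z hz]⟩

/-- A non-vanishing function on a simply connected space has a continuous logarithm. -/
lemma exists_continuousMap_exp_eq {X : Type*} [TopologicalSpace X] [SimplyConnectedSpace X]
    [LocallyPathConnectedSpace X] (f : C(X, ℂ)) (hf : ∀ x, f x ≠ 0) :
    ∃ F : C(X, ℂ), ∀ x, Complex.exp (F x) = f x := by
  obtain ⟨x₀⟩ : Nonempty X := inferInstance
  obtain ⟨F, ⟨-, hF⟩, -⟩ := Complex.isCoveringMapOn_exp.existsUnique_continuousMap_lifts f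
    (Complex.exp_log (hf x₀)) (fun x => by simpa using hf x)
  exact ⟨F, fun x => congrFun hF x⟩

/-- On a preconnected set, two continuous logarithms of the same function which agree at one point
agree everywhere. -/
lemma eqOn_of_exp_eqOn {X : Type*} [TopologicalSpace X] {s : Set X} (hs : IsPreconnected s)
    {f g : X → ℂ} (hf : ContinuousOn f s) (hg : ContinuousOn g s)
    (hfg : ∀ x ∈ s, Complex.exp (f x) = Complex.exp (g x)) {a : X} (ha : a ∈ s)
    (hag : f a = g a) : EqOn f g s :=
  Complex.isCoveringMap_exp.eqOn_of_comp_eqOn hs hf hg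
    (fun x hx => Subtype.ext (hfg x hx)) ha hag

/-- A continuous function on a preconnected set whose exponential is constant is constant. -/
lemma eq_of_exp_eq_const {X : Type*} [TopologicalSpace X] {s : Set X} (hs : IsPreconnected s)
    {f : X → ℂ} (hf : ContinuousOn f s) {c : ℂ} (hfc : ∀ x ∈ s, Complex.exp (f x) = c)
    {a b : X} (ha : a ∈ s) (hb : b ∈ s) : f a = f b :=
  (eqOn_of_exp_eqOn hs hf (continuousOn_const (c := f a))
    (fun x hx => by rw [hfc x hx, hfc a ha]) ha rfl hb).symm

/-- A continuous map which agrees with `z ↦ z - p` far away from `p` must vanish somewhere: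
otherwise it would have a logarithm, and hence so would the identity on a large circle. -/
lemma exists_eq_zero_of_eq_sub_of_large {h : ℂ → ℂ} (hc : Continuous h) {p : ℂ} {R : ℝ}
    (hR : ∀ z, R ≤ ‖z - p‖ → h z = z - p) : ∃ z, h z = 0 := by
  by_contra! hne
  obtain ⟨H, hexp⟩ := exists_continuousMap_exp_eq ⟨h, hc⟩ hne
  set r : ℝ := max R 1 with hr
  have hr0 : (0:ℝ) < r := lt_of_lt_of_le one_pos (le_max_right _ _)
  let c : ℝ → ℂ := fun t => p + r * Complex.exp (t * Complex.I)
  have hc' : Continuous c := by fun_prop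
  have key : ∀ t : ℝ, Complex.exp (H (c t) - t * Complex.I) = r := by
    intro t
    have h1 : Complex.exp (H (c t)) = r * Complex.exp (t * Complex.I) := by
      rw [hexp, ContinuousMap.coe_mk, hR]
      · simp [c]
      · simp only [c, add_sub_cancel_left, norm_mul, Complex.norm_exp_ofReal_mul_I, mul_one,
          Complex.norm_real, Real.norm_eq_abs, abs_of_pos hr0]
        exact le_max_left _ _
    rw [Complex.exp_sub, h1, mul_div_assoc, div_self (Complex.exp_ne_zero _), mul_one]
  have := eq_of_exp_eq_const (s := (univ : Set ℝ)) isPreconnected_univ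
    (f := fun t => H (c t) - t * Complex.I) (by fun_prop) (fun t _ => key t)
    (mem_univ 0) (mem_univ (2 * Real.pi))
  have hcc : c 0 = c (2 * Real.pi) := by simp [c, Complex.exp_two_pi_mul_I]
  simp only [hcc, Complex.ofReal_zero, zero_mul, sub_zero] at this
  have h0 := sub_eq_self.1 this.symm
  simp [Real.pi_ne_zero] at h0

/-! ### Components of the complement of a compact set -/

lemma frontier_connectedComponentIn_subset {K : Set ℂ} (hK : IsClosed K) (p : ℂ) :
    frontier (connectedComponentIn Kᶜ p) ⊆ K := by
  intro z hz
  by_contra hzK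
  have hV : IsOpen (connectedComponentIn Kᶜ z) := hK.isOpen_compl.connectedComponentIn
  have hU : IsOpen (connectedComponentIn Kᶜ p) := hK.isOpen_compl.connectedComponentIn
  obtain ⟨w, hwV, hwU⟩ := mem_closure_iff.1 hz.1 _ hV (mem_connectedComponentIn hzK)
  have h1 := connectedComponentIn_eq hwV
  have h2 := connectedComponentIn_eq hwU
  have : z ∈ connectedComponentIn Kᶜ p := by
    rw [h2, ← h1]; exact mem_connectedComponentIn hzK
  rw [hU.frontier_eq] at hz
  exact hz.2 this

/-- The complement of a disc is connected. -/
lemma isPreconnected_setOf_lt_norm {R : ℝ} (hR : 0 ≤ R) : IsPreconnected {z : ℂ | R < ‖z‖} := by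
  have : {z : ℂ | R < ‖z‖} =
      (fun x : ℝ × ℝ => (x.1 : ℂ) * Complex.exp (x.2 * Complex.I)) '' (Ioi R ×ˢ univ) := by
    ext z
    constructor
    · intro hz
      exact ⟨(‖z‖, z.arg), ⟨hz, mem_univ _⟩, Complex.norm_mul_exp_arg_mul_I z⟩
    · rintro ⟨⟨r, t⟩, ⟨hr, -⟩, rfl⟩
      have hr' : R < r := hr
      simpa [Complex.norm_exp_ofReal_mul_I, abs_of_pos (hR.trans_lt hr')] using hr'
  rw [this]
  exact (isPreconnected_Ioi.prod isPreconnected_univ).image _ (by fun_prop)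

/-- A bounded set has only one unbounded complementary component. -/
lemma mem_connectedComponentIn_of_not_isBounded {K : Set ℂ} (hK : Bornology.IsBounded K) {p q : ℂ}
    (hq : q ∉ K)
    (hpU : ¬ Bornology.IsBounded (connectedComponentIn Kᶜ p))
    (hqU : ¬ Bornology.IsBounded (connectedComponentIn Kᶜ q)) :
    q ∈ connectedComponentIn Kᶜ p := by
  obtain ⟨R, hR0, hR⟩ := hK.exists_pos_norm_le
  have hO : {z : ℂ | R < ‖z‖} ⊆ Kᶜ := fun z hz hzK => not_lt.2 (hR z hzK) hz
  have aux : ∀ x, ¬ Bornology.IsBounded (connectedComponentIn Kᶜ x) →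
      {z : ℂ | R < ‖z‖} ⊆ connectedComponentIn Kᶜ x := by
    intro x hx
    obtain ⟨w, hw, hwR⟩ : ∃ w ∈ connectedComponentIn Kᶜ x, R < ‖w‖ := by
      by_contra! hcon
      exact hx (isBounded_iff_forall_norm_le.2 ⟨R, hcon⟩)
    rw [connectedComponentIn_eq hw]
    exact (isPreconnected_setOf_lt_norm hR0.le).subset_connectedComponentIn hwR hO
  have hw : ((R + 1 : ℝ) : ℂ) ∈ {z : ℂ | R < ‖z‖} := by
    simp only [mem_ofPred_eq, Complex.norm_real, Real.norm_eq_abs]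
    rw [abs_of_pos (by linarith)]; linarith
  rw [connectedComponentIn_eq (aux p hpU hw), ← connectedComponentIn_eq (aux q hqU hw)]
  exact mem_connectedComponentIn hq

/-- The points `p` and `q` are not separated by `K` if they lie in one component of `Kᶜ`. -/
def NotSep (K : Set ℂ) (p q : ℂ) : Prop := p ∉ K ∧ q ∈ connectedComponentIn Kᶜ p

lemma NotSep.right {K : Set ℂ} {p q : ℂ} (h : NotSep K p q) : q ∉ K :=
  connectedComponentIn_subset _ _ h.2

lemma NotSep.symm {K : Set ℂ} {p q : ℂ} (h : NotSep K p q) : NotSep K q p :=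
  ⟨h.right, by rw [← connectedComponentIn_eq h.2]; exact mem_connectedComponentIn h.1⟩

lemma NotSep.trans {K : Set ℂ} {p q r : ℂ} (h : NotSep K p q) (h' : NotSep K q r) :
    NotSep K p r :=
  ⟨h.1, by rw [connectedComponentIn_eq h.2]; exact h'.2⟩

lemma NotSep.mono {K K' : Set ℂ} {p q : ℂ} (h : NotSep K p q) (hK : K' ⊆ K) : NotSep K' p q :=
  ⟨fun hp => h.1 (hK hp), connectedComponentIn_mono _ (compl_subset_compl.2 hK) h.2⟩

lemma notSep_of_isPreconnected {K X : Set ℂ} (hX : IsPreconnected X) (hXK : Disjoint X K)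
    {p q : ℂ} (hp : p ∈ X) (hq : q ∈ X) : NotSep K p q :=
  ⟨disjoint_left.1 hXK hp,
    hX.subset_connectedComponentIn hp (subset_compl_iff_disjoint_right.2 hXK) hq⟩

/-- Eilenberg's criterion, one direction: along a component of the complement of `K` the points
may be moved, one into the other, by small steps `p → q`, for which `(z - p) / (z - q)` is close to
`1`. -/
lemma NotSep.hasLogOn {K : Set ℂ} (hK : IsClosed K) {p q : ℂ} (h : NotSep K p q) :
    HasLogOn (fun z => (z - p) / (z - q)) K := by
  have hU : IsOpen Kᶜ := hK.isOpen_compl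
  -- the classes of points related by the existence of a logarithm are open
  have loc : ∀ q ∉ K, ∀ᶠ q' in 𝓝 q, q' ∉ K ∧ HasLogOn (fun z => (z - q) / (z - q')) K := by
    intro q hq
    obtain ⟨ε, hε, hball⟩ := Metric.isOpen_iff.1 hU q hq
    filter_upwards [Metric.ball_mem_nhds q (half_pos hε)] with q' hq'
    have hq'K : q' ∉ K := hball (Metric.ball_subset_ball (half_le_self hε.le) hq')
    have hne : ∀ z ∈ K, z - q' ≠ 0 := fun z hz h0 => hq'K (by rwa [← sub_eq_zero.1 h0])
    have hs : ∀ z ∈ K, (z - q) / (z - q') ∈ Complex.slitPlane := by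
      intro z hz
      have h1 : (z - q) / (z - q') = 1 + (q' - q) / (z - q') := by
        field_simp [hne z hz]; ring
      rw [h1]
      apply Complex.mem_slitPlane_of_norm_lt_one
      have h2 : ε ≤ ‖z - q‖ := by
        by_contra! hlt
        exact hball (mem_ball_iff_norm.2 hlt) hz
      have h3 : ‖q' - q‖ < ε / 2 := mem_ball_iff_norm.1 hq'
      have h4 : ‖z - q‖ ≤ ‖z - q'‖ + ‖q' - q‖ := by
        simpa using norm_add_le (z - q') (q' - q)
      rw [norm_div, div_lt_one (norm_pos_iff.2 (hne z hz))]
      linarith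
    refine ⟨hq'K, fun z => Complex.log ((z - q) / (z - q')), ?_, fun z hz => ?_⟩
    · exact ContinuousOn.clog (by
        apply ContinuousOn.div (by fun_prop) (by fun_prop) hne) hs
    · exact Complex.exp_log (Complex.slitPlane_ne_zero (hs z hz))
  have trans : ∀ a b c, b ∉ K → HasLogOn (fun z => (z - a) / (z - b)) K →
      HasLogOn (fun z => (z - b) / (z - c)) K → HasLogOn (fun z => (z - a) / (z - c)) K := by
    intro a b c hb h1 h2
    refine (h1.mul h2).congr fun z hz => ?_
    have : z - b ≠ 0 := fun h0 => hb (by rwa [← sub_eq_zero.1 h0])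
    simp only
    field_simp
  have symm : ∀ a b, HasLogOn (fun z => (z - a) / (z - b)) K →
      HasLogOn (fun z => (z - b) / (z - a)) K := by
    intro a b h1
    exact h1.inv.congr fun z _ => by simp
  set C := connectedComponentIn Kᶜ p with hC
  by_contra hcon
  have hpre : IsPreconnected C := isPreconnected_connectedComponentIn
  have hCK : C ⊆ Kᶜ := connectedComponentIn_subset _ _
  let u : Set ℂ := {q | q ∉ K ∧ HasLogOn (fun z => (z - p) / (z - q)) K}
  let v : Set ℂ := {q | q ∉ K ∧ ¬ HasLogOn (fun z => (z - p) / (z - q)) K}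
  have hu : IsOpen u := isOpen_iff_mem_nhds.2 fun q hq => by
    filter_upwards [loc q hq.1] with q' hq'
    exact ⟨hq'.1, trans _ _ _ hq.1 hq.2 hq'.2⟩
  have hv : IsOpen v := isOpen_iff_mem_nhds.2 fun q hq => by
    filter_upwards [loc q hq.1] with q' hq'
    exact ⟨hq'.1, fun hl => hq.2 (trans _ _ _ hq'.1 hl (symm _ _ hq'.2))⟩
  have hp : HasLogOn (fun z => (z - p) / (z - p)) K := by
    refine ⟨fun _ => 0, continuousOn_const, fun z hz => ?_⟩
    have : z - p ≠ 0 := fun h0 => h.1 (by rwa [← sub_eq_zero.1 h0])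
    simp [this]
  obtain ⟨x, -, hxu, hxv⟩ := hpre u v hu hv (fun x hx => by
      by_cases hl : HasLogOn (fun z => (z - p) / (z - x)) K
      · exact Or.inl ⟨hCK hx, hl⟩
      · exact Or.inr ⟨hCK hx, hl⟩)
    ⟨p, mem_connectedComponentIn h.1, h.1, hp⟩ ⟨q, h.2, h.right, hcon⟩
  exact hxv.2 hxu.2

lemma HasLogOn.mem_of_isBounded {K : Set ℂ} (hK : IsCompact K) {p q : ℂ} (hp : p ∉ K)
    (h : HasLogOn (fun z => (z - p) / (z - q)) K)
    (hU : Bornology.IsBounded (connectedComponentIn Kᶜ p)) :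
    q ∈ connectedComponentIn Kᶜ p ∨ q ∈ K := by
  classical
  by_contra! hq
  obtain ⟨hqU, hqK⟩ := hq
  set U := connectedComponentIn Kᶜ p with hUdef
  obtain ⟨L, hL, hLexp⟩ := h
  -- Tietze extension of the logarithm
  obtain ⟨M, hM⟩ := ContinuousMap.exists_restrict_eq hK.isClosed
    (⟨K.domRestrict L, continuousOn_iff_continuous_domRestrict.1 hL⟩ : C(K, ℂ))
  have hMK : ∀ z ∈ K, Complex.exp (M z) = (z - p) / (z - q) := by
    intro z hz
    have : M z = L z := by
      exact congrArg (fun g : C(K, ℂ) => g ⟨z, hz⟩) hM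
    rw [this, hLexp z hz]
  let f : ℂ → ℂ := fun z => if z ∈ U then (z - q) * Complex.exp (M z) else z - p
  have hf : Continuous f := by
    refine continuous_if (fun z hz => ?_) (by fun_prop) (by fun_prop)
    have hzK : z ∈ K := frontier_connectedComponentIn_subset hK.isClosed p hz
    have : z - q ≠ 0 := fun h0 => hqK (by rwa [← sub_eq_zero.1 h0])
    rw [hMK z hzK]; field_simp
  obtain ⟨R, hR⟩ := hU.exists_norm_le
  obtain ⟨z, hz⟩ := exists_eq_zero_of_eq_sub_of_large (p := p) (R := R + 1 + ‖p‖) hf (by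
    intro z hz
    apply if_neg
    intro hzU
    have h1 := hR z hzU
    have h2 := norm_sub_le z p
    linarith)
  by_cases hzU : z ∈ U
  · simp only [f, if_pos hzU, mul_eq_zero, Complex.exp_ne_zero, or_false] at hz
    exact hqU (by rwa [← sub_eq_zero.1 hz])
  · simp only [f, if_neg hzU] at hz
    rw [sub_eq_zero.1 hz] at hzU
    exact hzU (mem_connectedComponentIn hp)

/-- Eilenberg's criterion, the other direction: if `p` and `q` were separated by `K`, one of them
would lie in a bounded component `U`, and the extended logarithm would allow to change `z - p`
inside `U` to a function without zeros. -/
lemma HasLogOn.notSep {K : Set ℂ} (hK : IsCompact K) {p q : ℂ} (hp : p ∉ K) (hq : q ∉ K)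
    (h : HasLogOn (fun z => (z - p) / (z - q)) K) : NotSep K p q := by
  by_cases hpU : Bornology.IsBounded (connectedComponentIn Kᶜ p)
  · exact ⟨hp, (h.mem_of_isBounded hK hp hpU).resolve_right hq⟩
  by_cases hqU : Bornology.IsBounded (connectedComponentIn Kᶜ q)
  · have h' : HasLogOn (fun z => (z - q) / (z - p)) K := h.inv.congr fun z _ => by simp
    exact NotSep.symm ⟨hq, (h'.mem_of_isBounded hK hq hqU).resolve_right hp⟩
  · exact ⟨hp, mem_connectedComponentIn_of_not_isBounded hK.isBounded hq hpU hqU⟩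

/-- Logarithms on two closed sets with connected intersection may be glued, as their difference is
constant on the intersection. -/
lemma HasLogOn.union {f : ℂ → ℂ} {K₁ K₂ : Set ℂ} (h₁ : HasLogOn f K₁) (h₂ : HasLogOn f K₂)
    (hK₁ : IsClosed K₁) (hK₂ : IsClosed K₂) (hc : IsConnected (K₁ ∩ K₂)) :
    HasLogOn f (K₁ ∪ K₂) := by
  classical
  obtain ⟨L, hL, hLf⟩ := h₁
  obtain ⟨M, hM, hMf⟩ := h₂
  obtain ⟨a, ha⟩ := hc.nonempty
  have key : EqOn L (fun z => M z + (L a - M a)) (K₁ ∩ K₂) := by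
    refine eqOn_of_exp_eqOn hc.isPreconnected (hL.mono inter_subset_left)
      ((hM.mono inter_subset_right).add continuousOn_const) (fun z hz => ?_) ha (by ring)
    rw [Complex.exp_add, Complex.exp_sub, hLf z hz.1, hMf z hz.2, hLf a ha.1, hMf a ha.2, div_self,
      mul_one]
    rw [← hLf a ha.1]; exact Complex.exp_ne_zero _
  refine ⟨K₁.piecewise L (fun z => M z + (L a - M a)), ?_, ?_⟩
  · apply ContinuousOn.union_of_isClosed _ _ hK₁ hK₂
    · exact hL.congr (piecewise_eqOn _ _ _)
    · refine (hM.add (continuousOn_const (c := L a - M a))).congr fun z hz => ?_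
      by_cases hz1 : z ∈ K₁
      · rw [piecewise_eq_of_mem _ _ _ hz1]; exact key ⟨hz1, hz⟩
      · rw [piecewise_eq_of_notMem _ _ _ hz1]; rfl
  · intro z hz
    by_cases hz1 : z ∈ K₁
    · rw [piecewise_eq_of_mem _ _ _ hz1]; exact hLf z hz1
    · rw [piecewise_eq_of_notMem _ _ _ hz1, Complex.exp_add, Complex.exp_sub,
        hMf z (hz.resolve_left hz1), hLf a ha.1, hMf a ha.2, div_self, mul_one]
      rw [← hLf a ha.1]; exact Complex.exp_ne_zero _

/-- Janiszewski's theorem. -/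
lemma NotSep.union {K₁ K₂ : Set ℂ} (hK₁ : IsCompact K₁) (hK₂ : IsCompact K₂)
    (hc : IsConnected (K₁ ∩ K₂)) {p q : ℂ} (h₁ : NotSep K₁ p q) (h₂ : NotSep K₂ p q) :
    NotSep (K₁ ∪ K₂) p q := by
  refine HasLogOn.notSep (hK₁.union hK₂) (fun h => h.elim h₁.1 h₂.1)
    (fun h => h.elim h₁.right h₂.right) ?_
  exact (h₁.hasLogOn hK₁.isClosed).union (h₂.hasLogOn hK₂.isClosed) hK₁.isClosed hK₂.isClosed hc

/-! ### Arcs and closed curves -/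

/-- A compact connected set on which every non-vanishing continuous function has a logarithm, like
an arc. -/
structure IsLogGood (K : Set ℂ) : Prop where
  isCompact : IsCompact K
  isConnected : IsConnected K
  hasLogOn : ∀ f : ℂ → ℂ, ContinuousOn f K → (∀ z ∈ K, f z ≠ 0) → HasLogOn f K

lemma IsLogGood.notSep {K : Set ℂ} (hK : IsLogGood K) {p q : ℂ} (hp : p ∉ K) (hq : q ∉ K) :
    NotSep K p q := by
  have h1 : ∀ z ∈ K, z - p ≠ 0 := fun z hz h0 => hp (by rwa [← sub_eq_zero.1 h0])
  have h2 : ∀ z ∈ K, z - q ≠ 0 := fun z hz h0 => hq (by rwa [← sub_eq_zero.1 h0])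
  exact HasLogOn.notSep hK.isCompact hp hq (hK.hasLogOn _
    (ContinuousOn.div (by fun_prop) (by fun_prop) h2) fun z hz => div_ne_zero (h1 z hz) (h2 z hz))

lemma IsLogGood.union {K₁ K₂ : Set ℂ} (h₁ : IsLogGood K₁) (h₂ : IsLogGood K₂) {a : ℂ}
    (ha : K₁ ∩ K₂ = {a}) : IsLogGood (K₁ ∪ K₂) where
  isCompact := h₁.isCompact.union h₂.isCompact
  isConnected := h₁.isConnected.union ⟨a, ha ▸ mem_singleton a⟩ h₂.isConnected
  hasLogOn f hf h0 :=
    (h₁.hasLogOn f (hf.mono subset_union_left) fun z hz => h0 z (Or.inl hz)).union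
      (h₂.hasLogOn f (hf.mono subset_union_right) fun z hz => h0 z (Or.inr hz))
      h₁.isCompact.isClosed h₂.isCompact.isClosed (ha ▸ isConnected_singleton)

lemma isLogGood_image_Icc {c : ℝ → ℂ} (hc : Continuous c) {a b : ℝ} (hab : a ≤ b)
    (hinj : InjOn c (Icc a b)) : IsLogGood (c '' Icc a b) where
  isCompact := isCompact_Icc.image hc
  isConnected := (isConnected_Icc hab).image _ hc.continuousOn
  hasLogOn f hf h0 := by
    classical
    have hcl : Continuous fun t : ℝ => f (c (projIcc a b hab t)) :=
      hf.comp_continuous (by fun_prop) fun t => mem_image_of_mem _ (projIcc a b hab t).2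
    obtain ⟨F, hF⟩ := exists_continuousMap_exp_eq (X := ℝ) ⟨_, hcl⟩
      fun t => h0 _ (mem_image_of_mem _ (projIcc a b hab t).2)
    -- the inverse of the homeomorphism `c` between `[a, b]` and its image
    let e : Icc a b → c '' Icc a b := fun t => ⟨c t, mem_image_of_mem _ t.2⟩
    have he : Continuous e := by fun_prop
    have hbij : Function.Bijective e :=
      ⟨fun s t hst => Subtype.ext (hinj s.2 t.2 (congrArg Subtype.val hst)),
        fun ⟨_, t, ht, h⟩ => ⟨⟨t, ht⟩, Subtype.ext h⟩⟩
    let E := Continuous.homeoOfEquivCompactToT2 (f := Equiv.ofBijective e hbij) he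
    let L : ℂ → ℂ := fun z => if hz : z ∈ c '' Icc a b then F (E.symm ⟨z, hz⟩ : ℝ) else 0
    refine ⟨L, ?_, ?_⟩
    · rw [continuousOn_iff_continuous_domRestrict]
      have : (c '' Icc a b).domRestrict L = fun z => F (E.symm z : ℝ) := by
        ext z; exact dif_pos z.2
      rw [this]
      fun_prop
    · intro z hz
      simp only [L, dif_pos hz, hF, ContinuousMap.coe_mk]
      rw [projIcc_val]
      exact congrArg f (congrArg Subtype.val (E.apply_symm_apply ⟨z, hz⟩))

/-- A parametrization of a simple closed curve by the interval `[0, 2]`. -/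
structure IsLoop (c : ℝ → ℂ) : Prop where
  continuous : Continuous c
  closed : c 0 = c 2
  injOn : InjOn c (Ico 0 2)

lemma IsLoop.eq_or {c : ℝ → ℂ} (hc : IsLoop c) {s t : ℝ} (hs : s ∈ Icc (0:ℝ) 2)
    (ht : t ∈ Icc (0:ℝ) 2) (hst : s < t) (h : c s = c t) : s = 0 ∧ t = 2 := by
  rcases ht.2.lt_or_eq with h2 | h2
  · exact absurd (hc.injOn ⟨hs.1, hst.trans h2⟩ ⟨ht.1, h2⟩ h) hst.ne
  · subst h2
    exact ⟨hc.injOn ⟨hs.1, hst⟩ ⟨le_rfl, by norm_num⟩ (h.trans hc.closed.symm), rfl⟩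

lemma IsLoop.injOn_Icc {c : ℝ → ℂ} (hc : IsLoop c) {a b : ℝ} (ha : 0 ≤ a) (hb : b ≤ 2)
    (hab : 0 < a ∨ b < 2) : InjOn c (Icc a b) := by
  intro s hs t ht h
  have hs' : s ∈ Icc (0:ℝ) 2 := ⟨ha.trans hs.1, hs.2.trans hb⟩
  have ht' : t ∈ Icc (0:ℝ) 2 := ⟨ha.trans ht.1, ht.2.trans hb⟩
  rcases lt_trichotomy s t with hlt | heq | hlt
  · obtain ⟨rfl, rfl⟩ := hc.eq_or hs' ht' hlt h
    rcases hab with h' | h'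
    · exact absurd hs.1 (not_le.2 h')
    · exact absurd ht.2 (not_le.2 h')
  · exact heq
  · obtain ⟨rfl, rfl⟩ := hc.eq_or ht' hs' hlt h.symm
    rcases hab with h' | h'
    · exact absurd ht.1 (not_le.2 h')
    · exact absurd hs.2 (not_le.2 h')

lemma IsLoop.isLogGood_inner {c : ℝ → ℂ} (hc : IsLoop c) {a b : ℝ} (ha : 0 ≤ a) (hab : a ≤ b)
    (hb : b ≤ 2) (h : 0 < a ∨ b < 2) : IsLogGood (c '' Icc a b) :=
  isLogGood_image_Icc hc.continuous hab (hc.injOn_Icc ha hb h)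

lemma IsLoop.isLogGood_outer {c : ℝ → ℂ} (hc : IsLoop c) {a b : ℝ} (ha : 0 ≤ a) (hab : a < b)
    (hb : b ≤ 2) : IsLogGood (c '' Icc 0 a ∪ c '' Icc b 2) := by
  refine (hc.isLogGood_inner le_rfl ha (hab.le.trans hb) (Or.inr (hab.trans_le hb))).union
    (hc.isLogGood_inner (ha.trans hab.le) hb le_rfl (Or.inl (ha.trans_lt hab))) (a := c 0) ?_
  ext z
  constructor
  · rintro ⟨⟨s, hs, rfl⟩, t, ht, hst⟩
    obtain ⟨rfl, rfl⟩ := hc.eq_or ⟨hs.1, hs.2.trans (hab.le.trans hb)⟩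
      ⟨ha.trans (hab.le.trans ht.1), ht.2⟩ (hs.2.trans_lt (hab.trans_le ht.1)) hst.symm
    rfl
  · rintro rfl
    exact ⟨⟨0, ⟨le_rfl, ha⟩, rfl⟩, 2, ⟨hb, le_rfl⟩, hc.closed.symm⟩

/-- Two points cut a simple closed curve into two arcs. -/
lemma IsLoop.exists_split {c : ℝ → ℂ} (hc : IsLoop c) {x y : ℂ} (hx : x ∈ c '' Icc 0 2)
    (hy : y ∈ c '' Icc 0 2) (hxy : x ≠ y) :
    ∃ J₁ J₂, IsLogGood J₁ ∧ IsLogGood J₂ ∧ J₁ ∪ J₂ = c '' Icc 0 2 ∧ J₁ ∩ J₂ = {x, y} := by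
  have main : ∀ s t : ℝ, s ∈ Icc (0:ℝ) 2 → t ∈ Icc (0:ℝ) 2 → c s ≠ c t → s < t →
      ∃ J₁ J₂, IsLogGood J₁ ∧ IsLogGood J₂ ∧ J₁ ∪ J₂ = c '' Icc 0 2 ∧ J₁ ∩ J₂ = {c s, c t} := by
    intro s t hs ht hne hst
    have h02 : 0 < s ∨ t < 2 := by
      by_contra! hcon
      apply hne
      rw [le_antisymm hcon.1 hs.1, le_antisymm ht.2 hcon.2, hc.closed]
    refine ⟨_, _, hc.isLogGood_inner hs.1 hst.le ht.2 h02, hc.isLogGood_outer hs.1 hst ht.2,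
      ?_, ?_⟩
    · rw [← image_union, ← image_union]
      congr 1
      ext r
      simp only [mem_union, mem_Icc]
      constructor
      · rintro (h | h | h)
        · exact ⟨hs.1.trans h.1, h.2.trans ht.2⟩
        · exact ⟨h.1, h.2.trans hs.2⟩
        · exact ⟨ht.1.trans h.1, h.2⟩
      · intro h
        rcases le_total r s with h1 | h1
        · exact Or.inr (Or.inl ⟨h.1, h1⟩)
        rcases le_total r t with h2 | h2
        · exact Or.inl ⟨h1, h2⟩
        · exact Or.inr (Or.inr ⟨h2, h.2⟩)
    · ext z
      constructor
      · rintro ⟨⟨r, hr, rfl⟩, ⟨r', hr', hrr⟩ | ⟨r', hr', hrr⟩⟩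
        · rcases (hr'.2.trans hr.1).lt_or_eq with hlt | heq
          · obtain ⟨rfl, rfl⟩ := hc.eq_or ⟨hr'.1, hr'.2.trans hs.2⟩
              ⟨hs.1.trans hr.1, hr.2.trans ht.2⟩ hlt hrr
            right
            rw [le_antisymm ht.2 hr.2]; rfl
          · left
            rw [le_antisymm (heq ▸ hr'.2) hr.1]
        · rcases (hr.2.trans hr'.1).lt_or_eq with hlt | heq
          · obtain ⟨rfl, rfl⟩ := hc.eq_or ⟨hs.1.trans hr.1, hr.2.trans ht.2⟩
              ⟨ht.1.trans hr'.1, hr'.2⟩ hlt hrr.symm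
            left
            rw [le_antisymm hr.1 hs.1]
          · right
            rw [le_antisymm hr.2 (heq ▸ hr'.1)]; rfl
      · rintro (rfl | rfl)
        · exact ⟨⟨s, ⟨le_rfl, hst.le⟩, rfl⟩, Or.inl ⟨s, ⟨hs.1, le_rfl⟩, rfl⟩⟩
        · exact ⟨⟨t, ⟨hst.le, le_rfl⟩, rfl⟩, Or.inr ⟨t, ⟨le_rfl, ht.2⟩, rfl⟩⟩
  obtain ⟨s, hs, rfl⟩ := hx
  obtain ⟨t, ht, rfl⟩ := hy
  rcases lt_trichotomy s t with hlt | rfl | hlt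
  · exact main s t hs ht hxy hlt
  · exact absurd rfl hxy
  · rw [pair_comm]; exact main t s ht hs hxy.symm hlt

/-! ### A simple closed curve separates the plane -/

open Classical in
/-- The increment of a continuous logarithm of `z - u` along `K`, from `x` to `y`. -/
noncomputable def logIncr (K : Set ℂ) (x y u : ℂ) : ℂ :=
  if h : HasLogOn (fun z => z - u) K then h.choose y - h.choose x else 0

lemma logIncr_eq {K : Set ℂ} (hK : IsPreconnected K) {x y u : ℂ} (hx : x ∈ K) (hy : y ∈ K)
    {L : ℂ → ℂ} (hL : ContinuousOn L K) (hLu : ∀ z ∈ K, Complex.exp (L z) = z - u) :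
    logIncr K x y u = L y - L x := by
  have h : HasLogOn (fun z => z - u) K := ⟨L, hL, hLu⟩
  have h' := h.choose_spec
  rw [logIncr, dif_pos h]
  have := eqOn_of_exp_eqOn hK (f := fun z => h.choose z) (g := fun z => L z + (h.choose x - L x))
    h'.1 (by fun_prop) (fun z hz => by
      rw [Complex.exp_add, Complex.exp_sub, h'.2 z hz, hLu z hz, h'.2 x hx, hLu x hx, div_self,
        mul_one]
      have := Complex.exp_ne_zero (L x)
      rwa [hLu x hx] at this) hx (by ring) hy
  simp only at this
  rw [this]; ring

lemma exp_logIncr {K : Set ℂ} (hK : IsLogGood K) {x y u : ℂ} (hx : x ∈ K) (hy : y ∈ K)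
    (hu : u ∉ K) : Complex.exp (logIncr K x y u) = (y - u) / (x - u) := by
  obtain ⟨L, hL, hLu⟩ := hK.hasLogOn (fun z => z - u) (by fun_prop)
    fun z hz h0 => hu (by rwa [← sub_eq_zero.1 h0])
  rw [logIncr_eq hK.isConnected.isPreconnected hx hy hL hLu, Complex.exp_sub, hLu y hy, hLu x hx]

lemma continuousAt_logIncr {K : Set ℂ} (hK : IsLogGood K) {x y u : ℂ} (hx : x ∈ K) (hy : y ∈ K)
    (hu : u ∉ K) : ContinuousAt (logIncr K x y) u := by
  have hne : ∀ z ∈ K, z - u ≠ 0 := fun z hz h0 => hu (by rwa [← sub_eq_zero.1 h0])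
  obtain ⟨L, hL, hLu⟩ := hK.hasLogOn (fun z => z - u) (by fun_prop) hne
  obtain ⟨ε, hε, hball⟩ := Metric.isOpen_iff.1 hK.isCompact.isClosed.isOpen_compl u hu
  have hs : ∀ v ∈ Metric.ball u ε, ∀ z ∈ K, (z - v) / (z - u) ∈ Complex.slitPlane := by
    intro v hv z hz
    have h1 : (z - v) / (z - u) = 1 + (u - v) / (z - u) := by
      field_simp [hne z hz]; ring
    rw [h1]
    apply Complex.mem_slitPlane_of_norm_lt_one
    rw [norm_div, div_lt_one (norm_pos_iff.2 (hne z hz))]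
    refine lt_of_lt_of_le (by rw [norm_sub_rev]; exact mem_ball_iff_norm.1 hv) ?_
    by_contra! hlt
    exact hball (mem_ball_iff_norm.2 hlt) hz
  have key : ∀ v ∈ Metric.ball u ε, logIncr K x y v =
      L y - L x + (Complex.log ((y - v) / (y - u)) - Complex.log ((x - v) / (x - u))) := by
    intro v hv
    rw [logIncr_eq hK.isConnected.isPreconnected hx hy
      (L := fun z => L z + Complex.log ((z - v) / (z - u)))]
    · ring
    · exact hL.add (ContinuousOn.clog (ContinuousOn.div (by fun_prop) (by fun_prop) hne) (hs v hv))
    · intro z hz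
      rw [Complex.exp_add, hLu z hz, Complex.exp_log (Complex.slitPlane_ne_zero (hs v hv z hz)),
        mul_div_cancel₀ _ (hne z hz)]
  have hu0 : u ∈ Metric.ball u ε := Metric.mem_ball_self hε
  refine ContinuousAt.congr ?_ (Filter.mem_of_superset (Metric.ball_mem_nhds u hε)
    fun v hv => (key v hv).symm)
  refine continuousAt_const.add (ContinuousAt.sub ?_ ?_)
  · exact ContinuousAt.clog (by fun_prop) (hs u hu0 y hy)
  · exact ContinuousAt.clog (by fun_prop) (hs u hu0 x hx)

/-- Two arcs between the leftmost point `x` and the rightmost point `y` of their union, which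
meet only in these points, form a curve about which not all winding numbers vanish. Otherwise the
numbers that count whether a point `u` of the strip between `x` and `y` lies above or below the
one or the other arc would agree and would define a locally constant function on the whole
strip. -/
lemma exists_not_hasLogOn_of_strip {J₁ J₂ : Set ℂ} (h₁ : IsLogGood J₁) (h₂ : IsLogGood J₂) {x y : ℂ}
    (hJ : J₁ ∩ J₂ = {x, y}) (hx : ∀ z ∈ J₁ ∪ J₂, x.re ≤ z.re) (hxy : x.re < y.re) :
    ∃ u ∉ J₁ ∪ J₂, ¬ HasLogOn (fun z => z - u) (J₁ ∪ J₂) := by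
  classical
  by_contra! hall
  have hxJ : x ∈ J₁ ∩ J₂ := hJ ▸ mem_insert _ _
  have hyJ : y ∈ J₁ ∩ J₂ := hJ ▸ mem_insert_of_mem _ rfl
  let S : Set ℂ := {u | x.re < u.re} ∩ {u | u.re < y.re}
  have hS : IsPreconnected S :=
    ((convex_halfSpace_re_gt _).inter (convex_halfSpace_re_lt _)).isPreconnected
  let f : Set ℂ → ℂ → ℂ := fun K u => logIncr K x y u - Complex.log (y - u) + Complex.log (u - x)
  have hy0 : ∀ u ∈ S, y - u ∈ Complex.slitPlane := fun u hu =>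
    Or.inl (by simpa using hu.2)
  have hx0 : ∀ u ∈ S, u - x ∈ Complex.slitPlane := fun u hu =>
    Or.inl (by simpa using hu.1)
  have hfc : ∀ K, IsLogGood K → x ∈ K → y ∈ K → ∀ u ∈ S, u ∉ K → ContinuousAt (f K) u := by
    intro K hK hx hy u hu huK
    exact ((continuousAt_logIncr hK hx hy huK).sub (ContinuousAt.clog (by fun_prop) (hy0 u hu))).add
      (ContinuousAt.clog (by fun_prop) (hx0 u hu))
  have hfe : ∀ K, IsLogGood K → x ∈ K → y ∈ K → ∀ u ∈ S, u ∉ K → Complex.exp (f K u) = -1 := by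
    intro K hK hx hy u hu huK
    have h1 := Complex.slitPlane_ne_zero (hy0 u hu)
    have h2 := Complex.slitPlane_ne_zero (hx0 u hu)
    have h3 : x - u ≠ 0 := by rw [← neg_sub]; exact neg_ne_zero.2 h2
    simp only [f]
    rw [Complex.exp_add, Complex.exp_sub, exp_logIncr hK hx hy huK, Complex.exp_log h1,
      Complex.exp_log h2]
    field_simp
    ring
  have hff : ∀ u, u ∉ J₁ → u ∉ J₂ → f J₁ u = f J₂ u := by
    intro u hu1 hu2
    obtain ⟨L, hL, hLu⟩ := hall u (fun h => h.elim hu1 hu2)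
    simp only [f]
    rw [logIncr_eq h₁.isConnected.isPreconnected hxJ.1 hyJ.1 (hL.mono subset_union_left)
      (fun z hz => hLu z (Or.inl hz)), logIncr_eq h₂.isConnected.isPreconnected hxJ.2 hyJ.2
      (hL.mono subset_union_right) (fun z hz => hLu z (Or.inr hz))]
  have hdisj : ∀ u ∈ S, u ∈ J₁ → u ∉ J₂ := by
    intro u hu hu1 hu2
    have : u ∈ ({x, y} : Set ℂ) := hJ ▸ ⟨hu1, hu2⟩
    rcases this with rfl | rfl
    · exact lt_irrefl u.re hu.1
    · exact lt_irrefl u.re hu.2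
  let g : ℂ → ℂ := fun u => if u ∈ J₁ then f J₂ u else f J₁ u
  have hg2 : ∀ u, u ∉ J₂ → g u = f J₂ u := by
    intro u hu
    by_cases h : u ∈ J₁
    · exact if_pos h
    · simp only [g, if_neg h]; exact hff u h hu
  have hg1 : ∀ u, u ∉ J₁ → g u = f J₁ u := fun u hu => if_neg hu
  have hgc : ContinuousOn g S := by
    intro u hu
    apply ContinuousAt.continuousWithinAt
    by_cases h : u ∈ J₁
    · have h' := hdisj u hu h
      exact (hfc J₂ h₂ hxJ.2 hyJ.2 u hu h').congr
        ((h₂.isCompact.isClosed.isOpen_compl.eventually_mem h').mono fun v hv => (hg2 v hv).symm)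
    · exact (hfc J₁ h₁ hxJ.1 hyJ.1 u hu h).congr
        ((h₁.isCompact.isClosed.isOpen_compl.eventually_mem h).mono fun v hv => (hg1 v hv).symm)
  have hge : ∀ u ∈ S, Complex.exp (g u) = -1 := by
    intro u hu
    by_cases h : u ∈ J₁
    · have h' := hdisj u hu h
      rw [hg2 u h', hfe J₂ h₂ hxJ.2 hyJ.2 u hu h']
    · rw [hg1 u h, hfe J₁ h₁ hxJ.1 hyJ.1 u hu h]
  -- compare a point far above the curve with a point far below it
  obtain ⟨R, hR⟩ := h₁.isCompact.isBounded.exists_norm_le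
  have him : ∀ z ∈ J₁, |z.im| ≤ R := fun z hz => (Complex.abs_im_le_norm z).trans (hR z hz)
  have far : ∀ u ∈ S, (∀ z ∈ J₁, (z - u).im ≠ 0) →
      g u = Complex.log (u - x) - Complex.log (x - u) := by
    intro u hu h
    have huJ : u ∉ J₁ := fun hu' => h u hu' (by simp)
    rw [hg1 u huJ]
    simp only [f]
    rw [logIncr_eq h₁.isConnected.isPreconnected hxJ.1 hyJ.1 (L := fun z => Complex.log (z - u))]
    · ring
    · exact ContinuousOn.clog (by fun_prop) fun z hz => Or.inr (h z hz)
    · intro z hz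
      exact Complex.exp_log fun h0 => h z hz (by rw [h0]; simp)
  have hm1 : x.re < (x.re + y.re) / 2 := by linarith
  have hm2 : (x.re + y.re) / 2 < y.re := by linarith
  have htop := far ⟨(x.re + y.re) / 2, R + 1⟩ ⟨hm1, hm2⟩ fun z hz => by
    have := (abs_le.1 (him z hz)).2
    simp only [Complex.sub_im]; linarith
  have hbot := far ⟨(x.re + y.re) / 2, - (R + 1)⟩ ⟨hm1, hm2⟩ fun z hz => by
    have := (abs_le.1 (him z hz)).1
    simp only [Complex.sub_im]; linarith
  have heq := eq_of_exp_eq_const hS hgc hge (a := ⟨(x.re + y.re) / 2, R + 1⟩)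
    (b := ⟨(x.re + y.re) / 2, - (R + 1)⟩) ⟨hm1, hm2⟩ ⟨hm1, hm2⟩
  rw [htop, hbot] at heq
  have h := congrArg Complex.im heq
  have hxim := abs_le.1 (him x hxJ.1)
  simp only [Complex.sub_im, Complex.log_im] at h
  rw [← neg_sub _ x, ← neg_sub _ x, Complex.arg_neg_eq_arg_sub_pi_of_im_pos (by
    simp only [Complex.sub_im]; linarith [hxim.2]), Complex.arg_neg_eq_arg_add_pi_of_im_neg (by
    simp only [Complex.sub_im]; linarith [hxim.1])] at h
  linarith [Real.pi_pos]

/-- A simple closed curve separates the plane. -/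
lemma IsLoop.exists_not_notSep {c : ℝ → ℂ} (hc : IsLoop c) :
    ∃ u v, u ∉ c '' Icc 0 2 ∧ v ∉ c '' Icc 0 2 ∧ ¬ NotSep (c '' Icc 0 2) u v := by
  set J := c '' Icc 0 2 with hJdef
  have hcomp : IsCompact J := isCompact_Icc.image hc.continuous
  have hne : J.Nonempty := ⟨c 0, mem_image_of_mem _ ⟨le_rfl, by norm_num⟩⟩
  obtain ⟨x, hx, hxmin⟩ := hcomp.exists_isMinOn hne Complex.continuous_re.continuousOn
  obtain ⟨y, hy, hymax⟩ := hcomp.exists_isMaxOn hne Complex.continuous_re.continuousOn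
  have hxmin' : ∀ z ∈ J, x.re ≤ z.re := fun z hz => hxmin hz
  have hymax' : ∀ z ∈ J, z.re ≤ y.re := fun z hz => hymax hz
  have hxy : x.re < y.re := by
    by_contra! hle
    -- a simple closed curve is not contained in a line
    have hre : ∀ t ∈ Icc (0:ℝ) 2, (c t).re = x.re := fun t ht =>
      le_antisymm ((hymax' _ (mem_image_of_mem _ ht)).trans hle) (hxmin' _ (mem_image_of_mem _ ht))
    have him : Continuous fun t => (c t).im := Complex.continuous_im.comp hc.continuous
    have hm : ((c 0).im + (c 1).im) / 2 ∈ uIcc (c 0).im (c 1).im := by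
      rw [mem_uIcc]
      rcases le_total (c 0).im (c 1).im with h | h
      · left; constructor <;> linarith
      · right; constructor <;> linarith
    have hm' : ((c 0).im + (c 1).im) / 2 ∈ uIcc (c 1).im (c 2).im := by
      rw [← hc.closed, uIcc_comm]; exact hm
    obtain ⟨s, hs, hs'⟩ := intermediate_value_uIcc him.continuousOn hm
    obtain ⟨t, ht, ht'⟩ := intermediate_value_uIcc him.continuousOn hm'
    rw [uIcc_of_le (by norm_num)] at hs ht
    simp only at hs' ht'
    have h01 : (c 0).im ≠ (c 1).im := by
      intro h
      have := hc.injOn ⟨le_rfl, by norm_num⟩ ⟨by norm_num, by norm_num⟩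
        (Complex.ext ((hre 0 (by simp)).trans (hre 1 (by norm_num)).symm) h)
      norm_num at this
    have hs2 : s ∈ Icc (0:ℝ) 2 := ⟨hs.1, by linarith [hs.2]⟩
    have ht2 : t ∈ Icc (0:ℝ) 2 := ⟨by linarith [ht.1], ht.2⟩
    have hst : s < t := by
      refine lt_of_le_of_ne (hs.2.trans ht.1) fun h => ?_
      have h1 : s = 1 := le_antisymm hs.2 (h ▸ ht.1)
      rw [h1] at hs'
      apply h01; linarith
    obtain ⟨rfl, -⟩ := hc.eq_or hs2 ht2 hst
      (Complex.ext ((hre s hs2).trans (hre t ht2).symm) (hs'.trans ht'.symm))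
    apply h01; linarith
  obtain ⟨J₁, J₂, h₁, h₂, hun, hint⟩ := hc.exists_split hx hy
    (fun h => by rw [h] at hxy; exact lt_irrefl _ hxy)
  obtain ⟨u, hu, hlog⟩ := exists_not_hasLogOn_of_strip h₁ h₂ hint (by rw [hun]; exact hxmin') hxy
  rw [hun] at hu hlog
  -- a point to the right of the curve
  have hvre : ∀ z ∈ J, 0 < (y + 1 - z).re := fun z hz => by
    have := hymax' z hz
    simp only [Complex.sub_re, Complex.add_re, Complex.one_re]; linarith
  have hv : y + 1 ∉ J := fun h => by simpa using hvre _ h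
  refine ⟨u, y + 1, hu, hv, fun hsep => hlog ?_⟩
  have hl : HasLogOn (fun z => -(y + 1 - z)) J := by
    refine ⟨fun z => Complex.log (y + 1 - z) + Real.pi * Complex.I, ?_, fun z hz => ?_⟩
    · exact (ContinuousOn.clog (by fun_prop) fun z hz => Or.inl (hvre z hz)).add continuousOn_const
    · rw [Complex.exp_add, Complex.exp_pi_mul_I, Complex.exp_log, mul_neg_one]
      intro h0
      have := hvre z hz
      rw [h0] at this
      simp at this
  refine ((hsep.hasLogOn hcomp.isClosed).mul hl).congr fun z hz => ?_
  have : z - (y + 1) ≠ 0 := fun h0 => hv (by rwa [← sub_eq_zero.1 h0])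
  simp only
  field_simp
  ring

/-- Each point of a simple closed curve lies in the closure of each component of the complement,
and there are at least two components. -/
lemma IsLoop.exists_other_component {c : ℝ → ℂ} (hc : IsLoop c) (w : ℂ) :
    ∃ w' ∉ c '' Icc 0 2, ¬ NotSep (c '' Icc 0 2) w w' ∧
      ∀ s ∈ Ioo (0:ℝ) 2, c s ∈ closure (connectedComponentIn (c '' Icc 0 2)ᶜ w') := by
  set J := c '' Icc 0 2 with hJdef
  have hcl : IsClosed J := (isCompact_Icc.image hc.continuous).isClosed
  obtain ⟨u, v, hu, hv, huv⟩ := hc.exists_not_notSep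
  have aux : ∀ a b, a ∉ J → b ∉ J → ¬ NotSep J a b →
      ∀ s ∈ Ioo (0:ℝ) 2, c s ∈ closure (connectedComponentIn Jᶜ a) := by
    intro a b ha hb hab s hs
    by_contra hcs
    set U := connectedComponentIn Jᶜ a with hU
    obtain ⟨ε, hε, hball⟩ := Metric.isOpen_iff.1
      ((isClosed_closure (s := U)).isOpen_compl.preimage hc.continuous) s hcs
    -- remove a small open subarc around `c s`
    set δ := min (ε / 2) (min s (2 - s)) with hδ
    have hδ0 : 0 < δ := lt_min (half_pos hε) (lt_min hs.1 (by linarith [hs.2]))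
    have hδε : δ < ε := (min_le_left _ _).trans_lt (half_lt_self hε)
    have hδs : δ ≤ s := (min_le_right _ _).trans (min_le_left _ _)
    have hδs' : δ ≤ 2 - s := (min_le_right _ _).trans (min_le_right _ _)
    have hgood := hc.isLogGood_outer (a := s - δ) (b := s + δ) (by linarith) (by linarith)
      (by linarith)
    set K := c '' Icc 0 (s - δ) ∪ c '' Icc (s + δ) 2 with hK
    have hKJ : K ⊆ J := union_subset
      (image_mono fun r hr => ⟨hr.1, by linarith [hr.2]⟩)
      (image_mono fun r hr => ⟨by linarith [hr.1], hr.2⟩)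
    have hsub : frontier U ⊆ K := by
      intro z hz
      obtain ⟨r, hr, rfl⟩ := frontier_connectedComponentIn_subset hcl a hz
      by_contra hrK
      refine absurd hz.1 (hball (a := r) ?_)
      rw [Metric.mem_ball, Real.dist_eq, abs_lt]
      constructor
      · by_contra! hle
        exact hrK (Or.inl (mem_image_of_mem _ ⟨hr.1, by linarith⟩))
      · by_contra! hle
        exact hrK (Or.inr (mem_image_of_mem _ ⟨by linarith, hr.2⟩))
    have hUo : IsOpen U := hcl.isOpen_compl.connectedComponentIn
    have hnot := hgood.notSep (fun h => ha (hKJ h)) (fun h => hb (hKJ h))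
    have hpre : IsPreconnected (connectedComponentIn Kᶜ a) := isPreconnected_connectedComponentIn
    obtain ⟨z, hz, hzU, hzU'⟩ := hpre U (closure U)ᶜ hUo isClosed_closure.isOpen_compl
      (fun z hz => by
        by_cases hzU : z ∈ U
        · exact Or.inl hzU
        · refine Or.inr fun hzc => connectedComponentIn_subset _ _ hz (hsub ?_)
          rw [hUo.frontier_eq]; exact ⟨hzc, hzU⟩)
      ⟨a, mem_connectedComponentIn hnot.1, mem_connectedComponentIn ha⟩
      ⟨b, hnot.2, fun hbc => hnot.right (hsub (by
        rw [hUo.frontier_eq]; exact ⟨hbc, fun hbU => hab ⟨ha, hbU⟩⟩))⟩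
    exact hzU' (subset_closure hzU)
  by_cases h : NotSep J w u
  · exact ⟨v, hv, fun h' => huv (h.symm.trans h'), aux v u hv hu fun h' => huv h'.symm⟩
  · exact ⟨u, hu, h, aux u v hu hv huv⟩

/-! ### Faces of theta curves and of crossing chords -/

lemma isSimpleArc_iff {A : Set ℂ} {p q : ℂ} : IsSimpleArc A p q ↔
    ∃ c : ℝ → ℂ, Continuous c ∧ InjOn c (Icc 0 1) ∧ c 0 = p ∧ c 1 = q ∧ c '' Icc 0 1 = A := by
  constructor
  · rintro ⟨γ, hγ, hinj, h0, h1, hA⟩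
    refine ⟨fun t => γ (projIcc 0 1 zero_le_one t), by fun_prop, ?_, ?_, ?_, ?_⟩
    · intro s hs t ht hst
      have := hinj hst
      rw [projIcc_of_mem _ hs, projIcc_of_mem _ ht] at this
      exact congrArg Subtype.val this
    · rw [← h0]; simp
    · rw [← h1]; simp
    · rw [← hA]
      ext z
      constructor
      · rintro ⟨t, -, rfl⟩; exact mem_range_self _
      · rintro ⟨t, rfl⟩
        exact ⟨t, t.2, by simp⟩
  · rintro ⟨c, hc, hinj, h0, h1, hA⟩
    refine ⟨fun t => c t, by fun_prop, fun s t hst => Subtype.ext (hinj s.2 t.2 hst), by simpa,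
      by simpa, ?_⟩
    rw [← hA, image_eq_range]

namespace IsSimpleArc

variable {A B : Set ℂ} {p q r : ℂ}

lemma left_mem (h : IsSimpleArc A p q) : p ∈ A := by
  obtain ⟨c, -, -, rfl, -, rfl⟩ := isSimpleArc_iff.1 h
  exact mem_image_of_mem _ (by simp)

lemma right_mem (h : IsSimpleArc A p q) : q ∈ A := by
  obtain ⟨c, -, -, -, rfl, rfl⟩ := isSimpleArc_iff.1 h
  exact mem_image_of_mem _ (by simp)

lemma symm (h : IsSimpleArc A p q) : IsSimpleArc A q p := by
  obtain ⟨c, hc, hinj, rfl, rfl, rfl⟩ := isSimpleArc_iff.1 h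
  refine isSimpleArc_iff.2 ⟨fun t => c (1 - t), by fun_prop, ?_, by simp, by simp, ?_⟩
  · intro s hs t ht hst
    have := hinj ⟨by linarith [hs.2], by linarith [hs.1]⟩
      ⟨by linarith [ht.2], by linarith [ht.1]⟩ hst
    linarith
  · ext z
    constructor
    · rintro ⟨t, ht, rfl⟩
      exact ⟨1 - t, ⟨by linarith [ht.2], by linarith [ht.1]⟩, rfl⟩
    · rintro ⟨t, ht, rfl⟩
      exact ⟨1 - t, ⟨by linarith [ht.2], by linarith [ht.1]⟩, by simp⟩

lemma isLogGood (h : IsSimpleArc A p q) : IsLogGood A := by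
  obtain ⟨c, hc, hinj, -, -, rfl⟩ := isSimpleArc_iff.1 h
  exact isLogGood_image_Icc hc zero_le_one hinj

lemma exists_interior (h : IsSimpleArc A p q) : ∃ c : ℝ → ℂ, Continuous c ∧ c 0 = p ∧ c 1 = q ∧
    A \ {p, q} = c '' Ioo 0 1 := by
  obtain ⟨c, hc, hinj, rfl, rfl, rfl⟩ := isSimpleArc_iff.1 h
  refine ⟨c, hc, rfl, rfl, ?_⟩
  ext z
  constructor
  · rintro ⟨⟨t, ht, rfl⟩, hz⟩
    simp only [mem_insert_iff, mem_singleton_iff, not_or] at hz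
    refine ⟨t, ⟨ht.1.lt_of_ne ?_, ht.2.lt_of_ne ?_⟩, rfl⟩
    · rintro rfl; exact hz.1 rfl
    · rintro rfl; exact hz.2 rfl
  · rintro ⟨t, ht, rfl⟩
    refine ⟨⟨t, Ioo_subset_Icc_self ht, rfl⟩, ?_⟩
    rintro (h0 | h1)
    · exact ht.1.ne' (hinj (Ioo_subset_Icc_self ht) (by simp) h0)
    · exact ht.2.ne (hinj (Ioo_subset_Icc_self ht) (by simp) h1)

lemma isPreconnected_interior (h : IsSimpleArc A p q) : IsPreconnected (A \ {p, q}) := by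
  obtain ⟨c, hc, -, -, hA⟩ := h.exists_interior
  rw [hA]
  exact isPreconnected_Ioo.image _ hc.continuousOn

lemma left_mem_closure_interior (h : IsSimpleArc A p q) : p ∈ closure (A \ {p, q}) := by
  obtain ⟨c, hc, rfl, -, hA⟩ := h.exists_interior
  rw [hA]
  refine image_closure_subset_closure_image hc (mem_image_of_mem _ ?_)
  rw [closure_Ioo zero_ne_one]; simp

lemma right_mem_closure_interior (h : IsSimpleArc A p q) : q ∈ closure (A \ {p, q}) := by
  rw [pair_comm]; exact h.symm.left_mem_closure_interior

/-- Two arcs that share one end point, and nothing else, form an arc. -/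
lemma trans (hA : IsSimpleArc A p q) (hB : IsSimpleArc B q r) (hAB : A ∩ B ⊆ {q}) :
    IsSimpleArc (A ∪ B) p r := by
  obtain ⟨c, hc, hci, rfl, rfl, rfl⟩ := isSimpleArc_iff.1 hA
  obtain ⟨d, hd, hdi, hd0, rfl, rfl⟩ := isSimpleArc_iff.1 hB
  let e : ℝ → ℂ := fun t => if t ≤ 1 / 2 then c (2 * t) else d (2 * t - 1)
  have he1 : ∀ t ≤ (1:ℝ) / 2, e t = c (2 * t) := fun t ht => if_pos ht
  have he2 : ∀ t, (1:ℝ) / 2 < t → e t = d (2 * t - 1) := fun t ht => if_neg (not_le.2 ht)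
  have hcont : Continuous e := by
    refine Continuous.if_le (by fun_prop) (by fun_prop) continuous_id continuous_const ?_
    intro t ht
    rw [ht]; norm_num [hd0]
  have hcross : ∀ s ∈ Icc (0:ℝ) 1, ∀ t ∈ Icc (0:ℝ) 1, s ≤ 1 / 2 → 1 / 2 < t → e s ≠ e t := by
    intro s hs t ht hs2 ht2 hst
    rw [he1 s hs2, he2 t ht2] at hst
    have ht' : 2 * t - 1 ∈ Icc (0:ℝ) 1 := ⟨by linarith, by linarith [ht.2]⟩
    have hs' : 2 * s ∈ Icc (0:ℝ) 1 := ⟨by linarith [hs.1], by linarith⟩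
    have : d (2 * t - 1) = c 1 :=
      hAB ⟨⟨2 * s, hs', hst⟩, ⟨2 * t - 1, ht', rfl⟩⟩
    rw [← hd0] at this
    have := hdi ht' (by simp) this
    linarith
  refine isSimpleArc_iff.2 ⟨e, hcont, ?_, ?_, ?_, ?_⟩
  · intro s hs t ht hst
    rcases le_or_gt s (1 / 2) with h1 | h1 <;> rcases le_or_gt t (1 / 2) with h2 | h2
    · rw [he1 s h1, he1 t h2] at hst
      have := hci ⟨by linarith [hs.1], by linarith⟩ ⟨by linarith [ht.1], by linarith⟩ hst
      linarith
    · exact absurd hst (hcross s hs t ht h1 h2)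
    · exact absurd hst.symm (hcross t ht s hs h2 h1)
    · rw [he2 s h1, he2 t h2] at hst
      have := hdi ⟨by linarith, by linarith [hs.2]⟩ ⟨by linarith, by linarith [ht.2]⟩ hst
      linarith
  · rw [he1 0 (by norm_num)]; simp
  · rw [he2 1 (by norm_num)]; norm_num
  · ext z
    constructor
    · rintro ⟨t, ht, rfl⟩
      rcases le_or_gt t (1 / 2) with h | h
      · exact Or.inl ⟨2 * t, ⟨by linarith [ht.1], by linarith⟩, (he1 t h).symm⟩
      · exact Or.inr ⟨2 * t - 1, ⟨by linarith, by linarith [ht.2]⟩, (he2 t h).symm⟩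
    · rintro (⟨t, ht, rfl⟩ | ⟨t, ht, rfl⟩)
      · refine ⟨t / 2, ⟨by linarith [ht.1], by linarith [ht.2]⟩, ?_⟩
        rw [he1 _ (by linarith [ht.2])]; congr 1; ring
      · rcases ht.1.lt_or_eq with h | h
        · refine ⟨(t + 1) / 2, ⟨by linarith [ht.1], by linarith [ht.2]⟩, ?_⟩
          rw [he2 _ (by linarith)]; congr 1; ring
        · refine ⟨1 / 2, by norm_num, ?_⟩
          rw [he1 _ le_rfl, ← h, hd0]; norm_num

/-- Two arcs that share their end points, and nothing else, form a simple closed curve. -/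
lemma exists_isLoop (hA : IsSimpleArc A p q) (hB : IsSimpleArc B p q) (hAB : A ∩ B = {p, q}) :
    ∃ c : ℝ → ℂ, IsLoop c ∧ c 0 = p ∧ c '' Icc 0 2 = A ∪ B := by
  obtain ⟨c, hc, hci, rfl, rfl, rfl⟩ := isSimpleArc_iff.1 hA
  obtain ⟨d, hd, hdi, hd0, hd1, rfl⟩ := isSimpleArc_iff.1 hB
  let e : ℝ → ℂ := fun t => if t ≤ 1 then c t else d (2 - t)
  have he1 : ∀ t ≤ (1:ℝ), e t = c t := fun t ht => if_pos ht
  have he2 : ∀ t, (1:ℝ) < t → e t = d (2 - t) := fun t ht => if_neg (not_le.2 ht)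
  have hcross : ∀ s ∈ Ico (0:ℝ) 2, ∀ t ∈ Ico (0:ℝ) 2, s ≤ 1 → 1 < t → e s ≠ e t := by
    intro s hs t ht hs2 ht2 hst
    rw [he1 s hs2, he2 t ht2] at hst
    have ht' : 2 - t ∈ Icc (0:ℝ) 1 := ⟨by linarith [ht.2], by linarith⟩
    have : d (2 - t) ∈ ({c 0, c 1} : Set ℂ) :=
      hAB ▸ ⟨⟨s, ⟨hs.1, hs2⟩, hst⟩, ⟨2 - t, ht', rfl⟩⟩
    rcases this with h | h
    · rw [← hd0] at h
      have := hdi ht' (by simp) h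
      linarith [ht.2]
    · rw [mem_singleton_iff, ← hd1] at h
      have := hdi ht' (by simp) h
      linarith
  refine ⟨e, ⟨?_, ?_, ?_⟩, ?_, ?_⟩
  · refine Continuous.if_le (by fun_prop) (by fun_prop) continuous_id continuous_const ?_
    intro t ht
    rw [ht, ← hd1]; norm_num
  · rw [he1 0 (by norm_num), he2 2 (by norm_num)]; norm_num [hd0]
  · intro s hs t ht hst
    rcases le_or_gt s 1 with h1 | h1 <;> rcases le_or_gt t 1 with h2 | h2
    · rw [he1 s h1, he1 t h2] at hst
      exact hci ⟨hs.1, h1⟩ ⟨ht.1, h2⟩ hst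
    · exact absurd hst (hcross s hs t ht h1 h2)
    · exact absurd hst.symm (hcross t ht s hs h2 h1)
    · rw [he2 s h1, he2 t h2] at hst
      have := hdi ⟨by linarith [hs.2], by linarith⟩ ⟨by linarith [ht.2], by linarith⟩ hst
      linarith
  · exact he1 0 (by norm_num)
  · ext z
    constructor
    · rintro ⟨t, ht, rfl⟩
      rcases le_or_gt t 1 with h | h
      · exact Or.inl ⟨t, ⟨ht.1, h⟩, (he1 t h).symm⟩
      · exact Or.inr ⟨2 - t, ⟨by linarith [ht.2], by linarith⟩, (he2 t h).symm⟩
    · rintro (⟨t, ht, rfl⟩ | ⟨t, ht, rfl⟩)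
      · exact ⟨t, ⟨ht.1, by linarith [ht.2]⟩, he1 t ht.2⟩
      · rcases ht.2.lt_or_eq with h | h
        · refine ⟨2 - t, ⟨by linarith [ht.2], by linarith [ht.1]⟩, ?_⟩
          rw [he2 _ (by linarith)]; congr 1; ring
        · exact ⟨1, by norm_num, by rw [he1 _ le_rfl, h, hd1]⟩

end IsSimpleArc

lemma notSep_of_mem_closure {K X Y : Set ℂ} (hX : IsPreconnected X) (hY : IsPreconnected Y)
    (hXK : Disjoint X K) (hYK : Disjoint Y K) {b x y : ℂ} (hbX : b ∈ closure X)
    (hbY : b ∈ closure Y) (hb : b ∉ K) (hx : x ∈ X) (hy : y ∈ Y) : NotSep K x y := by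
  have hX' : IsPreconnected (insert b X) := hX.subset_closure (subset_insert _ _)
    (insert_subset hbX subset_closure)
  have hY' : IsPreconnected (insert b Y) := hY.subset_closure (subset_insert _ _)
    (insert_subset hbY subset_closure)
  refine notSep_of_isPreconnected (hX'.union b (mem_insert _ _) (mem_insert _ _) hY') ?_
    (Or.inl (mem_insert_of_mem _ hx)) (Or.inr (mem_insert_of_mem _ hy))
  rw [disjoint_union_left, disjoint_insert_left, disjoint_insert_left]
  exact ⟨⟨hb, hXK⟩, hb, hYK⟩

/-- If two compact sets have a connected intersection, at most one component of the complement of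
their union touches both a point that is only in the first set and a point that is only in
the second set. -/
lemma notSep_union_of_mem_closure {K₁ K₂ X Y : Set ℂ} (hK₁ : IsCompact K₁) (hK₂ : IsCompact K₂)
    (hc : IsConnected (K₁ ∩ K₂)) (hX : IsPreconnected X) (hY : IsPreconnected Y)
    (hXK : Disjoint X (K₁ ∪ K₂)) (hYK : Disjoint Y (K₁ ∪ K₂)) {b d x y : ℂ}
    (hbX : b ∈ closure X) (hbY : b ∈ closure Y) (hb : b ∉ K₂)
    (hdX : d ∈ closure X) (hdY : d ∈ closure Y) (hd : d ∉ K₁) (hx : x ∈ X) (hy : y ∈ Y) :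
    NotSep (K₁ ∪ K₂) x y := by
  rw [disjoint_union_right] at hXK hYK
  exact NotSep.union hK₁ hK₂ hc
    (notSep_of_mem_closure hX hY hXK.1 hYK.1 hdX hdY hd hx hy)
    (notSep_of_mem_closure hX hY hXK.2 hYK.2 hbX hbY hb hx hy)

/-- Let `F` be a connected set that touches inner points of two arcs `A₁` and `A₂` with common
end points. A third arc `P` between the end points, disjoint from `F`, does not run through
the face of the closed curve `A₁ ∪ A₂` that contains `F`. -/
lemma false_of_chord_in_face {A₁ A₂ P F : Set ℂ} {p q x₁ x₂ f : ℂ}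
    (h₁ : IsSimpleArc A₁ p q) (h₂ : IsSimpleArc A₂ p q) (hP : IsSimpleArc P p q)
    (h₁₂ : A₁ ∩ A₂ = {p, q}) (h₁P : A₁ ∩ P = {p, q}) (h₂P : A₂ ∩ P = {p, q})
    (hF : IsPreconnected F) (hf : f ∈ F) (hFA : Disjoint F (A₁ ∪ A₂)) (hFP : Disjoint F P)
    (hx₁ : x₁ ∈ A₁ \ {p, q}) (hx₂ : x₂ ∈ A₂ \ {p, q})
    (hx₁F : x₁ ∈ closure F) (hx₂F : x₂ ∈ closure F)
    (hface : ∀ z ∈ P \ {p, q}, NotSep (A₁ ∪ A₂) f z) : False := by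
  obtain ⟨c, hc, hc0, hcJ⟩ := h₁.exists_isLoop h₂ h₁₂
  have hpar : ∀ x ∈ A₁ ∪ A₂, x ≠ p → ∃ s ∈ Ioo (0:ℝ) 2, c s = x := by
    intro x hx hxp
    rw [← hcJ] at hx
    obtain ⟨s, hs, rfl⟩ := hx
    refine ⟨s, ⟨hs.1.lt_of_ne ?_, hs.2.lt_of_ne ?_⟩, rfl⟩
    · rintro rfl; exact hxp hc0
    · rintro rfl; exact hxp (hc.closed ▸ hc0)
  obtain ⟨w, hw, hfw, hcl⟩ := hc.exists_other_component f
  rw [hcJ] at hw hfw hcl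
  set U := connectedComponentIn (A₁ ∪ A₂)ᶜ w with hU
  have hUJ : Disjoint U (A₁ ∪ A₂) :=
    subset_compl_iff_disjoint_right.1 (connectedComponentIn_subset _ _)
  have hpqJ : ({p, q} : Set ℂ) ⊆ A₁ ∪ A₂ := h₁₂ ▸ inter_subset_left.trans subset_union_left
  have hUP : Disjoint U P := by
    rw [disjoint_left]
    intro z hzU hzP
    by_cases hz : z ∈ ({p, q} : Set ℂ)
    · exact disjoint_left.1 hUJ hzU (hpqJ hz)
    · exact hfw ((hface z ⟨hzP, hz⟩).trans (NotSep.symm ⟨hw, hzU⟩))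
  have hinter : (A₁ ∪ P) ∩ (A₂ ∪ P) = P := by
    rw [← inter_union_distrib_right, h₁₂]
    exact union_eq_right.2 (insert_subset hP.left_mem (singleton_subset_iff.2 hP.right_mem))
  have hun : (A₁ ∪ P) ∪ (A₂ ∪ P) = (A₁ ∪ A₂) ∪ P := by
    rw [union_union_union_comm, union_self]
  have key := notSep_union_of_mem_closure (K₁ := A₁ ∪ P) (K₂ := A₂ ∪ P) (X := F) (Y := U)
    (b := x₁) (d := x₂) (x := f) (y := w)
    (h₁.isLogGood.isCompact.union hP.isLogGood.isCompact)
    (h₂.isLogGood.isCompact.union hP.isLogGood.isCompact)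
    (by rw [hinter]; exact hP.isLogGood.isConnected) hF isPreconnected_connectedComponentIn
    (by rw [hun]; exact disjoint_union_right.2 ⟨hFA, hFP⟩)
    (by rw [hun]; exact disjoint_union_right.2 ⟨hUJ, hUP⟩)
    hx₁F (by
      obtain ⟨s, hs, rfl⟩ := hpar x₁ (Or.inl hx₁.1) fun h => hx₁.2 (Or.inl h)
      exact hcl s hs)
    (by
      rintro (h | h)
      · exact hx₁.2 (h₁₂ ▸ ⟨hx₁.1, h⟩)
      · exact hx₁.2 (h₁P ▸ ⟨hx₁.1, h⟩))
    hx₂F (by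
      obtain ⟨s, hs, rfl⟩ := hpar x₂ (Or.inr hx₂.1) fun h => hx₂.2 (Or.inl h)
      exact hcl s hs)
    (by
      rintro (h | h)
      · exact hx₂.2 (h₁₂ ▸ ⟨h, hx₂.1⟩)
      · exact hx₂.2 (h₂P ▸ ⟨hx₂.1, h⟩))
    hf (mem_connectedComponentIn hw)
  exact hfw (key.mono (by rw [hun]; exact subset_union_left))

/-- No face of a theta curve touches inner points of all its three arcs. -/
lemma false_of_theta {A₁ A₂ A₃ F : Set ℂ} {p q x₁ x₂ x₃ : ℂ}
    (h₁ : IsSimpleArc A₁ p q) (h₂ : IsSimpleArc A₂ p q) (h₃ : IsSimpleArc A₃ p q)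
    (h₁₂ : A₁ ∩ A₂ = {p, q}) (h₁₃ : A₁ ∩ A₃ = {p, q}) (h₂₃ : A₂ ∩ A₃ = {p, q})
    (hF : IsPreconnected F) (hF₁ : Disjoint F A₁) (hF₂ : Disjoint F A₂) (hF₃ : Disjoint F A₃)
    (hx₁ : x₁ ∈ A₁ \ {p, q}) (hx₂ : x₂ ∈ A₂ \ {p, q}) (hx₃ : x₃ ∈ A₃ \ {p, q})
    (hx₁F : x₁ ∈ closure F) (hx₂F : x₂ ∈ closure F) (hx₃F : x₃ ∈ closure F) : False := by
  obtain ⟨f, hf⟩ : F.Nonempty := closure_nonempty_iff.1 ⟨x₁, hx₁F⟩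
  have hFJ : Disjoint F (A₁ ∪ A₂) := disjoint_union_right.2 ⟨hF₁, hF₂⟩
  have h₃J : Disjoint (A₃ \ {p, q}) (A₁ ∪ A₂) := by
    rw [disjoint_left]
    rintro z ⟨hz, hzpq⟩ (h | h)
    · exact hzpq (h₁₃ ▸ ⟨h, hz⟩)
    · exact hzpq (h₂₃ ▸ ⟨h, hz⟩)
  refine false_of_chord_in_face h₁ h₂ h₃ h₁₂ h₁₃ h₂₃ hF hf hFJ hF₃ hx₁ hx₂ hx₁F hx₂F fun z hz => ?_
  exact notSep_of_mem_closure hF h₃.isPreconnected_interior hFJ h₃J hx₃F (subset_closure hx₃)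
    (disjoint_left.1 h₃J hx₃) hf hz

/-- No face of a closed curve with two disjoint chords with alternating end points touches all
four end points. -/
lemma false_of_crossing {Aab Abc Acd Ada P Q F : Set ℂ} {a b c d : ℂ}
    (hab : IsSimpleArc Aab a b) (hbc : IsSimpleArc Abc b c) (hcd : IsSimpleArc Acd c d)
    (hda : IsSimpleArc Ada d a) (hP : IsSimpleArc P a c) (hQ : IsSimpleArc Q b d)
    (habc : Aab ∩ Abc ⊆ {b}) (hbcd : Abc ∩ Acd ⊆ {c}) (hcda : Acd ∩ Ada ⊆ {d})
    (hdab : Ada ∩ Aab ⊆ {a}) (hac : Disjoint Aab Acd) (hbd : Disjoint Abc Ada)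
    (hPJ : P ∩ (Aab ∪ Abc ∪ Acd ∪ Ada) ⊆ {a, c})
    (hPQ : Disjoint P Q)
    (hF : IsPreconnected F) (hFJ : Disjoint F (Aab ∪ Abc ∪ Acd ∪ Ada)) (hFP : Disjoint F P)
    (hFQ : Disjoint F Q) (ha : a ∈ closure F) (hb : b ∈ closure F) (hc : c ∈ closure F)
    (hd : d ∈ closure F) : False := by
  obtain ⟨f, hf⟩ : F.Nonempty := closure_nonempty_iff.1 ⟨a, ha⟩
  have haP := hP.left_mem
  have hcP := hP.right_mem
  have hbQ := hQ.left_mem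
  have hdQ := hQ.right_mem
  have haab := hab.left_mem
  have hbab := hab.right_mem
  have hbbc := hbc.left_mem
  have hcbc := hbc.right_mem
  have hccd := hcd.left_mem
  have hdcd := hcd.right_mem
  have hdda := hda.left_mem
  have hada := hda.right_mem
  have habne : a ≠ b := fun h => disjoint_left.1 hPQ haP (h ▸ hbQ)
  have hcbne : c ≠ b := fun h => disjoint_left.1 hPQ hcP (h ▸ hbQ)
  have hadne : a ≠ d := fun h => disjoint_left.1 hPQ haP (h ▸ hdQ)
  have hcdne : c ≠ d := fun h => disjoint_left.1 hPQ hcP (h ▸ hdQ)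
  set J := Aab ∪ Abc ∪ Acd ∪ Ada with hJ
  have h₁ : IsSimpleArc (Aab ∪ Abc) a c := hab.trans hbc habc
  have h₂ : IsSimpleArc (Acd ∪ Ada) c a := hcd.trans hda hcda
  have hJ' : (Aab ∪ Abc) ∪ (Acd ∪ Ada) = J := by rw [hJ, ← union_assoc]
  have h₁₂ : (Aab ∪ Abc) ∩ (Acd ∪ Ada) = {a, c} := by
    apply Subset.antisymm
    · rintro z ⟨hz | hz, hz' | hz'⟩
      · exact absurd hz' (disjoint_left.1 hac hz)
      · exact Or.inl (hdab ⟨hz', hz⟩)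
      · exact Or.inr (hbcd ⟨hz, hz'⟩)
      · exact absurd hz' (disjoint_left.1 hbd hz)
    · rintro z (rfl | rfl)
      · exact ⟨Or.inl haab, Or.inr hada⟩
      · exact ⟨Or.inr hcbc, Or.inl hccd⟩
  have h₁P : (Aab ∪ Abc) ∩ P = {a, c} := by
    apply Subset.antisymm
    · rintro z ⟨hz, hz'⟩
      exact hPJ ⟨hz', hJ' ▸ Or.inl hz⟩
    · rintro z (rfl | rfl)
      · exact ⟨Or.inl haab, haP⟩
      · exact ⟨Or.inr hcbc, hcP⟩
  have h₂P : (Acd ∪ Ada) ∩ P = {a, c} := by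
    apply Subset.antisymm
    · rintro z ⟨hz, hz'⟩
      exact hPJ ⟨hz', hJ' ▸ Or.inr hz⟩
    · rintro z (rfl | rfl)
      · exact ⟨Or.inr hada, haP⟩
      · exact ⟨Or.inl hccd, hcP⟩
  refine false_of_chord_in_face h₁ h₂.symm hP h₁₂ h₁P h₂P hF hf (hJ' ▸ hFJ) hFP (x₁ := b) (x₂ := d)
    ⟨Or.inl hbab, by simp [habne.symm, hcbne.symm]⟩ ⟨Or.inl hdcd, by simp [hadne.symm, hcdne.symm]⟩
    hb hd fun z hz => ?_
  rw [hJ']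
  -- both `F` and the interior of `P` touch `a` and `c`, which lie on different sides of `b` and `d`
  have hinter : ((Abc ∪ Acd) ∪ Q) ∩ ((Ada ∪ Aab) ∪ Q) = Q := by
    apply Subset.antisymm
    · rintro z ⟨(hz | hz) | hz, (hz' | hz') | hz'⟩ <;> try assumption
      · exact absurd hz' (disjoint_left.1 hbd hz)
      · rw [show z = b from habc ⟨hz', hz⟩]; exact hbQ
      · rw [show z = d from hcda ⟨hz, hz'⟩]; exact hdQ
      · exact absurd hz (disjoint_left.1 hac hz')
    · exact fun z hz => ⟨Or.inr hz, Or.inr hz⟩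
  have hun : ((Abc ∪ Acd) ∪ Q) ∪ ((Ada ∪ Aab) ∪ Q) = J ∪ Q := by
    rw [hJ]; ext z; simp only [mem_union]; tauto
  have hPJ' : Disjoint (P \ {a, c}) (J ∪ Q) := by
    rw [disjoint_left]
    rintro w ⟨hw, hwac⟩ (h | h)
    · exact hwac (hPJ ⟨hw, h⟩)
    · exact disjoint_left.1 hPQ hw h
  have key := notSep_union_of_mem_closure (K₁ := (Abc ∪ Acd) ∪ Q) (K₂ := (Ada ∪ Aab) ∪ Q)
    (X := F) (Y := P \ {a, c}) (b := c) (d := a) (x := f) (y := z)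
    ((hbc.isLogGood.isCompact.union hcd.isLogGood.isCompact).union hQ.isLogGood.isCompact)
    ((hda.isLogGood.isCompact.union hab.isLogGood.isCompact).union hQ.isLogGood.isCompact)
    (by rw [hinter]; exact hQ.isLogGood.isConnected) hF hP.isPreconnected_interior
    (by rw [hun]; exact disjoint_union_right.2 ⟨hFJ, hFQ⟩)
    (by rw [hun]; exact hPJ')
    hc hP.right_mem_closure_interior
    (by
      rintro ((h | h) | h)
      · exact hcdne (hcda ⟨hccd, h⟩)
      · exact hcbne (habc ⟨h, hcbc⟩)
      · exact disjoint_left.1 hPQ hcP h)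
    ha hP.left_mem_closure_interior
    (by
      rintro ((h | h) | h)
      · exact habne (habc ⟨haab, h⟩)
      · exact hadne (hcda ⟨h, hada⟩)
      · exact disjoint_left.1 hPQ haP h)
    hf hz
  exact key.mono (by rw [hun]; exact subset_union_left)

/-! ### Paths and cycles in a drawing -/

namespace PlaneEmbedding

variable {V : Type*} {G : SimpleGraph V} (D : PlaneEmbedding G)

/-- The union of the arcs that join consecutive vertices of a list. -/
def draw (l : List V) : Set ℂ := {z | ∃ u v, [u, v] <:+: l ∧ z ∈ D.arc s(u, v)}

lemma draw_cons_cons (a b : V) (l : List V) :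
    D.draw (a :: b :: l) = D.arc s(a, b) ∪ D.draw (b :: l) := by
  ext z
  constructor
  · rintro ⟨u, v, h, hz⟩
    rcases List.infix_cons_iff.1 h with h | h
    · obtain ⟨rfl, h'⟩ := List.cons_prefix_cons.1 h
      obtain ⟨rfl, -⟩ := List.cons_prefix_cons.1 h'
      exact Or.inl hz
    · exact Or.inr ⟨u, v, h, hz⟩
  · rintro (hz | ⟨u, v, h, hz⟩)
    · exact ⟨a, b, ⟨[], l, rfl⟩, hz⟩
    · exact ⟨u, v, h.trans (List.suffix_cons _ _).isInfix, hz⟩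

lemma draw_singleton (a : V) : D.draw [a] = ∅ := by
  rw [eq_empty_iff_forall_notMem]
  rintro z ⟨u, v, h, -⟩
  simpa using h.length_le

lemma draw_pair (a b : V) : D.draw [a, b] = D.arc s(a, b) := by
  rw [draw_cons_cons, draw_singleton, union_empty]

variable {D}

lemma adj_of_infix {l : List V} (hl : l.IsChain G.Adj) {u v : V} (h : [u, v] <:+: l) :
    G.Adj u v := by
  simpa using hl.infix h

lemma draw_subset_support {l : List V} (hl : l.IsChain G.Adj) : D.draw l ⊆ D.support := by
  rintro z ⟨u, v, h, hz⟩
  refine Or.inr (mem_iUnion₂.2 ⟨s(u, v), ?_, hz⟩)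
  exact adj_of_infix hl h

/-- If no edge of the first path joins two vertices of the second path, then the two drawings meet
only in common vertices. -/
lemma exists_of_mem_draw {l l' : List V} (hl : l.IsChain G.Adj) (hl' : l'.IsChain G.Adj)
    (h : ∀ u v, [u, v] <:+: l → u ∈ l' → v ∉ l') {z : ℂ} (hz : z ∈ D.draw l)
    (hz' : z ∈ D.draw l') : ∃ w, w ∈ l ∧ w ∈ l' ∧ D.point w = z := by
  obtain ⟨u, v, huv, hz⟩ := hz
  obtain ⟨u', v', huv', hz'⟩ := hz'
  have hmem : ∀ w, w ∈ s(u, v) → w ∈ l := fun w hw => huv.subset (by simpa using hw)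
  have hmem' : ∀ w, w ∈ s(u', v') → w ∈ l' := fun w hw => huv'.subset (by simpa using hw)
  have hne : s(u, v) ≠ s(u', v') := by
    intro heq
    exact h u v huv (hmem' u (heq ▸ Sym2.mem_mk_left u v)) (hmem' v (heq ▸ Sym2.mem_mk_right u v))
  obtain ⟨w, hw, hw', hwz⟩ := D.crossing_free _ (adj_of_infix hl huv) _ (adj_of_infix hl' huv')
    hne z ⟨hz, hz'⟩
  exact ⟨w, hmem w hw, hmem' w hw', hwz⟩

/-- Two paths with at most one common vertex. -/
lemma draw_inter_draw_subset {l l' : List V} (hl : l.IsChain G.Adj) (hl' : l'.IsChain G.Adj)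
    {b : V} (h : ∀ w ∈ l, w ∈ l' → w = b) : D.draw l ∩ D.draw l' ⊆ {D.point b} := by
  rintro z ⟨hz, hz'⟩
  obtain ⟨w, hw, hw', rfl⟩ := exists_of_mem_draw hl hl' (by
    intro u v huv hu hv
    have h1 := h u (huv.subset (by simp)) hu
    have h2 := h v (huv.subset (by simp)) hv
    have := adj_of_infix hl huv
    rw [h1, h2] at this
    exact G.loopless.irrefl _ this) hz hz'
  rw [h w hw hw']; rfl

lemma disjoint_draw {l l' : List V} (hl : l.IsChain G.Adj) (hl' : l'.IsChain G.Adj)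
    (h : ∀ w ∈ l, w ∉ l') : Disjoint (D.draw l) (D.draw l') := by
  rw [disjoint_left]
  intro z hz hz'
  obtain ⟨w, hw, hw', -⟩ := exists_of_mem_draw hl hl' (fun u v huv hu =>
    absurd hu (h u (huv.subset (by simp)))) hz hz'
  exact h w hw hw'

lemma isSimpleArc_draw : ∀ (l : List V) (a b : V), (a :: (l ++ [b])).IsChain G.Adj →
    (a :: (l ++ [b])).Nodup → IsSimpleArc (D.draw (a :: (l ++ [b]))) (D.point a) (D.point b)
  | [], a, b, hl, _ => by
    rw [List.nil_append, draw_pair]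
    exact D.isSimpleArc a b (by simpa using hl)
  | x :: l, a, b, hl, hn => by
    have hl' : (x :: (l ++ [b])).IsChain G.Adj := hl.tail
    have hax : G.Adj a x := by
      rw [List.cons_append, List.isChain_cons_cons] at hl; exact hl.1
    rw [List.cons_append, draw_cons_cons, ← draw_pair]
    rw [List.cons_append] at hn
    refine IsSimpleArc.trans (q := D.point x) ?_ (isSimpleArc_draw l x b hl' hn.of_cons) ?_
    · rw [draw_pair]; exact D.isSimpleArc a x hax
    · refine draw_inter_draw_subset (by simpa using hax) hl' fun w hw hw' => ?_
      simp only [List.mem_cons, List.not_mem_nil, or_false] at hw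
      rcases hw with rfl | rfl
      · exact absurd hw' (List.nodup_cons.1 hn).1
      · rfl

lemma point_mem_draw : ∀ (l : List V) (a b : V), (a :: (l ++ [b])).IsChain G.Adj →
    ∀ w ∈ l, D.point w ∈ D.draw (a :: (l ++ [b]))
  | [], _, _, _, w, hw => by simp at hw
  | x :: l, a, b, hl, w, hw => by
    rw [List.cons_append, draw_cons_cons]
    have hax : G.Adj a x := by
      rw [List.cons_append, List.isChain_cons_cons] at hl; exact hl.1
    rcases List.mem_cons.1 hw with rfl | hw
    · exact Or.inl (D.isSimpleArc a w hax).right_mem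
    · exact Or.inr (point_mem_draw l x b hl.tail w hw)

lemma disjoint_outerFace_draw {l : List V} (hl : l.IsChain G.Adj) :
    Disjoint D.outerFace (D.draw l) :=
  disjoint_left.2 fun _ hz hz' => hz.1 (draw_subset_support hl hz')

section Outer

variable [Finite V]

lemma isBounded_support : Bornology.IsBounded D.support := by
  refine (Set.finite_range _).isBounded.union ?_
  rw [Bornology.isBounded_biUnion G.edgeSet.toFinite]
  intro e he
  induction e with
  | _ u v => exact (D.isSimpleArc u v he).isLogGood.isCompact.isBounded

lemma isPreconnected_outerFace : IsPreconnected D.outerFace := by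
  rcases D.outerFace.eq_empty_or_nonempty with h | ⟨z, hz⟩
  · rw [h]; exact isPreconnected_empty
  · have : D.outerFace = connectedComponentIn D.supportᶜ z := by
      ext w
      constructor
      · intro hw
        exact mem_connectedComponentIn_of_not_isBounded isBounded_support hw.1 hz.2 hw.2
      · intro hw
        exact ⟨connectedComponentIn_subset _ _ hw, by rw [← connectedComponentIn_eq hw]; exact hz.2⟩
    rw [this]
    exact isPreconnected_connectedComponentIn

/-- In an outerplanar drawing no two vertices are joined by three internally disjoint paths with
inner vertices. -/
lemma false_of_three_paths (hD : ∀ v : V, D.point v ∈ frontier D.outerFace) {a b : V}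
    {l₁ l₂ l₃ : List V} (h₁ : (a :: (l₁ ++ [b])).IsChain G.Adj)
    (h₂ : (a :: (l₂ ++ [b])).IsChain G.Adj) (h₃ : (a :: (l₃ ++ [b])).IsChain G.Adj)
    (hn₁ : (a :: (l₁ ++ [b])).Nodup) (hn₂ : (a :: (l₂ ++ [b])).Nodup)
    (hn₃ : (a :: (l₃ ++ [b])).Nodup) (h₁₂ : l₁.Disjoint l₂) (h₁₃ : l₁.Disjoint l₃)
    (h₂₃ : l₂.Disjoint l₃) (hne₁ : l₁ ≠ []) (hne₂ : l₂ ≠ []) (hne₃ : l₃ ≠ []) : False := by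
  have aux : ∀ l l' : List V, (a :: (l ++ [b])).IsChain G.Adj →
      (a :: (l' ++ [b])).IsChain G.Adj → (a :: (l ++ [b])).Nodup → (a :: (l' ++ [b])).Nodup →
      l.Disjoint l' → l ≠ [] →
      D.draw (a :: (l ++ [b])) ∩ D.draw (a :: (l' ++ [b])) = {D.point a, D.point b} := by
    intro l l' hl hl' hn hn' hd hne
    apply Subset.antisymm
    · rintro z ⟨hz, hz'⟩
      have hcommon : ∀ w, w ∈ a :: (l ++ [b]) → w ∈ a :: (l' ++ [b]) → w = a ∨ w = b := by
        intro w hw hw'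
        simp only [List.mem_cons, List.mem_append, List.not_mem_nil, or_false] at hw hw'
        rcases hw with h | h | h
        · exact Or.inl h
        · rcases hw' with h' | h' | h'
          · exact Or.inl h'
          · exact absurd h' (hd h)
          · exact Or.inr h'
        · exact Or.inr h
      -- an edge of the first path cannot join `a` and `b`
      obtain ⟨w, hw, hw', rfl⟩ := exists_of_mem_draw hl hl' (by
        rintro u v ⟨s, t, hst⟩ hu hv
        have hu' := hcommon u (by rw [← hst]; simp) hu
        have hv' := hcommon v (by rw [← hst]; simp) hv
        obtain ⟨x, l, rfl⟩ := List.exists_cons_of_ne_nil hne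
        have hax : a ≠ x := by rintro rfl; simp at hn
        have hbx : b ≠ x := by rintro rfl; simp at hn
        have hab : a ≠ b := by rintro rfl; simp at hn
        rcases s with _ | ⟨s0, s⟩
        · simp only [List.nil_append, List.cons_append, List.cons.injEq] at hst
          rcases hv' with h | h
          · exact hax (h.symm.trans hst.2.1)
          · exact hbx (h.symm.trans hst.2.1)
        · rw [← hst] at hn
          simp only [List.cons_append, List.cons.injEq] at hst
          obtain ⟨rfl, hst⟩ := hst
          have hu'' : u ≠ s0 := by rintro rfl; simp at hn
          have hv'' : v ≠ s0 := by rintro rfl; simp at hn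
          have hub := hu'.resolve_left hu''
          have hvb := hv'.resolve_left hv''
          rw [hub, hvb] at hn
          simp [List.nodup_append] at hn) hz hz'
      rcases hcommon w hw hw' with rfl | rfl
      · exact Or.inl rfl
      · exact Or.inr rfl
    · rintro z (rfl | rfl)
      · exact ⟨(isSimpleArc_draw _ _ _ hl hn).left_mem, (isSimpleArc_draw _ _ _ hl' hn').left_mem⟩
      · exact ⟨(isSimpleArc_draw _ _ _ hl hn).right_mem, (isSimpleArc_draw _ _ _ hl' hn').right_mem⟩
  have inner : ∀ l : List V, (a :: (l ++ [b])).IsChain G.Adj → (a :: (l ++ [b])).Nodup →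
      ∀ w ∈ l, D.point w ∈ D.draw (a :: (l ++ [b])) \ {D.point a, D.point b} := by
    intro l hl hn w hw
    refine ⟨point_mem_draw _ _ _ hl w hw, ?_⟩
    rintro (h | h)
    · rw [D.point_injective h] at hw
      exact (List.nodup_cons.1 hn).1 (List.mem_append_left _ hw)
    · rw [D.point_injective h] at hw
      exact (List.disjoint_of_nodup_append hn.of_cons) hw (by simp)
  obtain ⟨x₁, hx₁⟩ := List.exists_mem_of_ne_nil _ hne₁
  obtain ⟨x₂, hx₂⟩ := List.exists_mem_of_ne_nil _ hne₂
  obtain ⟨x₃, hx₃⟩ := List.exists_mem_of_ne_nil _ hne₃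
  exact false_of_theta (isSimpleArc_draw _ _ _ h₁ hn₁) (isSimpleArc_draw _ _ _ h₂ hn₂)
    (isSimpleArc_draw _ _ _ h₃ hn₃) (aux _ _ h₁ h₂ hn₁ hn₂ h₁₂ hne₁)
    (aux _ _ h₁ h₃ hn₁ hn₃ h₁₃ hne₁) (aux _ _ h₂ h₃ hn₂ hn₃ h₂₃ hne₂) isPreconnected_outerFace
    (disjoint_outerFace_draw h₁) (disjoint_outerFace_draw h₂) (disjoint_outerFace_draw h₃)
    (inner _ h₁ hn₁ x₁ hx₁) (inner _ h₂ hn₂ x₂ hx₂) (inner _ h₃ hn₃ x₃ hx₃)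
    (hD x₁).1 (hD x₂).1 (hD x₃).1

/-- In an outerplanar drawing no two chords of a cycle cross. -/
lemma false_of_crossing_chords (hD : ∀ v : V, D.point v ∈ frontier D.outerFace) {a b c d : V}
    {l₁ l₂ l₃ l₄ : List V} (h₁ : (a :: (l₁ ++ [b])).IsChain G.Adj)
    (h₂ : (b :: (l₂ ++ [c])).IsChain G.Adj) (h₃ : (c :: (l₃ ++ [d])).IsChain G.Adj)
    (h₄ : (d :: (l₄ ++ [a])).IsChain G.Adj)
    (hn : (a :: (l₁ ++ b :: (l₂ ++ c :: (l₃ ++ d :: l₄)))).Nodup)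
    (hac : G.Adj a c) (hbd : G.Adj b d) : False := by
  have hac' : [a, c].IsChain G.Adj := by simpa using hac
  have hbd' : [b, d].IsChain G.Adj := by simpa using hbd
  refine false_of_crossing (F := D.outerFace) (isSimpleArc_draw _ _ _ h₁ ?_)
    (isSimpleArc_draw _ _ _ h₂ ?_)
    (isSimpleArc_draw _ _ _ h₃ ?_) (isSimpleArc_draw _ _ _ h₄ ?_) (D.isSimpleArc a c hac)
    (D.isSimpleArc b d hbd) (draw_inter_draw_subset h₁ h₂ ?_) (draw_inter_draw_subset h₂ h₃ ?_)
    (draw_inter_draw_subset h₃ h₄ ?_) (draw_inter_draw_subset h₄ h₁ ?_) (disjoint_draw h₁ h₃ ?_)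
    (disjoint_draw h₂ h₄ ?_) ?_ ?_ isPreconnected_outerFace ?_
    (D.draw_pair a c ▸ disjoint_outerFace_draw hac')
    (D.draw_pair b d ▸ disjoint_outerFace_draw hbd') (hD a).1 (hD b).1 (hD c).1 (hD d).1
  any_goals
    first
    | (simp only [List.nodup_cons, List.nodup_append, List.mem_append, List.mem_cons,
        List.not_mem_nil, or_false] at hn ⊢
       grind)
    | skip
  · rw [← D.draw_pair a c]
    rintro z ⟨hz, ((h | h) | h) | h⟩
    · exact Or.inl (draw_inter_draw_subset hac' h₁ (b := a) (by grind) ⟨hz, h⟩)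
    · exact Or.inr (draw_inter_draw_subset hac' h₂ (b := c) (by grind) ⟨hz, h⟩)
    · exact Or.inr (draw_inter_draw_subset hac' h₃ (b := c) (by grind) ⟨hz, h⟩)
    · exact Or.inl (draw_inter_draw_subset hac' h₄ (b := a) (by grind) ⟨hz, h⟩)
  · rw [← D.draw_pair a c, ← D.draw_pair b d]
    exact disjoint_draw hac' hbd' (by grind)
  · simp only [disjoint_union_right]
    exact ⟨⟨⟨disjoint_outerFace_draw h₁, disjoint_outerFace_draw h₂⟩, disjoint_outerFace_draw h₃⟩,
      disjoint_outerFace_draw h₄⟩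

end Outer

end PlaneEmbedding

/-! ### Noncrossing vertex orders -/

section NonCrossing

variable {V : Type*} {G : SimpleGraph V}

/-- No two edges cross when the vertices are drawn on a line in the order of the list `l` and the
edges are drawn on one side of the line. -/
def NonCrossing (G : SimpleGraph V) (l : List V) : Prop :=
  ∀ a b c d, [a, b, c, d].Sublist l → ¬ (G.Adj a c ∧ G.Adj b d)

lemma NonCrossing.sublist {l l' : List V} (h : NonCrossing G l) (hl : l'.Sublist l) :
    NonCrossing G l' := fun a b c d hs => h a b c d (hs.trans hl)

lemma four_eq_append {a b c d : V} {x y : List V} (h : [a, b, c, d] = x ++ y) :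
    (x = [] ∧ y = [a, b, c, d]) ∨ (x = [a] ∧ y = [b, c, d]) ∨ (x = [a, b] ∧ y = [c, d]) ∨
      (x = [a, b, c] ∧ y = [d]) ∨ (x = [a, b, c, d] ∧ y = []) := by
  rcases x with _ | ⟨x0, _ | ⟨x1, _ | ⟨x2, _ | ⟨x3, _ | ⟨x4, x⟩⟩⟩⟩⟩ <;> simp_all

lemma NonCrossing.rotate {l₁ l₂ : List V} (h : NonCrossing G (l₁ ++ l₂)) :
    NonCrossing G (l₂ ++ l₁) := by
  rintro a b c d hs ⟨hac, hbd⟩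
  obtain ⟨x, y, hxy, hx, hy⟩ := List.sublist_append_iff.1 hs
  have key := hy.append hx
  rcases four_eq_append hxy with ⟨rfl, rfl⟩ | ⟨rfl, rfl⟩ | ⟨rfl, rfl⟩ | ⟨rfl, rfl⟩ | ⟨rfl, rfl⟩
  · exact h _ _ _ _ key ⟨hac, hbd⟩
  · exact h _ _ _ _ key ⟨hbd, hac.symm⟩
  · exact h _ _ _ _ key ⟨hac.symm, hbd.symm⟩
  · exact h _ _ _ _ key ⟨hbd.symm, hac⟩
  · exact h _ _ _ _ key ⟨hac, hbd⟩

/-- Vertex orders of two graphs without edges between them may be concatenated. -/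
lemma NonCrossing.append {l₁ l₂ : List V} (h₁ : NonCrossing G l₁) (h₂ : NonCrossing G l₂)
    (h : ∀ a ∈ l₁, ∀ b ∈ l₂, ¬ G.Adj a b) : NonCrossing G (l₁ ++ l₂) := by
  rintro a b c d hs ⟨hac, hbd⟩
  obtain ⟨x, y, hxy, hx, hy⟩ := List.sublist_append_iff.1 hs
  rcases four_eq_append hxy with ⟨rfl, rfl⟩ | ⟨rfl, rfl⟩ | ⟨rfl, rfl⟩ | ⟨rfl, rfl⟩ | ⟨rfl, rfl⟩
  · exact h₂ _ _ _ _ hy ⟨hac, hbd⟩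
  · exact h a (hx.subset (by simp)) c (hy.subset (by simp)) hac
  · exact h a (hx.subset (by simp)) c (hy.subset (by simp)) hac
  · exact h b (hx.subset (by simp)) d (hy.subset (by simp)) hbd
  · exact h₁ _ _ _ _ hx ⟨hac, hbd⟩

/-- Vertex orders of two graphs that share only a cut vertex `v` may be glued at `v`. -/
lemma NonCrossing.cons_append {v : V} {l₁ l₂ : List V} (h₁ : NonCrossing G (v :: l₁))
    (h₂ : NonCrossing G (v :: l₂)) (h : ∀ a ∈ l₁, ∀ b ∈ l₂, ¬ G.Adj a b) :
    NonCrossing G (v :: (l₁ ++ l₂)) := by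
  rintro a b c d hs ⟨hac, hbd⟩
  rcases List.sublist_cons_iff.1 hs with hs | ⟨r, hr, hs⟩
  · exact (h₁.sublist (List.sublist_cons_self _ _)).append (h₂.sublist (List.sublist_cons_self _ _))
      h a b c d hs ⟨hac, hbd⟩
  obtain ⟨rfl, rfl⟩ := List.cons.inj hr
  obtain ⟨x, y, hxy, hx, hy⟩ := List.sublist_append_iff.1 hs
  rcases x with _ | ⟨x0, _ | ⟨x1, _ | ⟨x2, x⟩⟩⟩
  · simp only [List.nil_append] at hxy
    exact h₂ _ _ _ _ (List.Sublist.cons_cons a (hxy ▸ hy)) ⟨hac, hbd⟩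
  · obtain ⟨rfl, rfl⟩ := List.cons.inj hxy
    exact h b (hx.subset (by simp)) d (hy.subset (by simp)) hbd
  · simp only [List.cons_append, List.nil_append, List.cons.injEq] at hxy
    obtain ⟨rfl, rfl, rfl⟩ := hxy
    exact h b (hx.subset (by simp)) d (hy.subset (by simp)) hbd
  · simp only [List.cons_append, List.cons.injEq, List.nil_eq, List.append_eq_nil_iff] at hxy
    obtain ⟨rfl, rfl, rfl, rfl, rfl⟩ := hxy
    exact h₁ _ _ _ _ (List.Sublist.cons_cons a hx) ⟨hac, hbd⟩

/-- The list `a :: m` is the vertex sequence of a cycle; the degenerate cycle consisting of one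
edge is admitted. -/
structure IsCyc (G : SimpleGraph V) (a : V) (m : List V) : Prop where
  chain : (a :: (m ++ [a])).IsChain G.Adj
  nodup : (a :: m).Nodup
  ne_nil : m ≠ []

lemma isChain_append_singleton {a b : V} {l₁ l₂ : List V} :
    (a :: (l₁ ++ b :: l₂)).IsChain G.Adj ↔
      (a :: (l₁ ++ [b])).IsChain G.Adj ∧ (b :: l₂).IsChain G.Adj := by
  have := List.isChain_split (R := G.Adj) (l₁ := a :: l₁) (c := b) (l₂ := l₂)
  simpa using this

lemma IsCyc.rotate {a b : V} {m₁ m₂ : List V} (h : IsCyc G a (m₁ ++ b :: m₂)) :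
    IsCyc G b (m₂ ++ a :: m₁) := by
  obtain ⟨hc, hn, -⟩ := h
  refine ⟨?_, ?_, by simp⟩
  · rw [List.append_assoc, List.cons_append, isChain_append_singleton] at hc
    rw [List.append_assoc, List.cons_append, isChain_append_singleton]
    exact ⟨hc.2, hc.1⟩
  · refine List.Perm.nodup ?_ hn
    rw [← List.cons_append, ← List.cons_append]
    exact List.perm_append_comm

lemma IsCyc.exists_rotate {a b : V} {m : List V} (h : IsCyc G a m) (hb : b ∈ a :: m) :
    ∃ m', IsCyc G b m' ∧ (b :: m').Perm (a :: m) := by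
  rcases List.mem_cons.1 hb with rfl | hb
  · exact ⟨m, h, List.Perm.refl _⟩
  · obtain ⟨m₁, m₂, rfl⟩ := List.append_of_mem hb
    refine ⟨_, h.rotate, ?_⟩
    rw [← List.cons_append, ← List.cons_append]
    exact List.perm_append_comm

/-- The two configurations which do not occur in outerplanar drawings: three internally disjoint
paths, and two crossing chords of a cycle. -/
structure NoObstruction (G : SimpleGraph V) : Prop where
  no_theta : ∀ (a b : V) (l₁ l₂ l₃ : List V), (a :: (l₁ ++ [b])).IsChain G.Adj →
    (a :: (l₂ ++ [b])).IsChain G.Adj → (a :: (l₃ ++ [b])).IsChain G.Adj →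
    (a :: (l₁ ++ [b])).Nodup → (a :: (l₂ ++ [b])).Nodup →
    (a :: (l₃ ++ [b])).Nodup → l₁.Disjoint l₂ → l₁.Disjoint l₃ →
    l₂.Disjoint l₃ → l₁ ≠ [] → l₂ ≠ [] → l₃ ≠ [] → False
  no_crossing : ∀ (a b c d : V) (l₁ l₂ l₃ l₄ : List V), (a :: (l₁ ++ [b])).IsChain G.Adj →
    (b :: (l₂ ++ [c])).IsChain G.Adj → (c :: (l₃ ++ [d])).IsChain G.Adj →
    (d :: (l₄ ++ [a])).IsChain G.Adj →
    (a :: (l₁ ++ b :: (l₂ ++ c :: (l₃ ++ d :: l₄)))).Nodup →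
    G.Adj a c → G.Adj b d → False

lemma IsCyc.not_crossing_head (hG : NoObstruction G) {a b c d : V} {m : List V}
    (h : IsCyc G a m) (hs : [b, c, d].Sublist m) : ¬ (G.Adj a c ∧ G.Adj b d) := by
  rintro ⟨hac, hbd⟩
  obtain ⟨r₁, r₂, rfl, hb, hs₂⟩ := List.cons_sublist_iff.1 hs
  obtain ⟨l₁, s₁, rfl⟩ := List.append_of_mem hb
  obtain ⟨r₃, r₄, rfl, hc, hs₃⟩ := List.cons_sublist_iff.1 hs₂
  obtain ⟨t₁, t₂, rfl⟩ := List.append_of_mem hc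
  obtain ⟨u₁, u₂, rfl⟩ := List.append_of_mem (List.singleton_sublist.1 hs₃)
  have hch := h.chain
  have hn := h.nodup
  have e : (l₁ ++ b :: s₁) ++ ((t₁ ++ c :: t₂) ++ (u₁ ++ d :: u₂)) =
      l₁ ++ b :: ((s₁ ++ t₁) ++ c :: ((t₂ ++ u₁) ++ d :: u₂)) := by simp
  rw [e] at hch hn
  have e' : l₁ ++ b :: ((s₁ ++ t₁) ++ c :: ((t₂ ++ u₁) ++ d :: u₂)) ++ [a] =
      l₁ ++ b :: ((s₁ ++ t₁) ++ c :: ((t₂ ++ u₁) ++ d :: (u₂ ++ [a]))) := by simp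
  rw [e'] at hch
  obtain ⟨h₁, hch⟩ := isChain_append_singleton.1 hch
  obtain ⟨h₂, hch⟩ := isChain_append_singleton.1 hch
  obtain ⟨h₃, h₄⟩ := isChain_append_singleton.1 hch
  exact hG.no_crossing a b c d _ _ _ _ h₁ h₂ h₃ h₄ hn hac hbd

lemma IsCyc.nonCrossing (hG : NoObstruction G) {a : V} {m : List V} (h : IsCyc G a m) :
    NonCrossing G (a :: m) := by
  intro w b c d hs
  rcases List.sublist_cons_iff.1 hs with hs | ⟨r, hr, hs⟩
  · obtain ⟨r₁, r₂, rfl, hw, hs'⟩ := List.cons_sublist_iff.1 hs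
    obtain ⟨m₁, m₂, rfl⟩ := List.append_of_mem hw
    have h' : IsCyc G w (m₂ ++ r₂ ++ a :: m₁) := by
      have : IsCyc G a (m₁ ++ w :: (m₂ ++ r₂)) := by simpa using h
      exact this.rotate
    refine h'.not_crossing_head hG (hs'.trans ?_)
    exact (List.sublist_append_right _ _).trans (List.sublist_append_left _ _)
  · obtain ⟨rfl, rfl⟩ := List.cons.inj hr
    exact h.not_crossing_head hG hs

/-- A cycle with an outer path between two of its vertices is not a longest cycle. -/
lemma IsCyc.exists_longer (hG : NoObstruction G) {a b : V} {m p : List V} (h : IsCyc G a m)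
    (hb : b ∈ m) (hp : (a :: (p ++ [b])).IsChain G.Adj) (hpn : p.Nodup) (hp0 : p ≠ [])
    (hd : ∀ w ∈ p, w ∉ a :: m) :
    ∃ a' m', IsCyc G a' m' ∧ m.length < m'.length ∧ ∀ w ∈ a' :: m', w ∈ a :: m ∨ w ∈ p := by
  obtain ⟨m₁, m₂, rfl⟩ := List.append_of_mem hb
  have hch := h.chain
  have hn := h.nodup
  rw [List.append_assoc, List.cons_append, isChain_append_singleton] at hch
  have hlen : 0 < p.length := List.length_pos_iff.2 hp0
  have hrev : ∀ l : List V, (a :: (l ++ [b])).IsChain G.Adj →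
      (b :: (l.reverse ++ [a])).IsChain G.Adj := by
    intro l hl
    have : (a :: (l ++ [b])).reverse.IsChain G.Adj :=
      List.isChain_reverse.2 (hl.imp fun _ _ h => h.symm)
    simpa using this
  have hrev' : ∀ l : List V, (b :: (l ++ [a])).IsChain G.Adj →
      (a :: (l.reverse ++ [b])).IsChain G.Adj := by
    intro l hl
    have : (b :: (l ++ [a])).reverse.IsChain G.Adj :=
      List.isChain_reverse.2 (hl.imp fun _ _ h => h.symm)
    simpa using this
  rcases List.eq_nil_or_concat' m₁ with rfl | hm₁
  · refine ⟨a, p ++ b :: m₂, ⟨?_, ?_, by simp⟩, by simp; omega, ?_⟩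
    · rw [List.append_assoc, List.cons_append, isChain_append_singleton]
      exact ⟨hp, hch.2⟩
    · simp only [List.nodup_cons, List.nodup_append, List.mem_append, List.mem_cons,
        List.nil_append] at hn hd ⊢
      grind
    · simp; grind
  rcases List.eq_nil_or_concat' m₂ with rfl | hm₂
  · refine ⟨b, p.reverse ++ a :: m₁, ⟨?_, ?_, by simp⟩, by simp; omega, ?_⟩
    · rw [List.append_assoc, List.cons_append, isChain_append_singleton]
      exact ⟨hrev p hp, hch.1⟩
    · simp only [List.nodup_cons, List.nodup_append, List.mem_append, List.mem_cons,
        List.nodup_reverse, List.mem_reverse] at hn hd ⊢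
      grind
    · simp; grind
  · exfalso
    have hm₁' : m₁ ≠ [] := by rintro rfl; simp at hm₁
    have hm₂' : m₂ ≠ [] := by rintro rfl; simp at hm₂
    simp only [List.nodup_cons, List.nodup_append, List.mem_append, List.mem_cons] at hn hd
    refine hG.no_theta a b m₁ m₂.reverse p hch.1 (hrev' _ hch.2) hp ?_ ?_ ?_ ?_ ?_ ?_ hm₁'
      (by simpa using hm₂') hp0
    · simp only [List.nodup_cons, List.nodup_append, List.mem_append, List.mem_cons]
      grind
    · simp only [List.nodup_cons, List.nodup_append, List.mem_append, List.mem_cons,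
        List.nodup_reverse, List.mem_reverse]
      grind
    · simp only [List.nodup_cons, List.nodup_append, List.mem_append, List.mem_cons]
      grind
    · intro w hw hw'
      simp only [List.mem_reverse] at hw'
      grind
    · intro w hw hw'
      grind
    · intro w hw hw'
      simp only [List.mem_reverse] at hw
      grind

/-- In a graph without cut vertices, a cycle that misses a vertex is not a longest one. -/
lemma IsCyc.exists_longer_of_notMem (hG : NoObstruction G) [DecidableEq V] {s : Finset V}
    (hs : ∀ A B C : Finset V, A ∪ B ∪ C = s → Disjoint A B → Disjoint A C → Disjoint B C →
      C.card ≤ 1 → A.Nonempty → B.Nonempty → ∃ a ∈ A, ∃ b ∈ B, G.Adj a b) {a : V} {m : List V}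
    (h : IsCyc G a m) (hsub : ∀ w ∈ a :: m, w ∈ s) (hne : ∃ x ∈ s, x ∉ a :: m) :
    ∃ a' m', IsCyc G a' m' ∧ m.length < m'.length ∧ ∀ w ∈ a' :: m', w ∈ s := by
  classical
  obtain ⟨x₀, hx₀s, hx₀⟩ := hne
  -- an outer vertex `x` adjacent to the cycle
  obtain ⟨a', ha', x, hx, hax⟩ := hs (a :: m).toFinset (s \ (a :: m).toFinset) ∅ (by
      rw [Finset.union_empty, Finset.union_sdiff_of_subset]
      intro w hw; exact hsub w (List.mem_toFinset.1 hw)) Finset.disjoint_sdiff (by simp) (by simp)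
    (by simp) ⟨a, by simp⟩ ⟨x₀, Finset.mem_sdiff.2 ⟨hx₀s, fun hw => hx₀ (List.mem_toFinset.1 hw)⟩⟩
  obtain ⟨m', h', hperm⟩ := h.exists_rotate (List.mem_toFinset.1 ha')
  have hmem : ∀ w, w ∈ a' :: m' ↔ w ∈ a :: m := fun w => hperm.mem_iff
  have hlen : m'.length = m.length := by simpa using hperm.length_eq
  have hxs := (Finset.mem_sdiff.1 hx).1
  have hxm : x ∉ a' :: m' := fun hw =>
    (Finset.mem_sdiff.1 hx).2 (List.mem_toFinset.2 ((hmem x).1 hw))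
  -- the vertices reached from `a'` by outer paths
  let Q : V → Prop := fun z => ∃ p : List V, (p ++ [z]).Nodup ∧
    (a' :: (p ++ [z])).IsChain G.Adj ∧ ∀ w ∈ p ++ [z], w ∈ s ∧ w ∉ a' :: m'
  let B : Finset V := s.filter Q
  have hBs : B ⊆ s := Finset.filter_subset _ _
  have hBm : ∀ z ∈ B, z ∉ a' :: m' := by
    intro z hz
    obtain ⟨p, -, -, hp⟩ := (Finset.mem_filter.1 hz).2
    exact (hp z (by simp)).2
  have hQx : Q x := ⟨[], by simp, by simpa using hax, by simpa using ⟨hxs, by simpa using hxm⟩⟩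
  obtain ⟨c, hc⟩ := List.exists_mem_of_ne_nil _ h'.ne_nil
  have hca : c ≠ a' := fun hca => (List.nodup_cons.1 h'.nodup).1 (hca ▸ hc)
  have ha's : a' ∈ s := hsub a' ((hmem a').1 (by simp))
  obtain ⟨y, hy, z, hz, hyz⟩ := hs ((s \ B).erase a') B {a'} (by
      ext w
      simp only [Finset.mem_union, Finset.mem_erase, Finset.mem_sdiff, Finset.mem_singleton]
      constructor
      · rintro ((hw | hw) | rfl)
        · exact hw.2.1
        · exact hBs hw
        · exact ha's
      · intro hw
        by_cases h1 : w = a'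
        · exact Or.inr h1
        · by_cases h2 : w ∈ B
          · exact Or.inl (Or.inr h2)
          · exact Or.inl (Or.inl ⟨h1, hw, h2⟩))
    (Finset.disjoint_left.2 fun w hw hw' =>
      (Finset.mem_sdiff.1 (Finset.mem_of_mem_erase hw)).2 hw')
    (Finset.disjoint_singleton_right.2 (Finset.notMem_erase _ _))
    (Finset.disjoint_singleton_right.2 fun hw => hBm _ hw (by simp)) (by simp)
    ⟨c, Finset.mem_erase.2 ⟨hca, Finset.mem_sdiff.2
      ⟨hsub c ((hmem c).1 (List.mem_cons_of_mem _ hc)),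
        fun hw => hBm _ hw (List.mem_cons_of_mem _ hc)⟩⟩⟩
    ⟨x, Finset.mem_filter.2 ⟨hxs, hQx⟩⟩
  obtain ⟨hya, hy⟩ := Finset.mem_erase.1 hy
  obtain ⟨hys, hyB⟩ := Finset.mem_sdiff.1 hy
  obtain ⟨p, hpn, hpc, hp⟩ := (Finset.mem_filter.1 hz).2
  have hchain : (a' :: ((p ++ [z]) ++ [y])).IsChain G.Adj := by
    rw [List.append_assoc, List.singleton_append, isChain_append_singleton]
    exact ⟨hpc, by simpa using hyz.symm⟩
  have hym : y ∈ m' := by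
    by_contra hym
    apply hyB
    refine Finset.mem_filter.2 ⟨hys, p ++ [z], ?_, hchain, ?_⟩
    · rw [List.nodup_append]
      refine ⟨hpn, by simp, ?_⟩
      rintro w hw w' hw' rfl
      rw [List.mem_singleton.1 hw'] at hw
      -- a vertex on an outer path is itself reached by an outer path
      apply hyB
      obtain ⟨q₁, q₂, hq⟩ := List.append_of_mem hw
      refine Finset.mem_filter.2 ⟨hys, q₁, ?_, ?_, ?_⟩
      · rw [hq] at hpn
        refine hpn.sublist ?_
        rw [List.sublist_append_iff]
        exact ⟨q₁, [y], rfl, List.Sublist.refl _, by simp⟩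
      · rw [hq, isChain_append_singleton] at hpc
        exact hpc.1
      · intro w' hw'
        apply hp
        rw [hq]
        simp only [List.mem_append, List.mem_cons] at hw' ⊢
        tauto
    · intro w hw
      rcases List.mem_append.1 hw with hw | hw
      · exact hp w hw
      · rw [List.mem_singleton.1 hw]
        exact ⟨hys, by simp [hya, hym]⟩
  obtain ⟨a'', m'', h'', hlt, hsub''⟩ := h'.exists_longer hG hym hchain hpn (by simp)
    fun w hw => (hp w hw).2
  refine ⟨a'', m'', h'', hlen ▸ hlt, fun w hw => ?_⟩
  rcases hsub'' w hw with hw | hw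
  · exact hsub w ((hmem w).1 hw)
  · exact (hp w hw).1

/-- A graph without cut vertices and without the forbidden configurations is spanned by a cycle,
which orders its vertices. In general orders are glued at cut vertices. -/
lemma exists_nonCrossing (hG : NoObstruction G) (s : Finset V) :
    ∃ l : List V, l.Nodup ∧ (∀ x, x ∈ l ↔ x ∈ s) ∧ NonCrossing G l := by
  classical
  induction hk : s.card using Nat.strong_induction_on generalizing s with
  | _ k ih =>
  subst hk
  by_cases hs : ∀ A B C : Finset V, A ∪ B ∪ C = s → Disjoint A B → Disjoint A C → Disjoint B C →
      C.card ≤ 1 → A.Nonempty → B.Nonempty → ∃ a ∈ A, ∃ b ∈ B, G.Adj a b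
  · rcases Nat.lt_or_ge s.card 2 with hcard | hcard
    · refine ⟨s.toList, s.nodup_toList, fun x => Finset.mem_toList, fun a b c d h => ?_⟩
      have := h.length_le
      simp only [Finset.length_toList, List.length_cons, List.length_nil] at this
      omega
    -- a longest cycle spans the graph
    · let P : ℕ → Prop := fun k => ∃ a m, IsCyc G a m ∧ m.length = k ∧ ∀ w ∈ a :: m, w ∈ s
      have hbd : ∀ k, P k → k ≤ s.card := by
        rintro _ ⟨a, m, h, rfl, hsub⟩
        have h1 : (a :: m).toFinset ⊆ s := fun w hw => hsub w (List.mem_toFinset.1 hw)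
        have h2 := Finset.card_le_card h1
        rw [List.toFinset_card_of_nodup h.nodup, List.length_cons] at h2
        omega
      obtain ⟨k₀, hk₀⟩ : ∃ k, P k := by
        obtain ⟨a₀, ha₀⟩ : s.Nonempty := Finset.card_pos.1 (by omega)
        obtain ⟨a, ha, b, hb, hab⟩ := hs {a₀} (s.erase a₀) ∅ (by
            rw [Finset.union_empty, ← Finset.insert_eq, Finset.insert_erase ha₀])
          (by simp) (by simp) (by simp) (by simp) (by simp)
          (Finset.card_pos.1 (by rw [Finset.card_erase_of_mem ha₀]; omega))
        rw [Finset.mem_singleton] at ha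
        subst ha
        refine ⟨_, a, [b], ⟨by simpa using ⟨hab, hab.symm⟩, by simpa using hab.ne, by simp⟩, rfl, ?_⟩
        intro w hw
        simp only [List.mem_cons, List.not_mem_nil, or_false] at hw
        rcases hw with rfl | rfl
        · exact ha₀
        · exact Finset.mem_of_mem_erase hb
      have hmax := Nat.findGreatest_spec (hbd k₀ hk₀) hk₀
      set K := Nat.findGreatest P s.card with hK
      obtain ⟨a, m, h, hmK, hsub⟩ := hmax
      refine ⟨a :: m, h.nodup, fun x => ⟨hsub x, fun hx => ?_⟩, h.nonCrossing hG⟩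
      by_contra hxm
      obtain ⟨a', m', h', hlt, hsub'⟩ := h.exists_longer_of_notMem hG hs hsub ⟨x, hx, hxm⟩
      have hP : P m'.length := ⟨a', m', h', rfl, hsub'⟩
      have := Nat.le_findGreatest (hbd _ hP) hP
      omega
  · push Not at hs
    obtain ⟨A, B, C, hun, hAB, hAC, hBC, hC, hA, hB, hadj⟩ := hs
    have hcard : A.card + B.card + C.card = s.card := by
      rw [← hun, Finset.card_union_of_disjoint (Finset.disjoint_union_left.2 ⟨hAC, hBC⟩),
        Finset.card_union_of_disjoint hAB]
    have hA' := hA.card_pos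
    have hB' := hB.card_pos
    obtain ⟨l₁, hn₁, hm₁, hl₁⟩ := ih (A ∪ C).card (by
      rw [Finset.card_union_of_disjoint hAC]; omega) (A ∪ C) rfl
    obtain ⟨l₂, hn₂, hm₂, hl₂⟩ := ih (B ∪ C).card (by
      rw [Finset.card_union_of_disjoint hBC]; omega) (B ∪ C) rfl
    simp only [Finset.mem_union] at hm₁ hm₂
    rcases C.eq_empty_or_nonempty with rfl | ⟨v, hv⟩
    · simp only [Finset.notMem_empty, or_false] at hm₁ hm₂
      refine ⟨l₁ ++ l₂, ?_, ?_, hl₁.append hl₂ ?_⟩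
      · rw [List.nodup_append]
        refine ⟨hn₁, hn₂, ?_⟩
        rintro w hw w' hw' rfl
        exact Finset.disjoint_left.1 hAB ((hm₁ w).1 hw) ((hm₂ w).1 hw')
      · intro x
        rw [List.mem_append, hm₁, hm₂, ← hun]; simp
      · exact fun a ha b hb => hadj a ((hm₁ a).1 ha) b ((hm₂ b).1 hb)
    · obtain rfl : C = {v} := (Finset.eq_of_subset_of_card_le (Finset.singleton_subset_iff.2 hv)
        (by simpa using hC)).symm
      have rot : ∀ (X : Finset V) (l : List V), l.Nodup → (∀ x, x ∈ l ↔ x ∈ X ∨ x ∈ ({v} : Finset V)) →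
          NonCrossing G l → v ∉ X →
          ∃ l', (v :: l').Nodup ∧ (∀ x, x ∈ l' ↔ x ∈ X) ∧ NonCrossing G (v :: l') := by
        intro X l hn hm hl hvX
        obtain ⟨m₁, m₂, rfl⟩ := List.append_of_mem ((hm v).2 (by simp))
        have hperm : (v :: (m₂ ++ m₁)).Perm (m₁ ++ v :: m₂) := by
          rw [← List.cons_append]; exact List.perm_append_comm
        have hn' := hperm.nodup_iff.2 hn
        refine ⟨m₂ ++ m₁, hn', fun x => ?_, by simpa using hl.rotate⟩
        have h1 := hm x
        rw [← hperm.mem_iff, List.mem_cons, Finset.mem_singleton] at h1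
        constructor
        · intro hx
          refine (h1.1 (Or.inr hx)).resolve_right ?_
          rintro rfl
          exact (List.nodup_cons.1 hn').1 hx
        · intro hx
          refine (h1.2 (Or.inl hx)).resolve_left ?_
          rintro rfl
          exact hvX hx
      obtain ⟨k₁, hk₁, hkm₁, hkl₁⟩ := rot A l₁ hn₁ hm₁ hl₁ (Finset.disjoint_singleton_right.1 hAC)
      obtain ⟨k₂, hk₂, hkm₂, hkl₂⟩ := rot B l₂ hn₂ hm₂ hl₂ (Finset.disjoint_singleton_right.1 hBC)
      refine ⟨v :: (k₁ ++ k₂), ?_, ?_, hkl₁.cons_append hkl₂ ?_⟩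
      · rw [List.nodup_cons, List.nodup_append, List.mem_append]
        rw [List.nodup_cons] at hk₁ hk₂
        refine ⟨fun h => h.elim hk₁.1 hk₂.1, hk₁.2, hk₂.2, ?_⟩
        rintro w hw w' hw' rfl
        exact Finset.disjoint_left.1 hAB ((hkm₁ w).1 hw) ((hkm₂ w).1 hw')
      · intro x
        rw [List.mem_cons, List.mem_append, hkm₁, hkm₂, ← hun]
        simp only [Finset.mem_union, Finset.mem_singleton]
        tauto
      · exact fun a ha b hb => hadj a ((hkm₁ a).1 ha) b ((hkm₂ b).1 hb)

lemma SimpleGraph.IsOuterplanar.exists_nonCrossing [Fintype V] (hG : G.IsOuterplanar) :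
    ∃ l : List V, l.Nodup ∧ (∀ x, x ∈ l) ∧ NonCrossing G l := by
  obtain ⟨D, hD⟩ := hG
  obtain ⟨l, hn, hm, hl⟩ := _root_.exists_nonCrossing (G := G)
    ⟨fun _ _ _ _ _ => PlaneEmbedding.false_of_three_paths hD,
      fun _ _ _ _ _ _ _ _ => PlaneEmbedding.false_of_crossing_chords hD⟩ Finset.univ
  exact ⟨l, hn, fun x => (hm x).2 (Finset.mem_univ x), hl⟩

end NonCrossing

/-! ### Drawing a noncrossing order on a parabola -/

/-- The point of the parabola `im z = (re z) ^ 2` with real part `n`. -/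
def parabolaPoint (n : ℕ) : ℂ := ⟨n, (n : ℝ) ^ 2⟩

lemma mem_segment_parabolaPoint {m n : ℕ} (h : m < n) {z : ℂ} :
    z ∈ segment ℝ (parabolaPoint m) (parabolaPoint n) ↔
      (m : ℝ) ≤ z.re ∧ z.re ≤ n ∧ z.im = (m + n) * z.re - m * n := by
  have hmn : (m : ℝ) < n := Nat.cast_lt.2 h
  constructor
  · rintro ⟨a, b, ha, hb, hab, rfl⟩
    obtain rfl : a = 1 - b := by linarith
    simp only [parabolaPoint, Complex.add_re, Complex.real_smul, Complex.mul_re, Complex.ofReal_re,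
      Complex.ofReal_im, Complex.add_im, Complex.mul_im]
    refine ⟨?_, ?_, ?_⟩
    · nlinarith
    · nlinarith
    · ring
  · rintro ⟨h1, h2, h3⟩
    have h0 : (n : ℝ) - m ≠ 0 := by linarith
    refine ⟨(n - z.re) / (n - m), (z.re - m) / (n - m), div_nonneg (by linarith) (by linarith),
      div_nonneg (by linarith) (by linarith), by field_simp; ring, ?_⟩
    apply Complex.ext
    · simp only [parabolaPoint, Complex.add_re, Complex.real_smul, Complex.mul_re,
        Complex.ofReal_re, Complex.ofReal_im]
      field_simp
      ring
    · simp only [parabolaPoint, Complex.real_smul, Complex.ofReal_re,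
        Complex.ofReal_im, Complex.add_im, Complex.mul_im, h3]
      field_simp
      ring

/-- Two different chords of the parabola whose end points do not alternate meet only in common end
points. -/
lemma chords_meet {x₁ y₁ x₂ y₂ r : ℝ} (h₁ : x₁ ≤ r) (h₁' : r ≤ y₁) (h₂ : x₂ ≤ r) (h₂' : r ≤ y₂)
    (h : (x₁ + y₁) * r - x₁ * y₁ = (x₂ + y₂) * r - x₂ * y₂)
    (hne : ¬ (x₁ = x₂ ∧ y₁ = y₂)) (hc : ¬ (x₁ < x₂ ∧ x₂ < y₁ ∧ y₁ < y₂))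
    (hc' : ¬ (x₂ < x₁ ∧ x₁ < y₂ ∧ y₂ < y₁)) :
    (r = x₁ ∨ r = y₁) ∧ (r = x₂ ∨ r = y₂) := by
  have e : (r - x₁) * (y₁ - r) = (r - x₂) * (y₂ - r) := by nlinarith
  have main : ∀ x₁ y₁ x₂ y₂ : ℝ, x₁ ≤ r → r ≤ y₁ → x₂ ≤ r → r ≤ y₂ →
      (r - x₁) * (y₁ - r) = (r - x₂) * (y₂ - r) → ¬ (x₁ = x₂ ∧ y₁ = y₂) →
      ¬ (x₁ < x₂ ∧ x₂ < y₁ ∧ y₁ < y₂) → x₁ ≤ x₂ →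
      (r = x₁ ∨ r = y₁) ∧ (r = x₂ ∨ r = y₂) := by
    intro x₁ y₁ x₂ y₂ h₁ h₁' h₂ h₂' e hne hc hle
    rcases hle.lt_or_eq with hlt | rfl
    · rcases le_or_gt y₁ x₂ with h3 | h3
      · exact ⟨Or.inr (by linarith), Or.inl (by linarith)⟩
      · have h4 : y₂ ≤ y₁ := by by_contra! h4; exact hc ⟨hlt, h3, h4⟩
        rcases h4.lt_or_eq with h5 | rfl
        · exfalso
          have h6 : (r - x₂) * (y₂ - r) ≤ (r - x₂) * (y₁ - r) := by
            apply mul_le_mul_of_nonneg_left <;> linarith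
          have h7 : (r - x₂) * (y₁ - r) < (r - x₁) * (y₁ - r) := by
            apply mul_lt_mul_of_pos_right <;> linarith
          linarith
        · have h6 : (x₂ - x₁) * (y₂ - r) = 0 := by linarith
          have h7 := (mul_eq_zero.1 h6).resolve_left (by linarith)
          exact ⟨Or.inr (by linarith), Or.inr (by linarith)⟩
    · have h6 : (r - x₁) * (y₁ - y₂) = 0 := by linarith
      have h7 := (mul_eq_zero.1 h6).resolve_right fun h => hne ⟨rfl, by linarith⟩
      exact ⟨Or.inl (by linarith), Or.inl (by linarith)⟩
  rcases le_total x₁ x₂ with hle | hle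
  · exact main _ _ _ _ h₁ h₁' h₂ h₂' e hne hc hle
  · exact (main _ _ _ _ h₂ h₂' h₁ h₁' e.symm (fun h => hne ⟨h.1.symm, h.2.symm⟩) hc' hle).symm

lemma isSimpleArc_segment {p q : ℂ} (h : p ≠ q) : IsSimpleArc (segment ℝ p q) p q := by
  refine isSimpleArc_iff.2 ⟨AffineMap.lineMap p q, AffineMap.lineMap_continuous, ?_, by simp,
    by simp, (segment_eq_image_lineMap ℝ p q).symm⟩
  exact (AffineMap.lineMap_injective ℝ h).injOn

lemma isPreconnected_below_parabola : IsPreconnected {z : ℂ | z.im < z.re ^ 2} := by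
  have : {z : ℂ | z.im < z.re ^ 2} =
      (fun x : ℝ × ℝ => (⟨x.1, x.1 ^ 2 - x.2⟩ : ℂ)) '' (univ ×ˢ Ioi 0) := by
    ext z
    constructor
    · intro hz
      refine ⟨(z.re, z.re ^ 2 - z.im), ⟨mem_univ _, show 0 < z.re ^ 2 - z.im from sub_pos.2 hz⟩, ?_⟩
      apply Complex.ext <;> simp
    · rintro ⟨⟨r, t⟩, ⟨-, ht⟩, rfl⟩
      have ht' : 0 < t := ht
      simpa using ht'
  rw [this]
  refine (isPreconnected_univ.prod isPreconnected_Ioi).image _ (Continuous.continuousOn ?_)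
  have : (fun x : ℝ × ℝ => (⟨x.1, x.1 ^ 2 - x.2⟩ : ℂ)) =
      fun x => (x.1 : ℂ) + ((x.1 ^ 2 - x.2 : ℝ) : ℂ) * Complex.I := by
    ext x; exact Complex.mk_eq_add_mul_I _ _
  rw [this]
  fun_prop

/-- A graph is outerplanar if its vertices can be numbered such that no two edges cross. -/
lemma isOuterplanar_of_noncrossing {V : Type*} {G : SimpleGraph V} (f : V → ℕ)
    (hf : Function.Injective f)
    (hcross : ∀ a b c d, f a < f b → f b < f c → f c < f d → ¬ (G.Adj a c ∧ G.Adj b d)) :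
    G.IsOuterplanar := by
  have hpinj : Function.Injective fun v => parabolaPoint (f v) := by
    intro u v huv
    have := congrArg Complex.re huv
    exact hf (Nat.cast_injective (R := ℝ) this)
  let A : Sym2 V → Set ℂ := fun e =>
    {z | ∃ u v, e = s(u, v) ∧ z ∈ segment ℝ (parabolaPoint (f u)) (parabolaPoint (f v))}
  have hA : ∀ u v, A s(u, v) = segment ℝ (parabolaPoint (f u)) (parabolaPoint (f v)) := by
    intro u v
    ext z
    constructor
    · rintro ⟨u', v', h, hz⟩
      rcases Sym2.eq_iff.1 h with ⟨rfl, rfl⟩ | ⟨rfl, rfl⟩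
      · exact hz
      · rw [segment_symm]; exact hz
    · exact fun hz => ⟨u, v, rfl, hz⟩
  -- every edge can be written with its end points in increasing order
  have hE : ∀ e ∈ G.edgeSet, ∃ u v, e = s(u, v) ∧ G.Adj u v ∧ f u < f v ∧ ∀ z, z ∈ A e ↔
      (f u : ℝ) ≤ z.re ∧ z.re ≤ f v ∧ z.im = (f u + f v) * z.re - f u * f v := by
    intro e he
    induction e with
    | _ u v =>
    have huv : G.Adj u v := he
    rcases lt_or_gt_of_ne (fun h => huv.ne (hf h)) with h | h
    · exact ⟨u, v, rfl, huv, h, fun z => by rw [hA]; exact mem_segment_parabolaPoint h⟩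
    · exact ⟨v, u, Sym2.eq_swap, huv.symm, h, fun z => by
        rw [Sym2.eq_swap, hA]; exact mem_segment_parabolaPoint h⟩
  have hend : ∀ (z : ℂ) (x y : ℝ) (n : ℕ), z.im = (x + y) * z.re - x * y → (n : ℝ) = x ∨ (n : ℝ) = y →
      z.re = n → parabolaPoint n = z := by
    intro z x y n him hn hre
    apply Complex.ext
    · exact hre.symm
    · rw [him, hre]
      simp only [parabolaPoint]
      rcases hn with rfl | rfl <;> ring
  let D : PlaneEmbedding G :=
    { point := fun v => parabolaPoint (f v)
      arc := A
      point_injective := hpinj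
      isSimpleArc := by
        intro u v huv
        rw [hA]
        exact isSimpleArc_segment fun h => huv.ne (hpinj h)
      vertex_of_mem_arc := by
        intro e he w hw
        obtain ⟨u, v, rfl, huv, hlt, hmem⟩ := hE e he
        obtain ⟨-, -, h3⟩ := (hmem _).1 hw
        simp only [parabolaPoint] at h3
        have h4 : ((f w : ℝ) - f u) * (f w - f v) = 0 := by linarith
        rcases mul_eq_zero.1 h4 with h | h
        · rw [hf (Nat.cast_injective (sub_eq_zero.1 h))]; simp
        · rw [hf (Nat.cast_injective (sub_eq_zero.1 h))]; simp
      crossing_free := by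
        rintro e he e' he' hne z ⟨hz, hz'⟩
        obtain ⟨u, v, rfl, huv, hlt, hmem⟩ := hE e he
        obtain ⟨u', v', rfl, huv', hlt', hmem'⟩ := hE e' he'
        obtain ⟨h1, h2, h3⟩ := (hmem z).1 hz
        obtain ⟨h1', h2', h3'⟩ := (hmem' z).1 hz'
        obtain ⟨hA1, hA2⟩ := chords_meet h1 h2 h1' h2' (h3.symm.trans h3')
          (by
            rintro ⟨ha, hb⟩
            rw [hf (Nat.cast_injective ha), hf (Nat.cast_injective hb)] at hne
            exact hne rfl)
          (by
            rintro ⟨ha, hb, hc⟩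
            exact hcross u u' v v' (Nat.cast_lt.1 ha) (Nat.cast_lt.1 hb) (Nat.cast_lt.1 hc)
              ⟨huv, huv'⟩)
          (by
            rintro ⟨ha, hb, hc⟩
            exact hcross u' u v' v (Nat.cast_lt.1 ha) (Nat.cast_lt.1 hb) (Nat.cast_lt.1 hc)
              ⟨huv', huv⟩)
        obtain ⟨w, hw, hwz⟩ : ∃ w ∈ s(u, v), z.re = f w := by
          rcases hA1 with h | h
          · exact ⟨u, by simp, h⟩
          · exact ⟨v, by simp, h⟩
        obtain ⟨w', hw', hwz'⟩ : ∃ w ∈ s(u', v'), z.re = f w := by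
          rcases hA2 with h | h
          · exact ⟨u', by simp, h⟩
          · exact ⟨v', by simp, h⟩
        obtain rfl : w = w' := hf (Nat.cast_injective (R := ℝ) (hwz.symm.trans hwz'))
        refine ⟨w, hw, hw', hend z _ _ _ h3 ?_ hwz⟩
        rcases Sym2.mem_iff.1 hw with rfl | rfl
        · exact Or.inl rfl
        · exact Or.inr rfl }
  have hsupp : ∀ z ∈ D.support, z.re ^ 2 ≤ z.im := by
    rintro z (⟨v, rfl⟩ | hz)
    · exact le_rfl
    · obtain ⟨e, he, hz⟩ := mem_iUnion₂.1 hz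
      obtain ⟨u, v, rfl, huv, hlt, hmem⟩ := hE e he
      obtain ⟨h1, h2, h3⟩ := (hmem z).1 hz
      rw [h3]
      nlinarith [mul_nonneg (sub_nonneg.2 h1) (sub_nonneg.2 h2)]
  have hW : {z : ℂ | z.im < z.re ^ 2} ⊆ D.outerFace := by
    have hdisj : {z : ℂ | z.im < z.re ^ 2} ⊆ D.supportᶜ := fun z hz hz' =>
      not_lt.2 (hsupp z hz') hz
    intro z hz
    refine ⟨hdisj hz, fun hb => ?_⟩
    obtain ⟨R, hR0, hR⟩ := (hb.subset
      (isPreconnected_below_parabola.subset_connectedComponentIn hz hdisj)).exists_pos_norm_le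
    have h1 := hR ⟨0, -(R + 1)⟩ (by simp; linarith)
    have h2 := Complex.abs_im_le_norm ⟨0, -(R + 1)⟩
    simp only [abs_neg] at h2
    rw [abs_of_pos (by linarith)] at h2
    linarith
  refine ⟨D, fun v => ⟨closure_mono hW ?_, fun hint => ?_⟩⟩
  · rw [Metric.mem_closure_iff]
    intro ε hε
    refine ⟨⟨f v, (f v : ℝ) ^ 2 - ε / 2⟩, by simpa using hε, ?_⟩
    have : D.point v - ⟨f v, (f v : ℝ) ^ 2 - ε / 2⟩ = ((ε / 2 : ℝ) : ℂ) * Complex.I := by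
      apply Complex.ext <;> simp [D, parabolaPoint]
    rw [dist_eq_norm, this, norm_mul, Complex.norm_I, mul_one, Complex.norm_real, Real.norm_eq_abs,
      abs_of_pos (half_pos hε)]
    exact half_lt_self hε
  · exact (interior_subset hint).1 (Or.inl ⟨v, rfl⟩)

/-! ### Triangulated polygons -/

/-- The graph `G` is a triangulated polygon with `n` corners. The corners are numbered cyclically by
integers; `noncrossing` and `maximal` say that `G` is a maximal set of pairwise noncrossing sides
and diagonals. -/
structure IsTriangulation {V : Type*} (G : SimpleGraph V) (n : ℕ) (e : ℤ → V) : Prop where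
  eq_iff : ∀ i j : ℤ, e i = e j ↔ (n : ℤ) ∣ j - i
  surjective : Function.Surjective e
  noncrossing : ∀ i j k l : ℤ, i < j → j < k → k < l → l < i + n →
    ¬ (G.Adj (e i) (e k) ∧ G.Adj (e j) (e l))
  maximal : ∀ i j : ℤ, i < j → j < i + n → ¬ G.Adj (e i) (e j) →
    ∃ k l : ℤ, i < k ∧ k < j ∧ j < l ∧ l < i + n ∧ G.Adj (e k) (e l)

/-- The corners are the vertices in a noncrossing order. The order is maximal because any noncrossing
order yields an outerplanar drawing. -/
lemma SimpleGraph.IsMaximalOuterplanar.exists_isTriangulation {V : Type*} [Fintype V]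
    {G : SimpleGraph V} (hG : G.IsMaximalOuterplanar) (hn : 0 < Fintype.card V) :
    ∃ e, IsTriangulation G (Fintype.card V) e := by
  classical
  obtain ⟨l, hl, hmem, hnc⟩ := hG.1.exists_nonCrossing
  have hlen : l.length = Fintype.card V := by
    rw [← List.toFinset_card_of_nodup hl, ← Finset.card_univ]
    congr 1
    ext x; simp [hmem]
  set n := Fintype.card V with hndef
  have hn' : (0 : ℤ) < n := by exact_mod_cast hn
  have hlt : ∀ i : ℤ, (i % n).toNat < l.length := by
    intro i
    have h1 := Int.emod_nonneg i hn'.ne'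
    have h2 := Int.emod_lt_of_pos i hn'
    omega
  let e : ℤ → V := fun i => l[(i % n).toNat]'(hlt i)
  let f : V → ℕ := fun v => l.idxOf v
  have hfe : ∀ i, (f (e i) : ℤ) = i % n := by
    intro i
    have h1 := Int.emod_nonneg i hn'.ne'
    have : f (e i) = (i % n).toNat := hl.idxOf_getElem _ _
    omega
  have hfn : ∀ v, (f v : ℤ) < n := by
    intro v
    have : f v < l.length := List.idxOf_lt_length_of_mem (hmem v)
    omega
  have hef : ∀ v, e (f v) = v := by
    intro v
    have h1 : (f v : ℤ) % n = f v := Int.emod_eq_of_lt (by omega) (hfn v)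
    have h2 : ((f v : ℤ) % n).toNat = l.idxOf v := by rw [h1]; exact Int.toNat_natCast _
    simp only [e, h2]
    exact List.getElem_idxOf _
  have hfinj : Function.Injective f := by
    intro u v huv
    rw [← hef u, ← hef v, huv]
  have heq : ∀ i j, e i = e j ↔ (n : ℤ) ∣ j - i := by
    intro i j
    rw [← Int.modEq_iff_dvd]
    constructor
    · intro h
      have h1 := hfe i
      rw [h, hfe j] at h1
      exact h1.symm
    · intro h
      have h1 : i % n = j % n := h
      simp only [e, h1]
  have hcross : ∀ a b c d, f a < f b → f b < f c → f c < f d → ¬ (G.Adj a c ∧ G.Adj b d) := by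
    intro a b c d hab hbc hcd
    have hd : f d < l.length := List.idxOf_lt_length_of_mem (hmem d)
    have := List.map_getElem_sublist (l := l) (is := [⟨f a, by omega⟩, ⟨f b, by omega⟩,
      ⟨f c, by omega⟩, ⟨f d, hd⟩]) (by simp; omega)
    simp only [List.map_cons, List.map_nil, Fin.getElem_fin] at this
    have hg : ∀ v (h : f v < l.length), l[f v] = v := fun v h => List.getElem_idxOf _
    rw [hg, hg, hg, hg] at this
    exact hnc a b c d this
  -- indices may be shifted by multiples of `n`
  have hper : ∀ i q : ℤ, e (i - n * q) = e i := fun i q => (heq _ _).2 ⟨q, by ring⟩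
  -- in a window of length `n` that starts in `[0, n)`, an index is either the position of its vertex
  -- or, after one turn, this position plus `n`
  have hidx : ∀ v (i i₀ : ℤ), e i = v → i₀ ≤ i → i < i₀ + n → 0 ≤ i₀ → i₀ < n →
      i = f v ∨ i = f v + n := by
    rintro v i i₀ rfl h1 h2 h3 h4
    have h5 := hfe i
    rcases lt_or_ge i n with h | h
    · rw [Int.emod_eq_of_lt (by omega) h] at h5; omega
    · rw [← Int.sub_emod_right, Int.emod_eq_of_lt (by omega) (by omega)] at h5
      omega
  refine ⟨e, heq, fun v => ⟨f v, hef v⟩, ?_, ?_⟩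
  · intro i j k m hij hjk hkm hmi
    have hi0 := Int.emod_nonneg i hn'.ne'
    have hin := Int.emod_lt_of_pos i hn'
    have hiq := Int.emod_add_mul_ediv i n
    rw [← hper i (i / n), ← hper j (i / n), ← hper k (i / n), ← hper m (i / n)]
    set q := (n : ℤ) * (i / n) with hq
    have h1 := hidx _ (i - q) (i - q) rfl (by omega) (by omega) (by omega) (by omega)
    have h2 := hidx _ (j - q) (i - q) rfl (by omega) (by omega) (by omega) (by omega)
    have h3 := hidx _ (k - q) (i - q) rfl (by omega) (by omega) (by omega) (by omega)
    have h4 := hidx _ (m - q) (i - q) rfl (by omega) (by omega) (by omega) (by omega)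
    have g1 := hfn (e (i - q))
    have g2 := hfn (e (j - q))
    have g3 := hfn (e (k - q))
    have g4 := hfn (e (m - q))
    rintro ⟨hik, hjm⟩
    rcases h1 with h1 | h1
    · rcases h4 with h4 | h4
      · exact hcross _ _ _ _ (by omega) (by omega) (by omega) ⟨hik, hjm⟩
      rcases h3 with h3 | h3
      · exact hcross _ _ _ _ (by omega) (by omega) (by omega) ⟨hjm.symm, hik⟩
      rcases h2 with h2 | h2
      · exact hcross _ _ _ _ (by omega) (by omega) (by omega) ⟨hik.symm, hjm.symm⟩
      · exact hcross _ _ _ _ (by omega) (by omega) (by omega) ⟨hjm, hik.symm⟩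
    · omega
  · intro i j hij hji hadj
    have hi0 := Int.emod_nonneg i hn'.ne'
    have hin := Int.emod_lt_of_pos i hn'
    have hiq := Int.emod_add_mul_ediv i n
    have hne : e i ≠ e j := by
      intro h
      obtain ⟨q, hq⟩ := (heq i j).1 h
      have h1 : 0 < q := by by_contra! hq0; nlinarith
      have h2 : q < 1 := by by_contra! hq0; nlinarith
      omega
    -- the new edge must cross an old one, as otherwise it could be drawn
    have hnot : ¬ ∀ a b c d, f a < f b → f b < f c → f c < f d →
        ¬ ((G ⊔ SimpleGraph.edge (e i) (e j)).Adj a c ∧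
          (G ⊔ SimpleGraph.edge (e i) (e j)).Adj b d) := fun h =>
      hG.2 _ _ hne hadj (isOuterplanar_of_noncrossing f hfinj h)
    push Not at hnot
    obtain ⟨a, b, c, d, hab, hbc, hcd, hac, hbd⟩ := hnot
    have gd := hfn d
    rw [← hper i (i / n)] at hac hbd
    rw [← hper j (i / n)] at hac hbd
    set q := (n : ℤ) * (i / n) with hq
    have h1 := fun v h => hidx v (i - q) (i - q) h (by omega) (by omega) (by omega) (by omega)
    have h2 := fun v h => hidx v (j - q) (i - q) h (by omega) (by omega) (by omega) (by omega)
    have back : ∀ (v : V) (ε : ℤ), e (f v + n * ε + q) = v := fun v ε => by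
      conv_rhs => rw [← hef v]
      rw [heq]; exact ⟨-(ε + i / n), by rw [hq]; ring⟩
    have back0 : ∀ v : V, e (f v + q) = v := fun v => by simpa using back v 0
    have back1 : ∀ v : V, e (f v + n + q) = v := fun v => by simpa using back v 1
    simp only [SimpleGraph.sup_adj, SimpleGraph.edge_adj] at hac hbd
    rcases hac with hac | ⟨hac, -⟩
    · rcases hbd with hbd | ⟨hbd, -⟩
      · exact absurd ⟨hac, hbd⟩ (hcross a b c d hab hbc hcd)
      · rcases hbd with ⟨hb, hd⟩ | ⟨hb, hd⟩
        · rcases h1 b hb.symm with h1 | h1 <;> rcases h2 d hd.symm with h2 | h2 <;> try omega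
          exact ⟨f c + q, f a + n + q, by omega, by omega, by omega, by omega, by
            rw [back0, back1]; exact hac.symm⟩
        · rcases h1 d hd.symm with h1 | h1 <;> rcases h2 b hb.symm with h2 | h2 <;> try omega
          exact ⟨f a + n + q, f c + n + q, by omega, by omega, by omega, by omega, by
            rw [back1, back1]; exact hac⟩
    · rcases hbd with hbd | ⟨hbd, -⟩
      · rcases hac with ⟨ha, hc⟩ | ⟨ha, hc⟩
        · rcases h1 a ha.symm with h1 | h1 <;> rcases h2 c hc.symm with h2 | h2 <;> try omega
          exact ⟨f b + q, f d + q, by omega, by omega, by omega, by omega, by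
            rw [back0, back0]; exact hbd⟩
        · rcases h1 c hc.symm with h1 | h1 <;> rcases h2 a ha.symm with h2 | h2 <;> try omega
          exact ⟨f d + q, f b + n + q, by omega, by omega, by omega, by omega, by
            rw [back0, back1]; exact hbd.symm⟩
      · exfalso
        rcases hac with ⟨ha, hc⟩ | ⟨ha, hc⟩ <;> rcases hbd with ⟨hb, hd⟩ | ⟨hb, hd⟩ <;>
          rw [ha, hb] at hab <;> rw [hb, hc] at hbc <;> omega

namespace IsTriangulation

variable {V : Type*} {G : SimpleGraph V} {n : ℕ} {e : ℤ → V}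

lemma apply_add_period (h : IsTriangulation G n e) (i : ℤ) : e (i + n) = e i :=
  (h.eq_iff _ _).2 ⟨-1, by ring⟩

lemma ne_of_lt (h : IsTriangulation G n e) {i j : ℤ} (hij : i < j) (hj : j < i + n) :
    e i ≠ e j := by
  intro heq
  obtain ⟨q, hq⟩ := (h.eq_iff i j).1 heq
  have h1 : 0 < q := by by_contra! h0; nlinarith
  have h2 : q < 1 := by by_contra! h0; nlinarith
  omega

/-- Every vertex has an index in any given window of `n` consecutive integers. -/
lemma exists_index (h : IsTriangulation G n e) (hn : 0 < n) (i : ℤ) (v : V) :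
    ∃ k, i ≤ k ∧ k < i + n ∧ e k = v := by
  obtain ⟨m, rfl⟩ := h.surjective v
  have hn' : (0 : ℤ) < n := by exact_mod_cast hn
  refine ⟨i + (m - i) % n, ?_, ?_, (h.eq_iff _ _).2 ⟨(m - i) / n, ?_⟩⟩
  · have := Int.emod_nonneg (m - i) hn'.ne'; omega
  · have := Int.emod_lt_of_pos (m - i) hn'; omega
  · have := Int.emod_add_mul_ediv (m - i) n; linarith

lemma adj_succ (h : IsTriangulation G n e) (hn : 2 ≤ n) (i : ℤ) : G.Adj (e i) (e (i + 1)) := by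
  by_contra hadj
  obtain ⟨k, l, h1, h2, -⟩ := h.maximal i (i + 1) (by omega) (by omega) hadj
  omega

/-- Each side or diagonal `e i`, `e j` is the base of a triangle whose third corner lies between
`i` and `j`: the last neighbour of `e i` before `e j` is adjacent to `e j`. -/
lemma exists_apex (h : IsTriangulation G n e) {i j : ℤ} (hij : i + 2 ≤ j) (hj : j < i + n)
    (hadj : G.Adj (e i) (e j)) :
    ∃ k, i < k ∧ k < j ∧ G.Adj (e i) (e k) ∧ G.Adj (e k) (e j) := by
  obtain ⟨k, ⟨hik, hkj, hk⟩, hmax⟩ := Int.exists_greatest_of_bdd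
    (P := fun k => i < k ∧ k < j ∧ G.Adj (e i) (e k)) ⟨j, fun z hz => hz.2.1.le⟩
    ⟨i + 1, by omega, by omega, h.adj_succ (by omega) i⟩
  refine ⟨k, hik, hkj, hk, ?_⟩
  by_contra hno
  obtain ⟨a, b, hka, haj, hjb, hbk, hab⟩ := h.maximal k j hkj (by omega) hno
  rcases lt_trichotomy b (i + n) with hb | rfl | hb
  · exact h.noncrossing i a j b (by omega) haj hjb hb ⟨hadj, hab⟩
  · rw [h.apply_add_period] at hab
    have := hmax a ⟨by omega, haj, hab.symm⟩
    omega
  · have hper := h.apply_add_period (b - n)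
    rw [sub_add_cancel] at hper
    rw [hper] at hab
    exact h.noncrossing i (b - n) k a (by omega) (by omega) hka (by omega) ⟨hk, hab.symm⟩

/-- A shortest diagonal cuts off a single triangle. -/
lemma exists_ear (h : IsTriangulation G n e) (hn : 3 ≤ n) :
    ∃ i, G.Adj (e i) (e (i + 2)) := by
  have hex : ∃ d : ℕ, ∃ i : ℤ, 2 ≤ d ∧ d < n ∧ G.Adj (e i) (e (i + d)) := by
    refine ⟨n - 1, 1, by omega, by omega, ?_⟩
    have h1 : (1 : ℤ) + (n - 1 : ℕ) = 0 + n := by omega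
    rw [h1, h.apply_add_period]
    exact (h.adj_succ (by omega) 0).symm
  classical
  obtain ⟨i, hd, hdn, hi⟩ := Nat.find_spec hex
  have hmin := fun m => Nat.find_min hex (m := m)
  set d := Nat.find hex
  obtain ⟨k, hik, hkj, hk1, hk2⟩ := h.exists_apex (by omega) (by omega) hi
  have g1 : k - i < 2 := by
    by_contra! hlt
    refine hmin (k - i).toNat (by omega) ⟨i, by omega, by omega, ?_⟩
    rwa [show i + ((k - i).toNat : ℤ) = k by omega]
  have g2 : i + d - k < 2 := by
    by_contra! hlt
    refine hmin (i + d - k).toNat (by omega) ⟨k, by omega, by omega, ?_⟩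
    rwa [show k + ((i + d - k).toNat : ℤ) = i + d by omega]
  exact ⟨i, by rwa [show i + 2 = i + (d : ℤ) by omega]⟩

lemma eq_or_eq_of_ear (h : IsTriangulation G n e) {i : ℤ} (hn : 0 < n)
    (hi : G.Adj (e (i - 1)) (e (i + 1))) {w : V} (hw : G.Adj (e i) w) :
    w = e (i + 1) ∨ w = e (i - 1) := by
  obtain ⟨k, h1, h2, rfl⟩ := h.exists_index hn (i - 1) w
  rcases eq_or_ne k (i - 1) with rfl | g1
  · exact Or.inr rfl
  rcases eq_or_ne k i with rfl | g2
  · exact absurd rfl hw.ne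
  rcases eq_or_ne k (i + 1) with rfl | g3
  · exact Or.inl rfl
  exact absurd ⟨hi, hw⟩ (h.noncrossing (i - 1) i (i + 1) k (by omega) (by omega) (by omega) h2)

/-- A polygon cut off by a side or diagonal has a proper `3`-colouring with any two different
colours prescribed at the ends of that side or diagonal. -/
lemma exists_colouring_interval (h : IsTriangulation G n e) (d : ℕ) (hd : 1 ≤ d) (hdn : d < n)
    (i : ℤ) (hadj : G.Adj (e i) (e (i + d))) (x y : Fin 3) (hxy : x ≠ y) :
    ∃ c : ℤ → Fin 3, c i = x ∧ c (i + d) = y ∧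
      ∀ a b, i ≤ a → a < b → b ≤ i + d → G.Adj (e a) (e b) → c a ≠ c b := by
  induction d using Nat.strong_induction_on generalizing i x y with
  | _ d ih =>
    -- colour the two parts on both sides of the triangle over the base
    rcases Nat.lt_or_ge d 2 with h1 | h2
    · obtain rfl : d = 1 := by omega
      refine ⟨fun a => if a = i then x else y, by simp, by simp, ?_⟩
      intro a b ha hab hb _
      obtain rfl : a = i := by push_cast at hb; omega
      have : b ≠ a := by omega
      simpa [this] using hxy
    obtain ⟨k, hik, hkj, hk1, hk2⟩ := h.exists_apex (by omega) (by omega) hadj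
    obtain ⟨z, hzx, hzy⟩ : ∃ z : Fin 3, x ≠ z ∧ z ≠ y := by decide +revert
    have e1 : i + ((k - i).toNat : ℤ) = k := by omega
    have e2 : k + ((i + d - k).toNat : ℤ) = i + d := by omega
    obtain ⟨c₁, hc1i, hc1k, hc1⟩ := ih (k - i).toNat (by omega) (by omega) (by omega) i
      (by rwa [e1]) x z hzx
    obtain ⟨c₂, hc2k, hc2j, hc2⟩ := ih (i + d - k).toNat (by omega) (by omega) (by omega) k
      (by rwa [e2]) z y hzy
    rw [e1] at hc1k hc1
    rw [e2] at hc2j hc2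
    have hL : ∀ a, a ≤ k → (if a ≤ k then c₁ a else c₂ a) = c₁ a := fun a ha => if_pos ha
    have hR : ∀ a, k ≤ a → (if a ≤ k then c₁ a else c₂ a) = c₂ a := by
      intro a ha
      rcases ha.eq_or_lt with rfl | ha
      · rw [if_pos le_rfl, hc1k, hc2k]
      · exact if_neg (by omega)
    refine ⟨fun a => if a ≤ k then c₁ a else c₂ a, ?_, ?_, ?_⟩
    · exact (hL i hik.le).trans hc1i
    · exact (hR _ hkj.le).trans hc2j
    intro a b ha hab hb hadj'
    simp only
    rcases le_or_gt b k with hbk | hbk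
    · rw [hL a (by omega), hL b hbk]; exact hc1 a b ha hab hbk hadj'
    rcases le_or_gt k a with hka | hka
    · rw [hR a hka, hR b hbk.le]; exact hc2 a b hka hab hb hadj'
    rcases ha.eq_or_lt with rfl | ha
    · rcases hb.eq_or_lt with rfl | hb
      · rw [hL _ hka.le, hR _ hbk.le, hc1i, hc2j]; exact hxy
      · exact absurd ⟨hadj', hk2⟩ (h.noncrossing _ k b _ hka hbk hb (by omega))
    · exact absurd ⟨hk1, hadj'⟩ (h.noncrossing i a k b ha hka hbk (by omega))

lemma exists_colouring (h : IsTriangulation G n e) (hn : 2 ≤ n) :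
    ∃ c : V → Fin 3, ∀ u v, G.Adj u v → c u ≠ c v := by
  have e1 : (1 : ℤ) + (n - 1 : ℕ) = 0 + n := by omega
  obtain ⟨c, -, -, hc⟩ := h.exists_colouring_interval (n - 1) (by omega) (by omega) 1
    (by rw [e1, h.apply_add_period]; exact (h.adj_succ hn 0).symm) 0 1 (by decide)
  choose g hg1 hg2 hg3 using h.exists_index (n := n) (by omega) 1
  refine ⟨fun v => c (g v), fun u v huv => ?_⟩
  have huv' : G.Adj (e (g u)) (e (g v)) := by rwa [hg3, hg3]
  have a1 := hg2 u
  have a2 := hg2 v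
  rcases lt_trichotomy (g u) (g v) with hlt | heq | hlt
  · exact hc _ _ (hg1 u) hlt (by omega) huv'
  · rw [heq] at huv'; exact absurd rfl huv'.ne
  · exact (hc _ _ (hg1 v) hlt (by omega) huv'.symm).symm

/-- The rotation of the polygon by one step. -/
lemma exists_rotation (h : IsTriangulation G n e) :
    ∃ σ : Equiv.Perm V, ∀ i, σ (e i) = e (i + 1) ∧ σ.symm (e i) = e (i - 1) := by
  choose g hg using h.surjective
  have key : ∀ i m, e (g (e i) + m) = e (i + m) := fun i m => by
    have := hg (e i)
    rw [h.eq_iff] at this ⊢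
    rwa [show i + m - (g (e i) + m) = i - g (e i) by ring]
  have key' : ∀ i m, e (g (e i) - m) = e (i - m) := fun i m => key i (-m)
  refine ⟨⟨fun v => e (g v + 1), fun v => e (g v - 1), fun v => ?_, fun v => ?_⟩, fun i => ⟨?_, ?_⟩⟩
  · simp only [key', add_sub_cancel_right, hg]
  · simp only [key, sub_add_cancel, hg]
  · exact key i 1
  · exact key' i 1

end IsTriangulation

/-! ### Coloured polygons without coordinates -/

/-- The vertex `v` is the tip of a triangle formed by three consecutive corners. -/
def IsEar {V : Type*} (G : SimpleGraph V) (σ : Equiv.Perm V) (v : V) : Prop :=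
  G.Adj (σ.symm v) (σ v)

/-- The properties of a triangulated polygon with at least five corners, the rotation `σ` and the
proper `3`-colouring `c`, that the combinatorial part of the proof uses. The field `fan` describes
the neighbours of `t` that do not have the colour `j`, and `alternating` allows definitions by
recursion along the polygon: the condition on `v` makes the recursion start. -/
structure IsColouredPolygon {V : Type*} (G : SimpleGraph V) (σ : Equiv.Perm V) (c : V → Fin 3) :
    Prop where
  adj_succ : ∀ v, G.Adj v (σ v)
  two : ∀ v, σ (σ v) ≠ v
  three : ∀ v, σ (σ (σ v)) ≠ v
  four : ∀ v, σ (σ (σ (σ v))) ≠ v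
  colour : ∀ u v, G.Adj u v → c u ≠ c v
  ear : ∀ v w, IsEar G σ v → G.Adj v w → w = σ v ∨ w = σ.symm v
  not_ear : ∀ v, ¬ IsEar G σ v → ∃ w, G.Adj v w ∧ w ≠ σ v ∧ w ≠ σ.symm v
  apex : ∀ v, ∃ w, G.Adj v w ∧ G.Adj (σ v) w
  fan : ∀ t j, ¬ IsEar G σ t → c t ≠ j →
    (∃ s₁ s₂, s₁ ≠ s₂ ∧ G.Adj t s₁ ∧ G.Adj t s₂ ∧ c s₁ ≠ j ∧ c s₂ ≠ j) ∨
    ∃ v, (∀ w, G.Adj t w ↔ w = σ t ∨ w = v ∨ w = σ.symm t) ∧ c (σ t) = j ∧ c (σ.symm t) = j ∧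
      c v ≠ j ∧ G.Adj v (σ t) ∧ G.Adj v (σ.symm t)
  exists_ear : ∃ v, IsEar G σ v
  alternating : ∀ (A : Set V) (v : V), v ∉ A → σ v ∉ A →
    ∃ M : Set V, ∀ y, y ∈ M ↔ y ∈ A ∧ σ.symm (σ.symm y) ∉ M

lemma IsTriangulation.exists_isColouredPolygon {V : Type*} {G : SimpleGraph V} {n : ℕ} {e : ℤ → V}
    (h : IsTriangulation G n e) (hn : 5 ≤ n) :
    ∃ σ c, IsColouredPolygon G σ c := by
  obtain ⟨σ, hσ⟩ := h.exists_rotation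
  obtain ⟨c, hc⟩ := h.exists_colouring (by omega)
  have hs : ∀ i, σ (e i) = e (i + 1) := fun i => (hσ i).1
  have hp : ∀ i, σ.symm (e i) = e (i - 1) := fun i => (hσ i).2
  -- the third corner of the triangle over the side from `i` to `i + 1`
  have fan₁ : ∀ i : ℤ, ∃ k, i + 1 < k ∧ k < i + n ∧ G.Adj (e (i + 1)) (e k) ∧ G.Adj (e k) (e i) := by
    intro i
    obtain ⟨k, h1, h2, h3, h4⟩ := h.exists_apex (i := i + 1) (j := i + n) (by omega) (by omega)
      (by rw [h.apply_add_period]; exact (h.adj_succ (by omega) i).symm)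
    exact ⟨k, h1, h2, h3, by rwa [h.apply_add_period] at h4⟩
  have hpn : ∀ i, e (i - 1) = e (i + n - 1) := fun i => by
    rw [← h.apply_add_period (i - 1)]; congr 1; ring
  have fan₂ : ∀ i, ¬ IsEar G σ (e i) → ∀ k, i + 1 < k → G.Adj (e (i + 1)) (e k) → k ≠ i + n - 1 := by
    rintro i hi k h1 h2 rfl
    apply hi
    rw [IsEar, hp, hs, hpn]
    exact h2.symm
  refine ⟨σ, c, ?_, ?_, ?_, ?_, hc, ?_, ?_, ?_, ?_, ?_, ?_⟩
  · intro v
    obtain ⟨i, rfl⟩ := h.surjective v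
    rw [hs]; exact h.adj_succ (by omega) i
  · intro v
    obtain ⟨i, rfl⟩ := h.surjective v
    simp only [hs]; exact (h.ne_of_lt (by omega) (by omega)).symm
  · intro v
    obtain ⟨i, rfl⟩ := h.surjective v
    simp only [hs]; exact (h.ne_of_lt (by omega) (by omega)).symm
  · intro v
    obtain ⟨i, rfl⟩ := h.surjective v
    simp only [hs]; exact (h.ne_of_lt (by omega) (by omega)).symm
  · intro v w hv hw
    obtain ⟨i, rfl⟩ := h.surjective v
    rw [IsEar, hs, hp] at hv
    rw [hs, hp]
    exact h.eq_or_eq_of_ear (by omega) hv hw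
  · intro v hv
    obtain ⟨i, rfl⟩ := h.surjective v
    obtain ⟨k, h1, h2, h3, h4⟩ := fan₁ i
    have h5 := fan₂ i hv k h1 h3
    refine ⟨e k, h4.symm, ?_, ?_⟩
    · rw [hs]; exact h3.symm.ne
    · rw [hp, hpn]; exact h.ne_of_lt (by omega) (by omega)
  · intro v
    obtain ⟨i, rfl⟩ := h.surjective v
    obtain ⟨k, h1, h2, h3, h4⟩ := fan₁ i
    exact ⟨e k, h4.symm, by rwa [hs]⟩
  · -- `σ t`, `e a` and `e b` are consecutive neighbours of `t`, starting from the side `t`, `σ t`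
    intro t j ht hj
    obtain ⟨i, rfl⟩ := h.surjective t
    obtain ⟨a, h1, h2, h3, h4⟩ := fan₁ i
    have h5 := fan₂ i ht a h1 h3
    obtain ⟨b, g1, g2, g3, g4⟩ := h.exists_apex (i := a) (j := i + n) (by omega) (by omega)
      (by rwa [h.apply_add_period])
    rw [h.apply_add_period] at g4
    have hs1 := h.adj_succ (by omega) i
    have k1 := hc _ _ h3
    have k2 := hc _ _ h4
    have k3 := hc _ _ g3
    have k4 := hc _ _ g4
    have k5 := hc _ _ hs1
    by_cases hcol : c (e (i + 1)) = j
    · have hb : c (e b) = j := by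
        clear * - hcol k1 k2 k3 k4 k5 hj
        generalize c (e b) = x at *
        generalize c (e a) = y at *
        generalize c (e i) = z at *
        generalize c (e (i + 1)) = w at *
        decide +revert
      have ha : c (e a) ≠ j := fun hh => k1 (by rw [hcol, hh])
      rcases eq_or_ne b (i + n - 1) with rfl | hbn
      · right
        rw [← hpn] at hb g3 g4
        refine ⟨e a, fun w => ⟨fun hw => ?_, ?_⟩, by rwa [hs], by rwa [hp], ha, ?_, ?_⟩
        · rw [hs, hp]
          obtain ⟨m, m1, m2, rfl⟩ := h.exists_index (by omega) i w
          rcases eq_or_ne m i with rfl | m3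
          · exact absurd rfl hw.ne
          rcases eq_or_ne m (i + 1) with rfl | m4
          · exact Or.inl rfl
          rcases lt_trichotomy m a with m5 | rfl | m5
          · exact absurd ⟨hw, h3⟩ (h.noncrossing i (i + 1) m a (by omega) (by omega) m5 h2)
          · exact Or.inr (Or.inl rfl)
          rcases eq_or_ne m (i + n - 1) with rfl | m6
          · right; right; rw [← hpn]
          · rw [hpn] at g3
            rw [← h.apply_add_period i] at hw
            exact absurd ⟨g3, hw.symm⟩
              (h.noncrossing a m (i + n - 1) (i + n) m5 (by omega) (by omega) (by omega))
        · rw [hs, hp]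
          rintro (rfl | rfl | rfl)
          · exact hs1
          · exact h4.symm
          · exact g4.symm
        · rw [hs]; exact h3.symm
        · rw [hp]; exact g3
      · left
        obtain ⟨d, d1, d2, d3, d4⟩ := h.exists_apex (i := b) (j := i + n) (by omega) (by omega)
          (by rwa [h.apply_add_period])
        rw [h.apply_add_period] at d4
        refine ⟨e a, e d, h.ne_of_lt (by omega) (by omega), h4.symm, d4.symm, ha, ?_⟩
        intro hh
        exact hc _ _ d3 (by rw [hb, hh])
    · left
      refine ⟨e (i + 1), e b, h.ne_of_lt (by omega) (by omega), hs1, g4.symm, hcol, ?_⟩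
      clear * - hcol k1 k2 k3 k4 k5 hj
      generalize c (e b) = x at *
      generalize c (e a) = y at *
      generalize c (e i) = z at *
      generalize c (e (i + 1)) = w at *
      decide +revert
  · obtain ⟨i, hi⟩ := h.exists_ear (by omega)
    refine ⟨e (i + 1), ?_⟩
    rw [IsEar, hs, hp]
    rwa [add_sub_cancel_right, add_assoc]
  · intro A v hv hσv
    obtain ⟨i, rfl⟩ := h.surjective v
    rw [hs] at hσv
    -- decide membership by recursion along the polygon, starting at `v`
    obtain ⟨f, hf0, hf1, hf⟩ : ∃ f : ℕ → Prop, ¬ f 0 ∧ ¬ f 1 ∧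
        ∀ k, f (k + 2) ↔ e (i + (k + 2 : ℕ)) ∈ A ∧ ¬ f k :=
      ⟨fun k => (Nat.rec (motive := fun _ => Prop × Prop) (False, False)
        (fun m p => (p.2, e (i + (m + 2 : ℕ)) ∈ A ∧ ¬ p.1)) k).1, id, id, fun k => Iff.rfl⟩
    choose g hg1 hg2 hg3 using h.exists_index (n := n) (by omega) i
    have hgu : ∀ k, i ≤ k → k < i + n → g (e k) = k := by
      intro k h1 h2
      have b1 := hg1 (e k)
      have b2 := hg2 (e k)
      rcases lt_trichotomy (g (e k)) k with hlt | heq | hlt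
      · exact absurd (hg3 (e k)) (h.ne_of_lt hlt (by omega))
      · exact heq
      · exact absurd (hg3 (e k)).symm (h.ne_of_lt hlt (by omega))
    refine ⟨{y | f (g y - i).toNat}, fun y => ?_⟩
    obtain ⟨k, h1, h2, rfl⟩ := h.exists_index (n := n) (by omega) i y
    simp only [Set.mem_ofPred_eq, hp, hgu k h1 h2]
    obtain ⟨m, rfl⟩ : ∃ m : ℕ, k = i + m := ⟨(k - i).toNat, by omega⟩
    rw [show (i + (m : ℤ) - i).toNat = m by omega]
    rcases m with _ | _ | m
    · simpa [hf0] using fun hh => absurd hh hv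
    · simpa [hf1] using fun hh => absurd hh hσv
    · rw [hf, hgu _ (by omega) (by omega),
        show (i + ((m + 1 + 1 : ℕ) : ℤ) - 1 - 1 - i).toNat = m by omega]

/-! ### Removing colour classes -/

section Definitions

variable {V : Type*} (G : SimpleGraph V) (σ : Equiv.Perm V) (c : V → Fin 3)

/-- The vertex `v` is next to an ear on the polygon. These vertices are exactly the neighbours of the
ears. -/
def NearEar (v : V) : Prop := IsEar G σ (σ v) ∨ IsEar G σ (σ.symm v)

/-- The vertex `y` has exactly three neighbours, namely its two neighbours on the polygon, which
have colour `j`, and the vertex `v`, which has another colour. -/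
structure HasHub (j : Fin 3) (y v : V) : Prop where
  adj_iff : ∀ w, G.Adj y w ↔ w = σ y ∨ w = v ∨ w = σ.symm y
  colour_succ : c (σ y) = j
  colour_pred : c (σ.symm y) = j
  colour_hub : c v ≠ j
  adj_succ : G.Adj v (σ y)
  adj_pred : G.Adj v (σ.symm y)

/-- The ears together with the vertices of colour `j` that are not adjacent to an ear. -/
def baseSet (j : Fin 3) : Set V := {v | IsEar G σ v ∨ c v = j ∧ ¬ NearEar G σ v}

/-- The vertices with hub both of whose neighbours on the polygon are vertices of `baseSet` but not
ears: only the hub remains adjacent to them when `baseSet` is removed. -/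
def pivotSet (j : Fin 3) : Set V :=
  {y | (∃ v, HasHub G σ c j y v) ∧ ¬ IsEar G σ (σ y) ∧ ¬ NearEar G σ (σ y) ∧
    ¬ IsEar G σ (σ.symm y) ∧ ¬ NearEar G σ (σ.symm y)}

/-- A choice of pivots for each colour, such that of two pivots at distance two on the polygon
exactly one is chosen, and a pivot without a pivot two steps before it is chosen. -/
def IsSelection (M : Fin 3 → Set V) : Prop :=
  ∀ j y, y ∈ M j ↔ y ∈ pivotSet G σ c j ∧ σ.symm (σ.symm y) ∉ M j

variable (M : Fin 3 → Set V)

/-- The modification of `baseSet` in which the successor of each selected pivot is replaced by the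
pivot itself. -/
def shiftedSet (j : Fin 3) : Set V :=
  {v | v ∈ M j ∨ v ∈ baseSet G σ c j ∧ σ.symm v ∉ M j}

/-- The vertex `y` has exactly three neighbours: an ear `d` of colour `j`, the other neighbour `v`
of this ear, and the neighbour `x` of `y` on the polygon that is not `d`. Moreover `x` has colour
`j`, is adjacent to `v`, and is neither an ear nor adjacent to one. -/
structure IsFlap (j : Fin 3) (y d v x : V) : Prop where
  adj_iff : ∀ w, G.Adj y w ↔ w = d ∨ w = v ∨ w = x
  position : (d = σ y ∧ v = σ (σ y) ∧ x = σ.symm y) ∨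
    (d = σ.symm y ∧ v = σ.symm (σ.symm y) ∧ x = σ y)
  ear : IsEar G σ d
  colour_ear : c d = j
  colour_hub : c v ≠ j
  colour_end : c x = j
  adj_end : G.Adj v x
  not_ear : ¬ IsEar G σ x
  not_near : ¬ NearEar G σ x

/-- The flaps with respect to the colour `j`. These are the only vertices that may keep fewer than
two neighbours when `shiftedSet` is removed. -/
def flapSet (j : Fin 3) : Set V := {y | ∃ d v x, IsFlap G σ c j y d v x}

/-- A removed vertex `u` is bad if each of its remaining neighbours `v` is adjacent to a flap that is
not adjacent to `u`, so that the exchange of `u` and `v` may leave this flap without remaining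
neighbours. -/
def IsBad (u : V) : Prop :=
  u ∈ shiftedSet G σ c M (c u) ∧ ∀ v, G.Adj u v → v ∉ shiftedSet G σ c M (c u) →
    ∃ y ∈ flapSet G σ c (c u), G.Adj y v ∧ ¬ G.Adj y u

/-- A bad vertex that is not an ear is moved to the class of the third colour, the one that neither
it nor its successor has. -/
def IsMoved (j : Fin 3) (u : V) : Prop :=
  IsBad G σ c M u ∧ ¬ IsEar G σ u ∧ c u ≠ j ∧ c (σ u) ≠ j

/-- The modification of `shiftedSet` in which each bad vertex that is not an ear changes its class,
and one vertex is given back for each bad ear. The complement of this set is a secure total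
dominating set. -/
def finalSet (j : Fin 3) : Set V :=
  {u | IsMoved G σ c M j u ∨ u ∈ shiftedSet G σ c M j ∧
    ¬ (c u = j ∧ IsBad G σ c M u ∧ ¬ IsEar G σ u) ∧
    ¬ ∃ d, IsEar G σ d ∧ IsBad G σ c M d ∧ c d = j ∧ u = σ (σ (σ (σ d)))}

end Definitions

namespace IsColouredPolygon

variable {V : Type*} {G : SimpleGraph V} {σ : Equiv.Perm V} {c : V → Fin 3} {j : Fin 3}
  {M : Fin 3 → Set V} {t u v w x y d : V}

lemma adj_pred (h : IsColouredPolygon G σ c) (v : V) : G.Adj v (σ.symm v) := by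
  have := h.adj_succ (σ.symm v)
  rw [Equiv.apply_symm_apply] at this
  exact this.symm

lemma succ_ne_pred (h : IsColouredPolygon G σ c) (v : V) : σ v ≠ σ.symm v := by
  intro hv
  have := h.two v
  rw [hv, Equiv.apply_symm_apply] at this
  exact this rfl

lemma succ_succ_ne_pred (h : IsColouredPolygon G σ c) (v : V) : σ (σ v) ≠ σ.symm v := by
  intro hv
  have := h.three v
  rw [hv, Equiv.apply_symm_apply] at this
  exact this rfl

lemma pred_pred_ne_succ (h : IsColouredPolygon G σ c) (v : V) : σ.symm (σ.symm v) ≠ σ v := by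
  intro hv
  have := h.three v
  rw [← hv, Equiv.apply_symm_apply, Equiv.apply_symm_apply] at this
  exact this rfl

lemma succ_succ_ne_pred_pred (h : IsColouredPolygon G σ c) (v : V) :
    σ (σ v) ≠ σ.symm (σ.symm v) := by
  intro hv
  have := h.four v
  rw [hv, Equiv.apply_symm_apply, Equiv.apply_symm_apply] at this
  exact this rfl

lemma colour_eq_of_ne {a b d j : Fin 3} (h1 : a ≠ j) (h2 : b ≠ j) (h3 : a ≠ b) (h4 : d ≠ a)
    (h5 : d ≠ b) : d = j := by
  omega

lemma position_of_adj_ear (h : IsColouredPolygon G σ c) (hd : IsEar G σ d) (hw : G.Adj d w) :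
    d = σ w ∨ d = σ.symm w := by
  rcases h.ear d w hd hw with rfl | rfl
  · right; rw [Equiv.symm_apply_apply]
  · left; rw [Equiv.apply_symm_apply]

lemma near_of_adj_ear (h : IsColouredPolygon G σ c) (hd : IsEar G σ d) (hw : G.Adj d w) :
    NearEar G σ w := by
  rcases h.position_of_adj_ear hd hw with rfl | rfl
  · exact Or.inl hd
  · exact Or.inr hd

lemma not_ear_succ (h : IsColouredPolygon G σ c) (hv : IsEar G σ v) : ¬ IsEar G σ (σ v) := by
  intro hv'
  rw [IsEar, Equiv.symm_apply_apply] at hv'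
  rcases h.ear _ _ hv hv' with h1 | h1
  · exact (h.adj_succ _).ne' h1
  · exact h.succ_succ_ne_pred v h1

lemma not_near_of_ear (h : IsColouredPolygon G σ c) (hv : IsEar G σ v) : ¬ NearEar G σ v := by
  rintro (h1 | h1)
  · exact h.not_ear_succ hv h1
  · apply h.not_ear_succ h1
    rwa [Equiv.apply_symm_apply]

lemma not_ear_of_near (h : IsColouredPolygon G σ c) (hv : NearEar G σ v) : ¬ IsEar G σ v :=
  fun h1 => h.not_near_of_ear h1 hv

lemma near_succ (hv : IsEar G σ v) : NearEar G σ (σ v) := by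
  right; rwa [Equiv.symm_apply_apply]

lemma near_pred (hv : IsEar G σ v) : NearEar G σ (σ.symm v) := by
  left; rwa [Equiv.apply_symm_apply]

lemma not_ear_of_hub (h : IsColouredPolygon G σ c) (hy : HasHub G σ c j y v) : ¬ IsEar G σ y := by
  intro hear
  rcases h.ear y v hear ((hy.adj_iff v).2 (by simp)) with rfl | rfl
  · exact hy.colour_hub hy.colour_succ
  · exact hy.colour_hub hy.colour_pred

lemma colour_ne_of_hub (h : IsColouredPolygon G σ c) (hy : HasHub G σ c j y v) : c y ≠ j := by
  rw [← hy.colour_succ]; exact h.colour _ _ (h.adj_succ y)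

lemma hub_not_ear (h : IsColouredPolygon G σ c) (hy : HasHub G σ c j y v) : ¬ IsEar G σ v := by
  intro hear
  rcases h.position_of_adj_ear hear ((hy.adj_iff v).2 (by simp)).symm with hv | hv
  · exact hy.colour_hub (hv ▸ hy.colour_succ)
  · exact hy.colour_hub (hv ▸ hy.colour_pred)

/-- A hub with respect to colour `j` does not itself have a hub with respect to colour `j`: on a
polygon with four corners this would be possible. -/
lemma hub_not_hasHub (h : IsColouredPolygon G σ c) (hy : HasHub G σ c j y v) :
    ¬ HasHub G σ c j v w := by
  intro hv
  have hyv : G.Adj y v := (hy.adj_iff v).2 (by simp)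
  have hw : y = w := by
    rcases (hv.adj_iff y).1 hyv.symm with h1 | h1 | h1
    · exact absurd (h1 ▸ hv.colour_succ) (h.colour_ne_of_hub hy)
    · exact h1
    · exact absurd (h1 ▸ hv.colour_pred) (h.colour_ne_of_hub hy)
  subst hw
  have h1 : σ y = σ.symm v := by
    rcases (hv.adj_iff _).1 hy.adj_succ with h1 | h1 | h1
    · exact absurd (σ.injective h1) hyv.ne
    · exact absurd h1 (h.adj_succ y).ne'
    · exact h1
  have h2 : σ.symm y = σ v := by
    rcases (hv.adj_iff _).1 hy.adj_pred with h1 | h1 | h1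
    · exact h1
    · exact absurd h1 (h.adj_pred y).ne'
    · exact absurd (σ.symm.injective h1) hyv.ne
  apply h.succ_succ_ne_pred_pred y
  rw [h1, h2, Equiv.apply_symm_apply, Equiv.symm_apply_apply]

/-- Apart from the ears and the vertices of colour `j` only selected pivots are removed. -/
lemma mem_of_mem_shiftedSet (hv : v ∈ shiftedSet G σ c M j) (hj : c v ≠ j)
    (hear : ¬ IsEar G σ v) : v ∈ M j := by
  rcases hv with h1 | ⟨h1 | h1, -⟩
  · exact h1
  · exact absurd h1 hear
  · exact absurd h1.1 hj

section Selection

variable (h : IsColouredPolygon G σ c) (hM : IsSelection G σ c M)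
include hM

lemma exists_hub (hy : y ∈ M j) : ∃ v, HasHub G σ c j y v := ((hM j y).1 hy).1.1

lemma not_near_of_mem (hy : y ∈ M j) : ¬ NearEar G σ y := by
  obtain ⟨⟨-, h1, -, h2, -⟩, -⟩ := (hM j y).1 hy
  rintro (h3 | h3)
  · exact h1 h3
  · exact h2 h3

lemma mem_shiftedSet_of_ear (hv : IsEar G σ v) : v ∈ shiftedSet G σ c M j := by
  refine Or.inr ⟨Or.inl hv, fun h1 => ?_⟩
  obtain ⟨⟨-, h2, -⟩, -⟩ := (hM j _).1 h1
  rw [Equiv.apply_symm_apply] at h2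
  exact h2 hv

/-- A neighbour of colour `j` of a selected pivot is next to it on the polygon. -/
lemma position_of_adj_mem (hy : y ∈ M j) (hw : G.Adj y w) (hj : c w = j) :
    w = σ y ∨ w = σ.symm y := by
  obtain ⟨v, hv⟩ := exists_hub hM hy
  rcases (hv.adj_iff w).1 hw with h1 | h1 | h1
  · exact Or.inl h1
  · exact absurd (h1 ▸ hj) hv.colour_hub
  · exact Or.inr h1

include h

lemma colour_ne_of_mem (hy : y ∈ M j) : c y ≠ j :=
  (exists_hub hM hy).elim fun _ hv => h.colour_ne_of_hub hv

lemma not_ear_of_mem (hy : y ∈ M j) : ¬ IsEar G σ y :=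
  (exists_hub hM hy).elim fun _ hv => h.not_ear_of_hub hv

lemma not_mem_shiftedSet_of_near (hv : NearEar G σ v) : v ∉ shiftedSet G σ c M j := by
  rintro (h1 | ⟨h1 | h1, -⟩)
  · exact not_near_of_mem hM h1 hv
  · exact h.not_ear_of_near hv h1
  · exact h1.2 hv

lemma succ_not_mem_shiftedSet (hy : y ∈ M j) : σ y ∉ shiftedSet G σ c M j := by
  rintro (h1 | ⟨-, h1⟩)
  · exact h.colour_ne_of_mem hM h1 (exists_hub hM hy).choose_spec.colour_succ
  · rw [Equiv.symm_apply_apply] at h1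
    exact h1 hy

lemma exists_two_of_ear (ht : IsEar G σ t) :
    ∃ s₁ s₂, s₁ ≠ s₂ ∧ G.Adj t s₁ ∧ G.Adj t s₂ ∧ s₁ ∉ shiftedSet G σ c M j ∧
      s₂ ∉ shiftedSet G σ c M j :=
  ⟨σ t, σ.symm t, h.succ_ne_pred t, h.adj_succ t, h.adj_pred t,
    h.not_mem_shiftedSet_of_near hM (near_succ ht), h.not_mem_shiftedSet_of_near hM (near_pred ht)⟩

/-- A vertex between two ears is adjacent to the other neighbours of both. -/
lemma exists_two_of_between_ears (h1 : IsEar G σ (σ t)) (h2 : IsEar G σ (σ.symm t)) :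
    ∃ s₁ s₂, s₁ ≠ s₂ ∧ G.Adj t s₁ ∧ G.Adj t s₂ ∧ s₁ ∉ shiftedSet G σ c M j ∧
      s₂ ∉ shiftedSet G σ c M j := by
  refine ⟨σ (σ t), σ.symm (σ.symm t), h.succ_succ_ne_pred_pred t, ?_, ?_,
    h.not_mem_shiftedSet_of_near hM (near_succ h1), h.not_mem_shiftedSet_of_near hM (near_pred h2)⟩
  · rwa [IsEar, Equiv.symm_apply_apply] at h1
  · rw [IsEar, Equiv.apply_symm_apply] at h2; exact h2.symm

/-- A vertex of colour `j` that is not an ear has a neighbour off the polygon, which remains, and both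
neighbours on the polygon are removed only if they are ears. -/
lemma exists_two_of_colour_eq (ht : ¬ IsEar G σ t) (hj : c t = j) :
    ∃ s₁ s₂, s₁ ≠ s₂ ∧ G.Adj t s₁ ∧ G.Adj t s₂ ∧ s₁ ∉ shiftedSet G σ c M j ∧
      s₂ ∉ shiftedSet G σ c M j := by
  -- a removed neighbour is an ear or a selected pivot, hence next to `t`
  have key : ∀ s, G.Adj t s → s ∈ shiftedSet G σ c M j → IsEar G σ s ∨ s ∈ M j := by
    intro s hs hs1
    by_cases h1 : IsEar G σ s
    · exact Or.inl h1
    · exact Or.inr (mem_of_mem_shiftedSet hs1 (hj ▸ (h.colour _ _ hs).symm) h1)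
  have hM' : ∀ s, G.Adj t s → s ∈ M j → ¬ NearEar G σ t := by
    intro s hs hs1
    obtain ⟨⟨-, h2⟩, -⟩ := (hM j s).1 hs1
    rcases position_of_adj_mem hM hs1 hs.symm hj with rfl | rfl
    · exact h2.2.1
    · exact h2.2.2.2
  obtain ⟨w, hw, hw1, hw2⟩ := h.not_ear t ht
  have hwS : w ∉ shiftedSet G σ c M j := by
    intro hwR
    rcases key w hw hwR with h1 | h1
    · rcases h.position_of_adj_ear h1 hw.symm with h2 | h2
      · exact hw1 h2
      · exact hw2 h2
    · rcases position_of_adj_mem hM h1 hw.symm hj with rfl | rfl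
      · exact hw2 (by rw [Equiv.symm_apply_apply])
      · exact hw1 (by rw [Equiv.apply_symm_apply])
  by_cases h1 : σ t ∈ shiftedSet G σ c M j
  · by_cases h2 : σ.symm t ∈ shiftedSet G σ c M j
    · rcases key _ (h.adj_succ t) h1 with h3 | h3
      · rcases key _ (h.adj_pred t) h2 with h4 | h4
        · exact h.exists_two_of_between_ears hM h3 h4
        · exact absurd (Or.inl h3) (hM' _ (h.adj_pred t) h4)
      · rcases key _ (h.adj_pred t) h2 with h4 | h4
        · exact absurd (Or.inr h4) (hM' _ (h.adj_succ t) h3)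
        · have h5 := ((hM j _).1 h3).2
          rw [Equiv.symm_apply_apply] at h5
          exact absurd h4 h5
    · exact ⟨w, σ.symm t, hw2, hw, h.adj_pred t, hwS, h2⟩
  · exact ⟨w, σ t, hw1, hw, h.adj_succ t, hwS, h1⟩

/-- If a neighbour `s` of `t` is removed, where neither vertex has colour `j`, then it is an ear or
a selected pivot, and `t` has a remaining neighbour of colour `j` that replaces `s`. -/
lemma exists_replacement {s : V} (hs : G.Adj t s) (ht : c t ≠ j) (hsj : c s ≠ j) :
    s ∉ shiftedSet G σ c M j ∨ ∃ o, G.Adj t o ∧ o ∉ shiftedSet G σ c M j ∧ c o = j ∧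
      ((s = σ t ∧ o = σ (σ t) ∧ NearEar G σ o) ∨
        (s = σ.symm t ∧ o = σ.symm (σ.symm t) ∧ NearEar G σ o) ∨
        (o = σ s ∧ ¬ NearEar G σ o)) := by
  rw [or_iff_not_imp_left, not_not]
  intro hsR
  have hts := h.colour _ _ hs
  by_cases hear : IsEar G σ s
  · rcases h.position_of_adj_ear hear hs.symm with rfl | rfl
    · have h1 : G.Adj t (σ (σ t)) := by rwa [IsEar, Equiv.symm_apply_apply] at hear
      exact ⟨σ (σ t), h1, h.not_mem_shiftedSet_of_near hM (near_succ hear),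
        colour_eq_of_ne ht hsj hts (h.colour _ _ h1).symm (h.colour _ _ (h.adj_succ _)).symm,
        Or.inl ⟨rfl, rfl, near_succ hear⟩⟩
    · have h1 : G.Adj t (σ.symm (σ.symm t)) := by
        rw [IsEar, Equiv.apply_symm_apply] at hear; exact hear.symm
      exact ⟨σ.symm (σ.symm t), h1, h.not_mem_shiftedSet_of_near hM (near_pred hear),
        colour_eq_of_ne ht hsj hts (h.colour _ _ h1).symm (h.colour _ _ (h.adj_pred _)).symm,
        Or.inr (Or.inl ⟨rfl, rfl, near_pred hear⟩)⟩
  · have hsM := mem_of_mem_shiftedSet hsR hsj hear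
    obtain ⟨⟨⟨v, hv⟩, -, h2, -⟩, -⟩ := (hM j s).1 hsM
    have htv : t = v := by
      rcases (hv.adj_iff t).1 hs.symm with h1 | h1 | h1
      · exact absurd (h1 ▸ hv.colour_succ) ht
      · exact h1
      · exact absurd (h1 ▸ hv.colour_pred) ht
    subst htv
    exact ⟨σ s, hv.adj_succ, h.succ_not_mem_shiftedSet hM hsM, hv.colour_succ,
      Or.inr (Or.inr ⟨rfl, h2⟩)⟩

/-- After the removal of `shiftedSet` every vertex has two remaining neighbours, unless it is a
flap. -/
lemma exists_two_or_flap (t : V) (j : Fin 3) :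
    (∃ s₁ s₂, s₁ ≠ s₂ ∧ G.Adj t s₁ ∧ G.Adj t s₂ ∧ s₁ ∉ shiftedSet G σ c M j ∧
      s₂ ∉ shiftedSet G σ c M j) ∨ t ∈ flapSet G σ c j := by
  by_cases ht : IsEar G σ t
  · exact Or.inl (h.exists_two_of_ear hM ht)
  by_cases hj : c t = j
  · exact Or.inl (h.exists_two_of_colour_eq hM ht hj)
  rcases h.fan t j ht hj with ⟨s₁, s₂, hne, hs1, hs2, hc1, hc2⟩ | ⟨v, hN, hv1, hv2, hv3, hv4, hv5⟩
  · left
    rcases h.exists_replacement hM hs1 hj hc1 with h1 | ⟨o₁, a1, a2, a3, a4⟩ <;>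
      rcases h.exists_replacement hM hs2 hj hc2 with h2 | ⟨o₂, b1, b2, b3, b4⟩
    · exact ⟨s₁, s₂, hne, hs1, hs2, h1, h2⟩
    · exact ⟨s₁, o₂, fun hh => hc1 (hh ▸ b3), hs1, b1, h1, b2⟩
    · exact ⟨o₁, s₂, fun hh => hc2 (hh ▸ a3), a1, hs2, a2, h2⟩
    · refine ⟨o₁, o₂, ?_, a1, b1, a2, b2⟩
      rintro rfl
      rcases a4 with ⟨p1, p2, p3⟩ | ⟨p1, p2, p3⟩ | ⟨p2, p3⟩ <;>
        rcases b4 with ⟨q1, q2, q3⟩ | ⟨q1, q2, q3⟩ | ⟨q2, q3⟩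
      · exact hne (p1.trans q1.symm)
      · exact h.succ_succ_ne_pred_pred t (p2.symm.trans q2)
      · exact q3 p3
      · exact h.succ_succ_ne_pred_pred t (q2.symm.trans p2)
      · exact hne (p1.trans q1.symm)
      · exact q3 p3
      · exact p3 q3
      · exact p3 q3
      · exact hne (σ.injective (p2.symm.trans q2))
  have hhub : HasHub G σ c j t v := ⟨hN, hv1, hv2, hv3, hv4, hv5⟩
  have htv : G.Adj t v := (hN v).2 (by simp)
  have hvS : v ∉ shiftedSet G σ c M j := by
    intro hvR
    have hvM := mem_of_mem_shiftedSet hvR hv3 (h.hub_not_ear hhub)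
    obtain ⟨w, hw⟩ := exists_hub hM hvM
    exact h.hub_not_hasHub hhub hw
  by_cases h1 : σ t ∈ shiftedSet G σ c M j
  swap
  · exact Or.inl ⟨v, σ t, fun hh => hv3 (hh ▸ hv1), htv, h.adj_succ t, hvS, h1⟩
  by_cases h2 : σ.symm t ∈ shiftedSet G σ c M j
  swap
  · exact Or.inl ⟨v, σ.symm t, fun hh => hv3 (hh ▸ hv2), htv, h.adj_pred t, hvS, h2⟩
  -- both neighbours on the polygon are removed, and they are no pivots
  have key : ∀ s, c s = j → s ∈ shiftedSet G σ c M j → (IsEar G σ s ∨ ¬ NearEar G σ s) ∧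
      σ.symm s ∉ M j := by
    rintro s hs (h3 | ⟨h3, h4⟩)
    · exact absurd hs (h.colour_ne_of_mem hM h3)
    · exact ⟨h3.imp_right fun hh => hh.2, h4⟩
  obtain ⟨h3, h4⟩ := key _ hv1 h1
  obtain ⟨h5, h6⟩ := key _ hv2 h2
  rw [Equiv.symm_apply_apply] at h4
  by_cases e1 : IsEar G σ (σ t) <;> by_cases e2 : IsEar G σ (σ.symm t)
  · exact Or.inl (h.exists_two_of_between_ears hM e1 e2)
  · right
    have hvt : v = σ (σ t) := by
      have h7 := e1
      rw [IsEar, Equiv.symm_apply_apply, hN] at h7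
      rcases h7 with h7 | h7 | h7
      · exact absurd h7 (h.adj_succ _).ne'
      · exact h7.symm
      · exact absurd h7 (h.succ_succ_ne_pred t)
    exact ⟨σ t, v, σ.symm t, hN, Or.inl ⟨rfl, hvt, rfl⟩, e1, hv1, hv3, hv2, hv5, e2,
      h5.resolve_left e2⟩
  · right
    have hvt : v = σ.symm (σ.symm t) := by
      have h7 := e2
      rw [IsEar, Equiv.apply_symm_apply, G.adj_comm, hN] at h7
      rcases h7 with h7 | h7 | h7
      · exact absurd h7 (h.pred_pred_ne_succ t)
      · exact h7.symm
      · exact absurd h7 (h.adj_pred _).ne'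
    exact ⟨σ.symm t, v, σ t, fun w => (hN w).trans (by tauto), Or.inr ⟨rfl, hvt, rfl⟩, e2, hv2,
      hv3, hv1, hv4, e1, h3.resolve_left e1⟩
  · exact absurd ((hM j t).2 ⟨⟨⟨v, hhub⟩, e1, h3.resolve_left e1, e2, h5.resolve_left e2⟩, h6⟩) h4

end Selection

end IsColouredPolygon

/-! ### Bad vertices -/

namespace IsColouredPolygon

variable {V : Type*} {G : SimpleGraph V} {σ : Equiv.Perm V} {c : V → Fin 3} {i j : Fin 3}
  {M : Fin 3 → Set V} {t u v w x y d : V}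

lemma near_of_flap (h : IsColouredPolygon G σ c) (hy : IsFlap G σ c j y d v x) : NearEar G σ y :=
  h.near_of_adj_ear hy.ear ((hy.adj_iff d).2 (by simp)).symm

lemma near_hub_of_flap (hy : IsFlap G σ c j y d v x) : NearEar G σ v := by
  have hd := hy.ear
  rcases hy.position with ⟨rfl, rfl, -⟩ | ⟨rfl, rfl, -⟩
  · exact near_succ hd
  · exact near_pred hd

/-- The hub is the only neighbour of a flap that is adjacent to an ear. -/
lemma eq_hub_of_near (h : IsColouredPolygon G σ c) (hy : IsFlap G σ c j y d v x)
    (hw : G.Adj y w) (hnear : NearEar G σ w) : w = v := by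
  rcases (hy.adj_iff w).1 hw with rfl | rfl | rfl
  · exact absurd hnear (h.not_near_of_ear hy.ear)
  · rfl
  · exact absurd hnear hy.not_near

/-- If the hub of a flap is the successor of an ear `u` not adjacent to the flap, then the hub, the
ear `d` of the flap, the flap and its end follow `u` on the polygon in this order. -/
lemma flap_position_of_ear (hu : IsFlap G σ c j y d (σ u) x) (hyu : ¬ G.Adj y u) :
    d = σ (σ u) ∧ y = σ (σ (σ u)) ∧ x = σ (σ (σ (σ u))) := by
  rcases hu.position with ⟨rfl, h2, -⟩ | ⟨rfl, h2, rfl⟩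
  · rw [σ.injective h2] at hyu
    exact absurd ((hu.adj_iff _).2 (Or.inl rfl)) hyu
  · have h3 : y = σ (σ (σ u)) := by rw [h2]; simp
    subst h3
    simp

/-- A vertex of colour `j` next to an ear can be given up without harm to the flaps. -/
lemma not_flap_adj_of_near (h : IsColouredPolygon G σ c) (hc : c v = j) (hv : NearEar G σ v)
    (hy : y ∈ flapSet G σ c j) : ¬ G.Adj y v := by
  obtain ⟨d, w, x, hy⟩ := hy
  intro hyv
  exact hy.colour_hub (h.eq_hub_of_near hy hyv hv ▸ hc)

section Selection

variable (h : IsColouredPolygon G σ c) (hM : IsSelection G σ c M)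
include h hM

/-- Every remaining neighbour of a bad vertex is the hub of a flap. -/
lemma exists_flap_of_bad (hu : IsBad G σ c M u) (hw : G.Adj u w)
    (hwS : w ∉ shiftedSet G σ c M (c u)) :
    ∃ y d x, IsFlap G σ c (c u) y d w x ∧ ¬ G.Adj y u := by
  obtain ⟨y, ⟨d, v, x, hy⟩, hyw, hyu⟩ := hu.2 w hw hwS
  rcases (hy.adj_iff w).1 hyw with rfl | rfl | rfl
  · exact absurd (mem_shiftedSet_of_ear hM hy.ear) hwS
  · exact ⟨y, d, x, hy, hyu⟩
  · exact absurd hy.colour_end (h.colour _ _ hw).symm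

lemma near_of_adj_bad (hu : IsBad G σ c M u) (hw : G.Adj u w)
    (hwS : w ∉ shiftedSet G σ c M (c u)) : NearEar G σ w := by
  obtain ⟨y, d, x, hy, -⟩ := h.exists_flap_of_bad hM hu hw hwS
  exact near_hub_of_flap hy

lemma not_near_of_bad (hu : IsBad G σ c M u) : ¬ NearEar G σ u :=
  fun h1 => h.not_mem_shiftedSet_of_near hM h1 hu.1

lemma not_mem_finalSet_of_near (hv : NearEar G σ v) : v ∉ finalSet G σ c M j := by
  rintro (h1 | ⟨h1, -⟩)
  · exact h.not_near_of_bad hM h1.1 hv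
  · exact h.not_mem_shiftedSet_of_near hM hv h1

/-- A moved vertex was not already in the class that receives it. -/
lemma not_mem_shiftedSet_of_moved (hu : IsMoved G σ c M j u) : u ∉ shiftedSet G σ c M j := by
  obtain ⟨hbad, hear, hcu, -⟩ := hu
  intro huR
  have huM := mem_of_mem_shiftedSet huR hcu hear
  obtain ⟨⟨⟨v, hv⟩, -, h1, -, h2⟩, -⟩ := (hM j u).1 huM
  -- the remaining neighbours are all adjacent to ears, so only the hub qualifies
  have key : ∀ w, G.Adj u w → w ∉ shiftedSet G σ c M (c u) → w = v := by
    intro w hw hwS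
    have hnear := h.near_of_adj_bad hM hbad hw hwS
    rcases (hv.adj_iff w).1 hw with rfl | rfl | rfl
    · exact absurd hnear h1
    · rfl
    · exact absurd hnear h2
  rcases h.exists_two_or_flap hM u (c u) with ⟨s₁, s₂, hne, a1, a2, b1, b2⟩ | ⟨d, v, x, hy⟩
  · exact hne ((key s₁ a1 b1).trans (key s₂ a2 b2).symm)
  · exact h.colour _ _ ((hy.adj_iff d).2 (Or.inl rfl)) hy.colour_ear.symm

/-- The successor of a bad ear lies between two ears, and the vertex that is given back is no ear. -/
lemma bad_ear (hear : IsEar G σ u) (hbad : IsBad G σ c M u) :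
    IsEar G σ (σ (σ u)) ∧ ¬ IsEar G σ (σ (σ (σ (σ u)))) := by
  obtain ⟨y, d, x, hy, hyu⟩ := h.exists_flap_of_bad hM hbad (h.adj_succ u)
    (h.not_mem_shiftedSet_of_near hM (near_succ hear))
  obtain ⟨rfl, rfl, rfl⟩ := flap_position_of_ear hy hyu
  exact ⟨hy.ear, hy.not_ear⟩

lemma mem_finalSet_of_ear (hv : IsEar G σ v) : v ∈ finalSet G σ c M j := by
  refine Or.inr ⟨mem_shiftedSet_of_ear hM hv, fun h1 => h1.2.2 hv, ?_⟩
  rintro ⟨d, hd, hbad, -, rfl⟩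
  exact (h.bad_ear hM hd hbad).2 hv

/-- A neighbour `t` of a moved vertex `u` keeps two neighbours: if `t` remained before the move, it
is the hub of a flap, and the flap and its end are such neighbours; otherwise `t` is the pivot after
`u`, and its hub and its successor are. -/
lemma exists_two_of_adj_moved (hu : IsMoved G σ c M j u) (htu : G.Adj t u) :
    ∃ s₁ s₂, s₁ ≠ s₂ ∧ G.Adj t s₁ ∧ G.Adj t s₂ ∧ s₁ ∉ finalSet G σ c M j ∧
      s₂ ∉ finalSet G σ c M j := by
  obtain ⟨hbad, hear, hcu, hcs⟩ := hu
  have hunear := h.not_near_of_bad hM hbad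
  by_cases htS : t ∈ shiftedSet G σ c M (c u)
  · have htM : t ∈ M (c u) := by
      refine mem_of_mem_shiftedSet htS (h.colour _ _ htu) fun h1 => ?_
      exact hunear (h.near_of_adj_ear h1 htu)
    obtain ⟨v, hv⟩ := exists_hub hM htM
    have hut : u = σ.symm t := by
      rcases position_of_adj_mem hM htM htu rfl with h1 | h1
      · exact absurd (h1 ▸ hbad.1) (h1 ▸ h.succ_not_mem_shiftedSet hM htM)
      · exact h1
    have hsu : σ u = t := by rw [hut, Equiv.apply_symm_apply]
    rw [hsu] at hcs
    have htv : G.Adj t v := (hv.adj_iff v).2 (by simp)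
    have huv : G.Adj u v := hut ▸ hv.adj_pred.symm
    have hcv : c v = j := colour_eq_of_ne hcu hcs (h.colour _ _ htu).symm (h.colour _ _ huv).symm
      (h.colour _ _ htv).symm
    have hvS : v ∉ shiftedSet G σ c M (c u) := by
      intro hvR
      obtain ⟨w, hw⟩ := exists_hub hM (mem_of_mem_shiftedSet hvR hv.colour_hub (h.hub_not_ear hv))
      exact h.hub_not_hasHub hv hw
    refine ⟨v, σ t, fun hh => hv.colour_hub (hh ▸ hv.colour_succ), htv, h.adj_succ t,
      h.not_mem_finalSet_of_near hM (h.near_of_adj_bad hM hbad huv hvS), ?_⟩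
    have hst := h.succ_not_mem_shiftedSet hM htM
    have hcst := hv.colour_succ
    rintro (h1 | ⟨h1, -⟩)
    · have := h1.1.1
      rw [hcst] at this
      exact hst this
    · have h2 : σ t ∈ M j := by
        refine mem_of_mem_shiftedSet h1 (by rw [hcst]; exact hcu) ?_
        obtain ⟨⟨-, h3, -⟩, -⟩ := (hM _ t).1 htM
        exact h3
      have h3 := (exists_hub hM h2).choose_spec.colour_pred
      rw [Equiv.symm_apply_apply] at h3
      exact hcs h3
  · obtain ⟨y, d, x, hy, hyu⟩ := h.exists_flap_of_bad hM hbad htu.symm htS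
    have hyt : G.Adj y t := (hy.adj_iff t).2 (by simp)
    have hyx : G.Adj y x := (hy.adj_iff x).2 (by simp)
    have hynear := h.near_of_flap hy
    refine ⟨y, x, hyx.ne, hyt.symm, hy.adj_end, h.not_mem_finalSet_of_near hM hynear, ?_⟩
    rintro (⟨h1, -⟩ | ⟨h1, -⟩)
    · -- otherwise `y` is the hub of a flap, which can only be `t`, but `x` is adjacent to `t`
      have hyS := h.not_mem_shiftedSet_of_near (j := c x) hM hynear
      obtain ⟨y', d', x', hy', hyx'⟩ := h.exists_flap_of_bad hM h1 hyx.symm hyS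
      apply hyx'
      have hd' : d' = d := by
        have : G.Adj y d' := by
          have := hy'.ear
          rcases hy'.position with ⟨rfl, rfl, -⟩ | ⟨rfl, rfl, -⟩
          · exact (h.adj_succ _).symm
          · exact (h.adj_pred _).symm
        rcases (hy.adj_iff d').1 this with h2 | h2 | h2
        · exact h2
        · exact absurd (near_hub_of_flap hy) (h2 ▸ h.not_near_of_ear hy'.ear)
        · exact absurd hy'.ear (h2 ▸ hy.not_ear)
      have hy't : y' = t := by
        subst hd'
        rcases hy.position with ⟨p1, rfl, -⟩ | ⟨p1, rfl, -⟩ <;>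
          rcases hy'.position with ⟨q1, q2, -⟩ | ⟨q1, q2, -⟩
        · rw [q1] at p1
          rw [← σ.injective p1] at q2
          exact absurd q2.symm (fun h3 => h.two _ h3)
        · rw [← p1, q1, Equiv.apply_symm_apply]
        · rw [← p1, q1, Equiv.symm_apply_apply]
        · rw [q1] at p1
          rw [← σ.symm.injective p1, eq_comm, Equiv.symm_apply_eq, Equiv.symm_apply_eq] at q2
          exact absurd q2.symm (h.two _)
      rw [hy't]
      exact hy.adj_end
    · have h2 : x ∈ M j := mem_of_mem_shiftedSet h1 (by rw [hy.colour_end]; exact hcu) hy.not_ear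
      obtain ⟨⟨-, -, h3, -, h4⟩, -⟩ := (hM j x).1 h2
      rcases hy.position with ⟨-, -, rfl⟩ | ⟨-, -, rfl⟩
      · rw [Equiv.apply_symm_apply] at h3; exact h3 hynear
      · rw [Equiv.symm_apply_apply] at h4; exact h4 hynear

/-- After the removal of `finalSet` every vertex has two remaining neighbours, unless it is a
flap. -/
lemma exists_two_or_flap_final (t : V) (j : Fin 3) :
    (∃ s₁ s₂, s₁ ≠ s₂ ∧ G.Adj t s₁ ∧ G.Adj t s₂ ∧ s₁ ∉ finalSet G σ c M j ∧
      s₂ ∉ finalSet G σ c M j) ∨ t ∈ flapSet G σ c j := by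
  by_cases hmov : ∃ u, G.Adj t u ∧ IsMoved G σ c M j u
  · obtain ⟨u, htu, hu⟩ := hmov
    exact Or.inl (h.exists_two_of_adj_moved hM hu htu)
  push Not at hmov
  rcases h.exists_two_or_flap hM t j with ⟨s₁, s₂, hne, a1, a2, b1, b2⟩ | ht
  · refine Or.inl ⟨s₁, s₂, hne, a1, a2, ?_, ?_⟩
    · rintro (h1 | ⟨h1, -⟩)
      · exact hmov _ a1 h1
      · exact b1 h1
    · rintro (h1 | ⟨h1, -⟩)
      · exact hmov _ a2 h1
      · exact b2 h1
  · exact Or.inr ht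

/-- Each removed vertex `u` has a remaining neighbour `v` that it can replace: a flap adjacent to
`v` is adjacent to `u` or keeps two neighbours. -/
lemma exists_defender (hu : u ∈ finalSet G σ c M j) :
    ∃ v, G.Adj u v ∧ v ∉ finalSet G σ c M j ∧ ∀ y ∈ flapSet G σ c j, G.Adj y v → G.Adj y u ∨
      ∃ s₁ s₂, s₁ ≠ s₂ ∧ G.Adj y s₁ ∧ G.Adj y s₂ ∧ s₁ ∉ finalSet G σ c M j ∧
        s₂ ∉ finalSet G σ c M j := by
  rcases hu with ⟨hbad, hear, hcu, hcs⟩ | ⟨huR, hnb, hng⟩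
  · -- the third corner of the triangle over the side `u`, `σ u` has colour `j`
    obtain ⟨w, hw1, hw2⟩ := h.apex u
    have hcw : c w = j := colour_eq_of_ne hcu hcs (h.colour _ _ (h.adj_succ u))
      (h.colour _ _ hw1).symm (h.colour _ _ hw2).symm
    have hwS : w ∉ shiftedSet G σ c M (c u) := by
      intro hwR
      have hwM : w ∈ M (c u) := by
        refine mem_of_mem_shiftedSet hwR (h.colour _ _ hw1).symm fun h1 => ?_
        exact h.not_near_of_bad hM hbad (h.near_of_adj_ear h1 hw1.symm)
      rcases position_of_adj_mem hM hwM hw1.symm rfl with h1 | h1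
      · exact h.succ_not_mem_shiftedSet hM hwM (h1 ▸ hbad.1)
      · rw [h1, Equiv.apply_symm_apply] at hw2
        exact hw2.ne rfl
    have hnear := h.near_of_adj_bad hM hbad hw1 hwS
    exact ⟨w, hw1, h.not_mem_finalSet_of_near hM hnear, fun y hy hyw =>
      absurd hyw (h.not_flap_adj_of_near hcw hnear hy)⟩
  by_cases hcu : c u = j
  · by_cases hbad : IsBad G σ c M u
    · -- the vertex given back for the bad ear `u` serves the only flap that needs it
      have hear : IsEar G σ u := by
        by_contra hear; exact hnb ⟨hcu, hbad, hear⟩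
      have hnear := near_succ hear
      refine ⟨σ u, h.adj_succ u, h.not_mem_finalSet_of_near hM hnear, ?_⟩
      rintro y ⟨d, w, x, hy⟩ hyv
      obtain rfl := h.eq_hub_of_near hy hyv hnear
      by_cases hyu : G.Adj y u
      · exact Or.inl hyu
      obtain ⟨rfl, rfl, rfl⟩ := flap_position_of_ear hy hyu
      have hyx : G.Adj (σ (σ (σ u))) (σ (σ (σ (σ u)))) := h.adj_succ _
      refine Or.inr ⟨σ u, σ (σ (σ (σ u))), fun hh => hy.not_near (hh ▸ hnear), hyv, hyx,
        h.not_mem_finalSet_of_near hM hnear, ?_⟩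
      rintro (h1 | ⟨-, -, h1⟩)
      · exact h1.2.2.1 hy.colour_end
      · exact h1 ⟨u, hear, hbad, hcu, rfl⟩
    · -- the vertex exchanged with `u` before the moves is not moved itself
      have hdef : ∃ v, G.Adj u v ∧ v ∉ shiftedSet G σ c M j ∧
          ∀ y ∈ flapSet G σ c j, G.Adj y v → G.Adj y u := by
        subst hcu
        by_contra hno
        push Not at hno
        exact hbad ⟨huR, hno⟩
      obtain ⟨v, huv, hvS, hv⟩ := hdef
      refine ⟨v, huv, ?_, fun y hy hyv => Or.inl (hv y hy hyv)⟩
      rintro (⟨h1, h2, h3, h4⟩ | ⟨h1, -⟩)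
      · by_cases huS : u ∈ shiftedSet G σ c M (c v)
        · have huM : u ∈ M (c v) := by
            refine mem_of_mem_shiftedSet huS (by rw [hcu]; exact h3.symm) fun h5 => ?_
            exact h.not_near_of_bad hM h1 (h.near_of_adj_ear h5 huv)
          rcases position_of_adj_mem hM huM huv rfl with h5 | h5
          · exact h.succ_not_mem_shiftedSet hM huM (h5 ▸ h1.1)
          · rw [h5, Equiv.apply_symm_apply] at h4
            exact h4 hcu
        · exact h.not_mem_shiftedSet_of_near hM (h.near_of_adj_bad hM h1 huv.symm huS) huR
      · exact hvS h1
  by_cases hear : IsEar G σ u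
  · -- one of the two neighbours of the ear `u` has colour `j`
    have key : ∀ v, G.Adj u v → c v = j → NearEar G σ v → ∃ v, G.Adj u v ∧
        v ∉ finalSet G σ c M j ∧ ∀ y ∈ flapSet G σ c j, G.Adj y v → G.Adj y u ∨
        ∃ s₁ s₂, s₁ ≠ s₂ ∧ G.Adj y s₁ ∧ G.Adj y s₂ ∧ s₁ ∉ finalSet G σ c M j ∧
        s₂ ∉ finalSet G σ c M j := fun v huv hcv hnear =>
      ⟨v, huv, h.not_mem_finalSet_of_near hM hnear, fun y hy hyv =>
        absurd hyv (h.not_flap_adj_of_near hcv hnear hy)⟩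
    by_cases hcs : c (σ u) = j
    · exact key _ (h.adj_succ u) hcs (near_succ hear)
    · exact key _ (h.adj_pred u) (colour_eq_of_ne hcu hcs (h.colour _ _ (h.adj_succ u))
        (h.colour _ _ (h.adj_pred u)).symm (h.colour _ _ hear)) (near_pred hear)
  · -- a pivot is exchanged with its successor, which it has replaced
    have huM := mem_of_mem_shiftedSet huR hcu hear
    obtain ⟨⟨⟨v, hv⟩, hs1, hs2, -⟩, -⟩ := (hM j u).1 huM
    have hsS : σ u ∉ finalSet G σ c M j := by
      rintro (h1 | ⟨h1, -⟩)
      · exact h1.2.2.1 hv.colour_succ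
      · exact h.succ_not_mem_shiftedSet hM huM h1
    refine ⟨σ u, h.adj_succ u, hsS, ?_⟩
    rintro y ⟨d, w, x, hy⟩ hyv
    right
    have hw := near_hub_of_flap hy
    exact ⟨w, σ u, fun hh => hs2 (hh ▸ hw), (hy.adj_iff w).2 (by simp), hyv,
      h.not_mem_finalSet_of_near hM hw, hsS⟩

end Selection

end IsColouredPolygon

/-! ### Counting -/

namespace IsColouredPolygon

variable {V : Type*} {G : SimpleGraph V} {σ : Equiv.Perm V} {c : V → Fin 3} {j : Fin 3}
  {M : Fin 3 → Set V} {u v : V}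

/-- The selection may start at an ear, as neither an ear nor its successor is a pivot. -/
lemma exists_isSelection (h : IsColouredPolygon G σ c) : ∃ M, IsSelection G σ c M := by
  obtain ⟨v, hv⟩ := h.exists_ear
  have : ∀ j, ∃ M : Set V, ∀ y, y ∈ M ↔ y ∈ pivotSet G σ c j ∧ σ.symm (σ.symm y) ∉ M := by
    intro j
    refine h.alternating _ v ?_ ?_
    · rintro ⟨⟨w, hw⟩, -⟩
      exact h.not_ear_of_hub hw hv
    · rintro ⟨-, -, -, h1, -⟩
      rw [Equiv.symm_apply_apply] at h1
      exact h1 hv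
  choose M hM using this
  exact ⟨M, hM⟩

open Classical in
/-- A vertex that is replaced by the pivot before it is sent to this pivot. -/
lemma card_baseSet_le [Fintype V] (h : IsColouredPolygon G σ c) (hM : IsSelection G σ c M)
    (j : Fin 3) :
    (Finset.univ.filter (· ∈ baseSet G σ c j)).card ≤
      (Finset.univ.filter (· ∈ shiftedSet G σ c M j)).card := by
  have hdisj : ∀ v, v ∈ baseSet G σ c j → v ∉ M j := by
    rintro v (h1 | h1) h2
    · exact h.not_ear_of_mem hM h2 h1
    · exact h.colour_ne_of_mem hM h2 h1.1
  refine Finset.card_le_card_of_injOn (fun v => if σ.symm v ∈ M j then σ.symm v else v) ?_ ?_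
  · intro v hv
    simp only [Finset.coe_filter, Finset.mem_univ, true_and, Set.mem_ofPred_eq] at hv ⊢
    split_ifs with h1
    · exact Or.inl h1
    · exact Or.inr ⟨hv, h1⟩
  · intro v hv w hw hvw
    simp only [Finset.coe_filter, Finset.mem_univ, true_and, Set.mem_ofPred_eq] at hv hw hvw
    split_ifs at hvw with h1 h2 h2
    · exact σ.symm.injective hvw
    · exact absurd (hvw ▸ h1) (hdisj w hw)
    · exact absurd (hvw ▸ h2) (hdisj v hv)
    · exact hvw

open Classical in
/-- An ear belongs to all three classes, a neighbour of an ear to none, and every other vertex to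
one. -/
lemma weight_baseSet (h : IsColouredPolygon G σ c) (v : V) :
    (1 : ℤ) + 2 * (if IsEar G σ v then 1 else 0) - (if IsEar G σ (σ v) then 1 else 0) -
      (if IsEar G σ (σ.symm v) then 1 else 0) +
      (if IsEar G σ (σ v) ∧ IsEar G σ (σ.symm v) then 1 else 0) ≤
    ∑ j, if v ∈ baseSet G σ c j then 1 else 0 := by
  by_cases h1 : IsEar G σ v
  · have h2 := h.not_near_of_ear h1
    rw [NearEar, not_or] at h2
    simp [h1, h2.1, h2.2, baseSet]
  by_cases h2 : NearEar G σ v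
  · have h3 : (0 : ℤ) ≤ ∑ j, if v ∈ baseSet G σ c j then 1 else 0 :=
      Finset.sum_nonneg fun j _ => by split_ifs <;> simp
    refine le_trans ?_ h3
    rcases h2 with h2 | h2
    · by_cases h4 : IsEar G σ (σ.symm v) <;> simp [h1, h2, h4]
    · by_cases h4 : IsEar G σ (σ v) <;> simp [h1, h2, h4]
  · have h3 := h2
    rw [NearEar, not_or] at h3
    simp [h1, h3.1, h3.2, baseSet, h2]

open Classical in
/-- The passage to `finalSet` costs at most one class at the vertices given back for bad ears: a
moved vertex leaves one class and joins another one. -/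
lemma weight_finalSet (h : IsColouredPolygon G σ c) (hM : IsSelection G σ c M) (v : V) :
    (∑ j, if v ∈ shiftedSet G σ c M j then (1 : ℤ) else 0) ≤
      (∑ j, if v ∈ finalSet G σ c M j then 1 else 0) +
        if IsEar G σ (σ.symm (σ.symm (σ.symm (σ.symm v)))) ∧
          IsBad G σ c M (σ.symm (σ.symm (σ.symm (σ.symm v)))) then 1 else 0 := by
  obtain ⟨k, hk1, hk2⟩ : ∃ k, c v ≠ k ∧ c (σ v) ≠ k := by
    generalize c v = a
    generalize c (σ v) = b
    decide +revert
  set d := σ.symm (σ.symm (σ.symm (σ.symm v))) with hd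
  set P := IsBad G σ c M v ∧ ¬ IsEar G σ v with hP
  set Q := IsEar G σ d ∧ IsBad G σ c M d with hQ
  have key : ∀ j, (if v ∈ shiftedSet G σ c M j then (1 : ℤ) else 0) ≤
      (if v ∈ finalSet G σ c M j then 1 else 0) + (if c v = j then (if P then 1 else 0) else 0) -
        (if k = j then (if P then 1 else 0) else 0) +
        (if c d = j then (if Q then 1 else 0) else 0) := by
    intro j
    have hnn : (0 : ℤ) ≤ (if c d = j then (if Q then 1 else 0) else 0) := by
      split_ifs <;> simp
    by_cases hkP : k = j ∧ P
    · obtain ⟨rfl, hp⟩ := hkP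
      have hmov : IsMoved G σ c M k v := ⟨hp.1, hp.2, hk1, hk2⟩
      have hmem : v ∈ finalSet G σ c M k := Or.inl hmov
      rw [if_neg (h.not_mem_shiftedSet_of_moved hM hmov), if_pos hmem, if_neg hk1,
        if_pos rfl, if_pos hp]
      linarith
    · have h0 : (if k = j then (if P then (1 : ℤ) else 0) else 0) = 0 := by
        split_ifs with a1 a2
        · exact absurd ⟨a1, a2⟩ hkP
        · rfl
        · rfl
      rw [h0]
      have hnn' : (0 : ℤ) ≤ (if c v = j then (if P then 1 else 0) else 0) := by
        split_ifs <;> simp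
      have hnn'' : (0 : ℤ) ≤ (if v ∈ finalSet G σ c M j then 1 else 0) := by
        split_ifs <;> simp
      by_cases hv : v ∈ shiftedSet G σ c M j
      swap
      · rw [if_neg hv]; linarith
      rw [if_pos hv]
      by_cases h1 : c v = j ∧ P
      · rw [if_pos h1.1, if_pos h1.2]; linarith
      by_cases h2 : ∃ d, IsEar G σ d ∧ IsBad G σ c M d ∧ c d = j ∧ v = σ (σ (σ (σ d)))
      · obtain ⟨d', a1, a2, a3, a4⟩ := h2
        have hdd : d = d' := by rw [hd, a4]; simp
        rw [← hdd] at a1 a2 a3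
        have hq : Q := ⟨a1, a2⟩
        rw [if_pos a3, if_pos hq]; linarith
      · have hmem : v ∈ finalSet G σ c M j := Or.inr ⟨hv, h1, h2⟩
        rw [if_pos hmem]; linarith
  refine (Finset.sum_le_sum fun j _ => key j).trans (le_of_eq ?_)
  simp only [Finset.sum_add_distrib, Finset.sum_sub_distrib, Finset.sum_ite_eq, Finset.mem_univ,
    if_true]
  ring

open Classical in
/-- The surplus of `baseSet` over one class per vertex is the number of vertices between two ears,
which is at least the number of bad ears. -/
lemma card_le_sum_card_finalSet [Fintype V] (h : IsColouredPolygon G σ c)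
    (hM : IsSelection G σ c M) :
    Fintype.card V ≤ ∑ j, (Finset.univ.filter (· ∈ finalSet G σ c M j)).card := by
  have hcard : ∀ s : Fin 3 → Set V, ((∑ j, (Finset.univ.filter (· ∈ s j)).card : ℕ) : ℤ) =
      ∑ v, ∑ j, if v ∈ s j then 1 else 0 := by
    intro s
    rw [Finset.sum_comm]
    push_cast [Finset.card_filter]
    rfl
  have h1 := Finset.sum_le_sum fun v (_ : v ∈ Finset.univ) => h.weight_baseSet v
  have h2 : ∑ j, (Finset.univ.filter (· ∈ baseSet G σ c j)).card ≤
      ∑ j, (Finset.univ.filter (· ∈ shiftedSet G σ c M j)).card :=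
    Finset.sum_le_sum fun j _ => h.card_baseSet_le hM j
  have h3 := Finset.sum_le_sum fun v (_ : v ∈ Finset.univ) => h.weight_finalSet hM v
  zify at h2 ⊢
  rw [← Nat.cast_sum, ← Nat.cast_sum, hcard, hcard] at h2
  rw [← Nat.cast_sum, hcard]
  simp only [Finset.sum_add_distrib, Finset.sum_sub_distrib, ← Finset.mul_sum] at h1 h3
  rw [Equiv.sum_comp σ (fun v => if IsEar G σ v then (1 : ℤ) else 0),
    Equiv.sum_comp σ.symm (fun v => if IsEar G σ v then (1 : ℤ) else 0)] at h1
  have hshift : (∑ v, if IsEar G σ (σ.symm (σ.symm (σ.symm (σ.symm v)))) ∧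
      IsBad G σ c M (σ.symm (σ.symm (σ.symm (σ.symm v)))) then (1 : ℤ) else 0) =
      ∑ v, if IsEar G σ v ∧ IsBad G σ c M v then 1 else 0 :=
    Equiv.sum_comp (σ.symm.trans (σ.symm.trans (σ.symm.trans σ.symm)))
      (fun v => if IsEar G σ v ∧ IsBad G σ c M v then (1 : ℤ) else 0)
  rw [hshift] at h3
  rw [← Equiv.sum_comp σ (fun v => if IsEar G σ (σ v) ∧ IsEar G σ (σ.symm v) then (1 : ℤ) else 0)]
    at h1
  -- each bad ear `v` contributes a vertex `σ v` between two ears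
  have h4 : ∑ v, (if IsEar G σ v ∧ IsBad G σ c M v then (1 : ℤ) else 0) ≤
      ∑ v, if IsEar G σ (σ (σ v)) ∧ IsEar G σ (σ.symm (σ v)) then (1 : ℤ) else 0 := by
    refine Finset.sum_le_sum fun v _ => ?_
    by_cases hv : IsEar G σ v ∧ IsBad G σ c M v
    · rw [if_pos hv, if_pos ⟨(h.bad_ear hM hv.1 hv.2).1, by
        rw [Equiv.symm_apply_apply]; exact hv.1⟩]
    · rw [if_neg hv]; split_ifs <;> simp
  simp only [Finset.sum_const, Finset.card_univ, nsmul_eq_mul, mul_one] at h1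
  linarith

lemma degree_ne_two [Fintype V] [DecidableRel G.Adj] (h : IsColouredPolygon G σ c)
    (hv : ¬ IsEar G σ v) : G.degree v ≠ 2 := by
  classical
  obtain ⟨w, hw, h1, h2⟩ := h.not_ear v hv
  have hsub : ({σ v, σ.symm v, w} : Finset V) ⊆ G.neighborFinset v := by
    intro x hx
    rw [SimpleGraph.mem_neighborFinset]
    simp only [Finset.mem_insert, Finset.mem_singleton] at hx
    rcases hx with rfl | rfl | rfl
    · exact h.adj_succ v
    · exact h.adj_pred v
    · exact hw
  have hcard := Finset.card_le_card hsub
  rw [Finset.card_eq_three.2 ⟨_, _, _, h.succ_ne_pred v, h1.symm, h2.symm, rfl⟩,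
    SimpleGraph.card_neighborFinset_eq_degree] at hcard
  omega

/-- The complement of each `finalSet` is a secure total dominating set. -/
lemma isSecureTotalDominatingSet_compl (h : IsColouredPolygon G σ c) (hM : IsSelection G σ c M)
    (j : Fin 3) : G.IsSecureTotalDominatingSet (finalSet G σ c M j)ᶜ := by
  constructor
  · intro t
    rcases h.exists_two_or_flap_final hM t j with ⟨s, -, -, hs, -, hsS, -⟩ | ⟨d, v, x, ht⟩
    · exact ⟨s, hsS, hs⟩
    · exact ⟨v, h.not_mem_finalSet_of_near hM (near_hub_of_flap ht), (ht.adj_iff v).2 (by simp)⟩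
  · intro u hu
    rw [Set.mem_compl_iff, not_not] at hu
    obtain ⟨v, huv, hv, hflap⟩ := h.exists_defender hM hu
    refine ⟨v, hv, huv, fun t => ?_⟩
    have two : (∃ s₁ s₂, s₁ ≠ s₂ ∧ G.Adj t s₁ ∧ G.Adj t s₂ ∧ s₁ ∉ finalSet G σ c M j ∧
        s₂ ∉ finalSet G σ c M j) →
        ∃ s ∈ ((finalSet G σ c M j)ᶜ \ {v}) ∪ {u}, G.Adj t s := by
      rintro ⟨s₁, s₂, hne, a1, a2, b1, b2⟩
      by_cases hs : s₁ = v
      · exact ⟨s₂, Or.inl ⟨b2, fun hh => hne (hs.trans hh.symm)⟩, a2⟩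
      · exact ⟨s₁, Or.inl ⟨b1, hs⟩, a1⟩
    rcases h.exists_two_or_flap_final hM t j with h1 | ht
    · exact two h1
    by_cases htv : G.Adj t v
    · rcases hflap t ht htv with h1 | h1
      · exact ⟨u, Or.inr rfl, h1⟩
      · exact two h1
    · obtain ⟨d, w, x, ht⟩ := ht
      have htw : G.Adj t w := (ht.adj_iff w).2 (by simp)
      exact ⟨w, Or.inl ⟨h.not_mem_finalSet_of_near hM (near_hub_of_flap ht),
        fun hh => htv (hh ▸ htw)⟩, htw⟩

lemma exists_secureTotalDominatingSet [Fintype V] [DecidableRel G.Adj]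
    (h : IsColouredPolygon G σ c) :
    ∃ S : Finset V, G.IsSecureTotalDominatingSet (S : Set V) ∧
      S.card ≤ 2 * Fintype.card V / 3 ∧ ∀ v ∈ S, G.degree v ≠ 2 := by
  classical
  obtain ⟨M, hM⟩ := h.exists_isSelection
  obtain ⟨j, hj⟩ : ∃ j, Fintype.card V ≤
      3 * (Finset.univ.filter (· ∈ finalSet G σ c M j)).card := by
    have h1 := h.card_le_sum_card_finalSet hM
    rw [Fin.sum_univ_three] at h1
    by_contra! hno
    have h2 := hno 0
    have h3 := hno 1
    have h4 := hno 2
    omega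
  refine ⟨(Finset.univ.filter (· ∈ finalSet G σ c M j))ᶜ, ?_, ?_, ?_⟩
  · convert h.isSecureTotalDominatingSet_compl hM j
    ext v; simp
  · rw [Finset.card_compl]; omega
  · intro v hv
    refine h.degree_ne_two fun hear => ?_
    rw [Finset.mem_compl, Finset.mem_filter] at hv
    exact hv ⟨Finset.mem_univ v, h.mem_finalSet_of_ear hM hear⟩

end IsColouredPolygon

/-- In a triangulated quadrilateral the two ends of the diagonal form the desired set. -/
lemma IsTriangulation.exists_secureTotalDominatingSet_of_four {V : Type*} [Fintype V]
    {G : SimpleGraph V} [DecidableRel G.Adj] {e : ℤ → V} (h : IsTriangulation G 4 e) :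
    ∃ S : Finset V, G.IsSecureTotalDominatingSet (S : Set V) ∧ S.card ≤ 2 ∧
      ∀ v ∈ S, G.degree v ≠ 2 := by
  classical
  obtain ⟨i, hi⟩ := h.exists_ear (by omega)
  have h01 := h.adj_succ (by omega) i
  have h12 := h.adj_succ (by omega) (i + 1)
  have h23 := h.adj_succ (by omega) (i + 2)
  have h30 := h.adj_succ (by omega) (i + 3)
  have hpq : e (i + 1) ≠ e (i + 3) := h.ne_of_lt (by omega) (by omega)
  have hall : ∀ v, v = e i ∨ v = e (i + 1) ∨ v = e (i + 2) ∨ v = e (i + 3) := by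
    intro v
    obtain ⟨k, h1, h2, rfl⟩ := h.exists_index (by omega) i v
    obtain rfl | rfl | rfl | rfl : k = i ∨ k = i + 1 ∨ k = i + 2 ∨ k = i + 3 := by
      push_cast at h2; omega
    all_goals simp
  rw [show i + 1 + 1 = i + 2 by ring] at h12
  rw [show i + 2 + 1 = i + 3 by ring] at h23
  rw [show i + 3 + 1 = i + (4 : ℕ) by push_cast; ring, h.apply_add_period] at h30
  generalize e i = a at *
  generalize e (i + 1) = p at *
  generalize e (i + 2) = b at *
  generalize e (i + 3) = q at *
  have hdeg : ∀ x y, G.Adj x y → G.Adj x p → G.Adj x q → G.Adj y p → G.Adj y q →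
      G.degree x ≠ 2 := by
    intro x y h1 h2 h3 h4 h5
    have hsub : ({y, p, q} : Finset V) ⊆ G.neighborFinset x := by
      intro z hz
      rw [SimpleGraph.mem_neighborFinset]
      simp only [Finset.mem_insert, Finset.mem_singleton] at hz
      rcases hz with rfl | rfl | rfl <;> assumption
    have hcard := Finset.card_le_card hsub
    rw [Finset.card_eq_three.2 ⟨_, _, _, h4.ne, h5.ne, hpq, rfl⟩,
      SimpleGraph.card_neighborFinset_eq_degree] at hcard
    omega
  have hdom : ∀ r, G.Adj b r →
      G.IsTotalDominatingSet (((({a, b} : Finset V) : Set V) \ {a}) ∪ {r}) := by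
    intro r hr t
    rcases hall t with rfl | rfl | rfl | rfl
    · exact ⟨b, Or.inl ⟨by simp, hi.ne'⟩, hi⟩
    · exact ⟨b, Or.inl ⟨by simp, hi.ne'⟩, h12⟩
    · exact ⟨r, Or.inr rfl, hr⟩
    · exact ⟨b, Or.inl ⟨by simp, hi.ne'⟩, h23.symm⟩
  refine ⟨{a, b}, ⟨fun t => ?_, fun u hu => ?_⟩, Finset.card_le_two, fun v hv => ?_⟩
  · rcases hall t with rfl | rfl | rfl | rfl
    · exact ⟨b, by simp, hi⟩
    · exact ⟨a, by simp, h01.symm⟩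
    · exact ⟨a, by simp, hi.symm⟩
    · exact ⟨a, by simp, h30⟩
  · rcases hall u with rfl | rfl | rfl | rfl
    · simp at hu
    · exact ⟨a, by simp, h01.symm, hdom _ h12.symm⟩
    · simp at hu
    · exact ⟨a, by simp, h30, hdom _ h23⟩
  · simp only [Finset.mem_insert, Finset.mem_singleton] at hv
    rcases hv with rfl | rfl
    · exact hdeg _ b hi h01 h30.symm h12.symm h23
    · exact hdeg _ a hi.symm h12.symm h23 h01 h30.symm

theorem mainTheorem2 {V : Type*} [Fintype V] (G : SimpleGraph V) [DecidableRel G.Adj]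
    (hG : G.IsMaximalOuterplanar) (hn : 4 ≤ Fintype.card V) :
    ∃ S : Finset V, G.IsSecureTotalDominatingSet (S : Set V) ∧
      S.card ≤ 2 * Fintype.card V / 3 ∧ ∀ v ∈ S, G.degree v ≠ 2 := by
  obtain ⟨e, he⟩ := hG.exists_isTriangulation (by omega)
  rcases hn.eq_or_lt with h4 | h5
  · rw [← h4] at he ⊢
    exact he.exists_secureTotalDominatingSet_of_four
  · obtain ⟨σ, c, h⟩ := he.exists_isColouredPolygon h5
    exact h.exists_secureTotalDominatingSet
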